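/- **Setting.** Let $U=\mathbb R^3/\mathbb Z^3$ with its Euclidean distance, and let $0<T<\infty$. Let $f_0,g_0$ be probability densities on $U\times\mathbb R^3$ (fixed nonnegative measurable representatives) such that: - $\int f_0(x,v)(1+|v|^2)\,dx\,dv<\infty$; - with $\bar g(v)=\operatorname{ess\,sup}_x g_0(x,v)$, both $\int\bar g(v)(1+|v|^2)\,dv<\infty$ and $\operatorname{ess\,sup}_v\bar g(v)(1+|v|)<\infty$; - $g_0(\cdot,v)\in W^{1,1}(U)$ for almost all $v$, and $\operatorname{ess\,sup}_x\int|\partial_xg_0(x,v)|(1+|v|)\,dv<\infty$; - there are $L>0$, $\alpha\in(0,1]$ such that for almost all $v$, $|g_0(x,v)-g_0(y,v)|\le L|x-y|^\alpha$ for all $x,y\in U$. Write $g_t(x,v)=g_0(x-tv,v)$ and $[a]_+=\max(a,0)$. **Dynamics.** Let $N\varepsilon^2=1$. A tagged particle with initial state of density $f_0$ and $N$ background particles with initial states of density $g_0$, all independent, move freely on $U$. When the tagged particle (position $x$, velocity $v$) and a background particle (velocity $w$) reach distance $\varepsilon$, the latter being at $x+\varepsilon\nu$, $\nu\in\mathbb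 S^2$, their velocities become $v-((v-w)\cdot\nu)\nu$ and $w+((v-w)\cdot\nu)\nu$. Background particles do not interact with each other. **Trees.** A tree $\Phi=((x_0,v_0),(t_1,\nu_1,v_1),\dots,(t_n,\nu_n,v_n))$, $n\ge0$, $0\le t_1<\dots<t_n\le T$, records the initial state of the tagged particle and the times, directions and incoming background velocities of its collisions. It determines the path $(x(t),v(t))$ of the tagged particle and, for each $j$, the path $(x_j(t),v_j(t))$ of the background particle of collision $j$, which flies freely before and after $t_j$ and is at $x(t_j)+\varepsilon\nu_j$ at time $t_j$. Put $\tau=t_n$ ($\tau=0$ if $n=0$); for $n\ge1$ write $(\tau,\nu,v')=(t_n,\nu_n,v_n)$, and let $\bar\Phi$ be $\Phi$ without its final collision. The set of trees carries the measure $dx_0\,dv_0\prod_j dt_j\,d\nu_j\,dv_j$. Let $V,M:(0,\infty)\to[0,\infty)$ be decreasing, tending to $\infty$ at $0$, with $\varepsilon V(\varepsilon)^3\le\frac18$ and $M(\varepsilon)\le\varepsilon^{-1/2}$ for $0<\varepsilon<1$. The tree $\Phi$ is good, $\Phi\in\mathcal G(\varepsilon)$, if $n\le M(\varepsilon)$;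 $|v(t)|,|v_j(t)|\le V(\varepsilon)$ for all $t\in[0,T]$ and all $j$; $|x(t)-x_j(t)|>\varepsilon$ for all $j$ and all $t\in[0,T]\setminus\{t_j\}$; $|x_0-x_j(0)|>\varepsilon$ for all $j$; and $\nu_j\cdot(v(t_j^-)-v_j)>0$ for all $j$. **Empirical distribution.** For $t\in[0,T]$ and a measurable set $A$ of trees, $\hat P^\varepsilon_t(A)$ is the probability that no background particle is initially within distance $\varepsilon$ of the tagged one and that the tree formed by the initial state of the tagged particle and its collisions in $(0,t]$ lies in $A$. **Operators.** Let $\mathbb 1^\varepsilon_t[\Phi](\bar x,\bar v)=1$ if $|x(s)-(\bar x+s\bar v)|>\varepsilon$ for all $s\in(0,t)$, and $0$ otherwise, and let $m_t^\varepsilon(\Phi)=\int g_0\,\mathbb 1_t^\varepsilon[\Phi]\,d\bar x\,d\bar v$. Put $$\hat{\mathcal Q}^{\varepsilon,+}_t[P_t](\Phi)=\delta(t-\tau)\,P_t(\bar\Phi)\,\frac{g_\tau(x(\tau)+\varepsilon\nu,v')\,[(v(\tau^-)-v')\cdot\nu]_+}{m^\varepsilon_\tau(\Phi)}\quad(n\ge1),\qquad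 \hat{\mathcal Q}^{\varepsilon,+}_t[P_t](\Phi)=0\quad(n=0),$$ $$\hat{\mathcal Q}^{\varepsilon,-}_t[P_t](\Phi)=P_t(\Phi)\,\frac{\int_{\mathbb S^2}\int_{\mathbb R^3}g_t(x(t)+\varepsilon\nu,\bar v)[(v(\tau)-\bar v)\cdot\nu]_+\,d\bar v\,d\nu-\hat C_t^\varepsilon(\Phi)}{m_t^\varepsilon(\Phi)},\qquad \hat{\mathcal Q}^\varepsilon_t=\hat{\mathcal Q}^{\varepsilon,+}_t-\hat{\mathcal Q}^{\varepsilon,-}_t .$$ For $t\ge 0$ and $h>0$ let $B^\varepsilon_{t,h}(\Phi)$ be the set of $(\bar x,\bar v)$ with $\mathbb 1_t^\varepsilon[\Phi](\bar x,\bar v)=0$ for which there are $s\in(t,t+h)$, $\nu\in\mathbb S^2$ with $x(s)+\varepsilon\nu=\bar x+s\bar v$ and $(v(s)-\bar v)\cdot\nu>0$. Finally $$\zeta^\varepsilon(\Phi)=\Big(1-\int_{B_\varepsilon(x_0)}\int_{\mathbb R^3}g_0\,d\bar v\,d\bar x\Big)^N,\qquad \gamma^\varepsilon(t)=\begin{cases}1&t<\tau\\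 n(\bar\Phi)\varepsilon^2&t=\tau\\ n(\Phi)\varepsilon^2&t>\tau.\end{cases}$$ **Theorem.** There are $\varepsilon_0>0$ and numbers $\hat C^\varepsilon_t(\Phi)$ such that: 1. If $\Phi$ is good for some diameter and $t\in(\tau,T]$, then $\hat C_t^\varepsilon(\Phi)\to0$ as $\varepsilon\to0$. 2. If $0<\varepsilon<\varepsilon_0$, $\Phi\in\mathcal G(\varepsilon)$ and $t\in(\tau,T]$, then $\hat C^\varepsilon_t(\Phi)\ge0$ and $$\hat C_t^\varepsilon(\Phi)=\lim_{h\downarrow0}\frac1{h\varepsilon^2}\int_{B^\varepsilon_{t,h}(\Phi)}g_0=\lim_{h\downarrow0}\frac1{h\varepsilon^2}\int_{B^\varepsilon_{t-h,h}(\Phi)}g_0 .$$ 3. If $0<\varepsilon<\varepsilon_0$ and $N\varepsilon^2=1$ with $N\in\mathbb N$, then $m^\varepsilon_t(\Phi)>0$ for all $\Phi\in\mathcal G(\varepsilon)$ and $t\in[0,T]$, and there are measurable functions $\hat P_t^\varepsilon(\Phi)\ge0$, $t\in[0,T]$, which are densities of the measures $\hat P_t^\varepsilon$ on the set of non-grazing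 trees that are free from initial overlap and satisfy $|x(s)-x_j(s)|>\varepsilon$ for all $j$ and $s\in[0,t]\setminus\{t_j\}$ (this set contains $\mathcal G(\varepsilon)$ and, for $t=\tau(\Phi)$, the pruned trees $\bar\Phi$ of $\Phi\in\mathcal G(\varepsilon)$), such that for every $\Phi\in\mathcal G(\varepsilon)$ $$\partial_t\hat P^\varepsilon_t(\Phi)=(1-\gamma^\varepsilon(t))\,\hat{\mathcal Q}^\varepsilon_t[\hat P_t^\varepsilon](\Phi)\ \text{ on }[0,T],\qquad \hat P^\varepsilon_0(\Phi)=\zeta^\varepsilon(\Phi)f_0(x_0,v_0)\mathbb 1_{n(\Phi)=0}.$$ Here the equation means that $t\mapsto\hat P_t^\varepsilon(\Phi)$ is differentiable on $[0,T]\setminus\{\tau\}$ (one-sidedly at $0$ and $T$) with derivative $-(1-\gamma^\varepsilon(t))\hat{\mathcal Q}^{\varepsilon,-}_t[\hat P^\varepsilon_t](\Phi)$, is right continuous at $\tau$, and, if $\tau>0$, jumps at $\tau$ by $(1-\gamma^\varepsilon(\tau))$ times the coefficient of $\delta(t-\tau)$ in $\hat{\mathcal Q}^{\varepsilon,+}_t$.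 -/

import Mathlib

open MeasureTheory Filter Topology Set

noncomputable section

namespace RayleighGas

/-! ### Phase space -/

/-- Velocities. -/
abbrev Vel := EuclideanSpace ℝ (Fin 3)

/-- The box `[0,1]^3` with periodic boundary conditions, i.e. the torus `ℝ^3 / ℤ^3`. Its `volume` is
Lebesgue measure, of total mass one. -/
abbrev Torus := UnitAddTorus (Fin 3)

/-- Position and velocity of one particle. -/
abbrev Phase := Torus × Vel

/-- The unit sphere of `ℝ^3`. -/
abbrev Sph := Metric.sphere (0 : Vel) 1

/-- Surface measure on the unit sphere. -/
def sphereMeasure : Measure Sph := (volume : Measure Vel).toSphere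

/-- The point `x + u` of the torus, for a vector `u`. -/
def shift (x : Torus) (u : Vel) : Torus := fun i => x i + ((u i : ℝ) : UnitAddCircle)

/-- The Euclidean distance `|x - y|` on the torus (the norm of `UnitAddCircle` is the distance of a
representative to the nearest integer). -/
def torusDist (x y : Torus) : ℝ := √(∑ i, ‖x i - y i‖ ^ 2)

/-! ### Admissible initial densities -/

/-- `f₀` is a tagged-admissible probability density. -/
structure TaggedAdmissible (f₀ : Phase → ℝ) : Prop where
  measurable : Measurable f₀
  nonneg : ∀ q, 0 ≤ f₀ q
  mass : ∫⁻ q, ENNReal.ofReal (f₀ q) = 1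
  moment : ∫⁻ q, ENNReal.ofReal (f₀ q * (1 + ‖q.2‖ ^ 2)) < ⊤

/-- `gbar v` is the essential supremum of `g₀ (x, v)` over `x`. -/
def gbar (g₀ : Phase → ℝ) (v : Vel) : ENNReal :=
  essSup (fun x : Torus => ENNReal.ofReal (g₀ (x, v))) volume

/-- The function `u` on the torus lies in `W^{1,1}`, with weak gradient `Du`. -/
def HasWeakGradient (u : Torus → ℝ) (Du : Torus → Vel) : Prop :=
  Integrable u ∧ Integrable Du ∧
    ∀ φ : Torus → ℝ,
      ContDiff ℝ ((⊤ : ℕ∞) : WithTop ℕ∞) (fun z : Vel => φ (fun i => ((z i : ℝ) : UnitAddCircle))) →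
      ∀ i : Fin 3,
        ∫ x, u x * deriv (fun r : ℝ => φ (shift x (r • EuclideanSpace.single i (1 : ℝ)))) 0
          = - ∫ x, Du x i * φ x

/-- `g₀` is a background-admissible probability density. -/
structure BackgroundAdmissible (g₀ : Phase → ℝ) : Prop where
  measurable : Measurable g₀
  nonneg : ∀ q, 0 ≤ g₀ q
  mass : ∫⁻ q, ENNReal.ofReal (g₀ q) = 1
  moment : ∫⁻ v, gbar g₀ v * ENNReal.ofReal (1 + ‖v‖ ^ 2) < ⊤
  bounded : essSup (fun v => gbar g₀ v * ENNReal.ofReal (1 + ‖v‖)) volume < ⊤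
  sobolev : ∃ Dg : Phase → Vel, Measurable Dg ∧
    (∀ᵐ v : Vel, HasWeakGradient (fun x => g₀ (x, v)) (fun x => Dg (x, v))) ∧
    essSup (fun x : Torus => ∫⁻ v, ENNReal.ofReal (‖Dg (x, v)‖ * (1 + ‖v‖))) volume < ⊤
  holder : ∃ M > 0, ∃ α : ℝ, 0 < α ∧ α ≤ 1 ∧
    ∀ᵐ v : Vel, ∀ x y : Torus, |g₀ (x, v) - g₀ (y, v)| ≤ M * torusDist x y ^ α

/-- The background density transported freely up to time `t`: `g_t (x, v) = g₀ (x - t v, v)`. -/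
def transported (g₀ : Phase → ℝ) (t : ℝ) (q : Phase) : ℝ := g₀ (shift q.1 (-(t • q.2)), q.2)

/-! ### The particle dynamics -/

/-- A state of the tagged particle (first component) and of `N` background particles. -/
abbrev Config (N : ℕ) := Phase × (Fin N → Phase)

/-- What a tree records about a collision: its time, the unit vector pointing from the tagged to the
background particle, and the velocity of the background particle before the collision. -/
abbrev Mark := ℝ × Sph × Vel

/-- Free flight of one particle for a time `s`. -/
def flyOne (s : ℝ) (q : Phase) : Phase := (shift q.1 (s • q.2), q.2)

/-- Free flight of all particles for a time `s`. -/
def fly {N : ℕ} (s : ℝ) (S : Config N) : Config N := (flyOne s S.1, fun i => flyOne s (S.2 i))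

/-- The momentum `((v - w)·ν) ν` which a particle of velocity `v` passes on to one of velocity `w`. -/
def impulse (v w : Vel) (ν : Sph) : Vel := inner ℝ (v - w) (ν : Vel) • (ν : Vel)

/-- The hard-sphere collision of the tagged particle with background particle `i`, in direction `ν`. -/
def collide {N : ℕ} (i : Fin N) (ν : Sph) (S : Config N) : Config N :=
  ((S.1.1, S.1.2 - impulse S.1.2 (S.2 i).2 ν),
    Function.update S.2 i ((S.2 i).1, (S.2 i).2 + impulse S.1.2 (S.2 i).2 ν))

/-- Background particle `i` is farther than `ε` away from the tagged particle. -/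
def Apart {N : ℕ} (ε : ℝ) (S : Config N) (i : Fin N) : Prop := ε < torusDist S.1.1 (S.2 i).1

/-- The dynamics, for initial states without overlap. `Evolves ε ω t h S` says: the particles of
diameter `ε`, started in `ω`, are in the state `S` at time `t`, and `h` lists the collisions of the
tagged particle during `(0, t]`, in the order of time. Particles fly freely as long as all background
particles are farther than `ε` from the tagged one; when exactly one of them reaches distance `ε`,
it and the tagged particle undergo a hard-sphere collision. Background particles ignore each other.
States in which several background particles touch the tagged one at once, or one of them grazes it,
are not continued (they form a null set). -/
inductive Evolves {N : ℕ} (ε : ℝ) (ω : Config N) : ℝ → List Mark → Config N → Prop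
  | start : (∀ i, Apart ε ω i) → Evolves ε ω 0 [] ω
  | free {s s' : ℝ} {h : List Mark} {S : Config N} :
      Evolves ε ω s h S → s ≤ s' →
      (∀ r ∈ Ioc s s', ∀ i, Apart ε (fly (r - s) S) i) →
      Evolves ε ω s' h (fly (s' - s) S)
  | collision {s s' : ℝ} {h : List Mark} {S : Config N} (i : Fin N) (ν : Sph) :
      Evolves ε ω s h S → s < s' →
      (∀ r ∈ Ioo s s', ∀ j, Apart ε (fly (r - s) S) j) →
      (∀ j, j ≠ i → Apart ε (fly (s' - s) S) j) →
      ((fly (s' - s) S).2 i).1 = shift (fly (s' - s) S).1.1 (ε • (ν : Vel)) →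
      0 < inner ℝ (S.1.2 - (S.2 i).2) (ν : Vel) →
      Evolves ε ω s' (h ++ [(s', ν, (S.2 i).2)]) (collide i ν (fly (s' - s) S))

/-- The law of the initial state: independent particles, the tagged one with density `f₀`, the
background particles with density `g₀`. -/
def initialLaw (f₀ g₀ : Phase → ℝ) (N : ℕ) : Measure (Config N) :=
  ((volume : Measure Phase).withDensity fun q => ENNReal.ofReal (f₀ q)).prod
    (Measure.pi fun _ : Fin N =>
      (volume : Measure Phase).withDensity fun q => ENNReal.ofReal (g₀ q))

/-! ### Trees -/

/-- A marked tree: the number of collisions, the initial position and velocity of the tagged particle,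
and the marks of the collisions. -/
abbrev CollisionTree := Σ n : ℕ, Phase × (Fin n → Mark)

/-- Lebesgue measure on trees. -/
def treeMeasure : Measure CollisionTree :=
  Measure.sum fun n =>
    ((volume : Measure Phase).prod
      (Measure.pi fun _ : Fin n =>
        (volume : Measure ℝ).prod (sphereMeasure.prod (volume : Measure Vel)))).map
      (Sigma.mk (β := fun n : ℕ => Phase × (Fin n → Mark)) n)

namespace CollisionTree

/-- The number of collisions. -/
def n (Φ : CollisionTree) : ℕ := Φ.1

/-- Initial position of the tagged particle. -/
def x₀ (Φ : CollisionTree) : Torus := Φ.2.1.1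

/-- Initial velocity of the tagged particle. -/
def v₀ (Φ : CollisionTree) : Vel := Φ.2.1.2

/-- Time of collision `j`. -/
def time (Φ : CollisionTree) (j : Fin Φ.n) : ℝ := (Φ.2.2 j).1

/-- Collision parameter of collision `j`. -/
def dir (Φ : CollisionTree) (j : Fin Φ.n) : Sph := (Φ.2.2 j).2.1

/-- Velocity of the background particle before collision `j`. -/
def inVel (Φ : CollisionTree) (j : Fin Φ.n) : Vel := (Φ.2.2 j).2.2

/-- The time `τ` of the final collision, `0` if there is none. -/
def tau : CollisionTree → ℝ
  | ⟨0, _⟩ => 0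
  | ⟨n + 1, a⟩ => (a.2 (Fin.last n)).1

/-- The pruned tree, in which the final collision is removed (only used for `n ≥ 1`). -/
def prune : CollisionTree → CollisionTree
  | ⟨0, a⟩ => ⟨0, a⟩
  | ⟨n + 1, a⟩ => ⟨n, a.1, Fin.init a.2⟩

/-- Velocity of the tagged particle after the first `k` collisions. In particular `velAfter Φ j` is its
velocity just before collision `j`, when collisions are numbered from `0`. -/
def velAfter (Φ : CollisionTree) : ℕ → Vel
  | 0 => Φ.v₀
  | k + 1 =>
    if h : k < Φ.n then
      velAfter Φ k - impulse (velAfter Φ k) (Φ.inVel ⟨k, h⟩) (Φ.dir ⟨k, h⟩)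
    else velAfter Φ k

/-- Velocity `v(s)` of the tagged particle at time `s`. -/
def vel (Φ : CollisionTree) (s : ℝ) : Vel :=
  velAfter Φ (Finset.univ.filter fun j : Fin Φ.n => Φ.time j ≤ s).card

/-- Position `x(s)` of the tagged particle at time `s`: the continuous path which starts at `x₀` and has
velocity `v(s)`. -/
def pos (Φ : CollisionTree) (s : ℝ) : Torus :=
  shift Φ.x₀ (s • Φ.v₀ +
    ∑ j : Fin Φ.n, max (s - Φ.time j) 0 • (velAfter Φ (j + 1) - velAfter Φ j))

/-- Velocity at time `s` of the background particle of collision `j`. -/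
def bgVel (Φ : CollisionTree) (j : Fin Φ.n) (s : ℝ) : Vel :=
  if s < Φ.time j then Φ.inVel j
  else Φ.inVel j + impulse (velAfter Φ j) (Φ.inVel j) (Φ.dir j)

/-- Position at time `s` of the background particle of collision `j`: it flies freely before and after the
collision, in which it is at `x(t_j) + ε ν_j`. -/
def bgPos (ε : ℝ) (Φ : CollisionTree) (j : Fin Φ.n) (s : ℝ) : Torus :=
  shift (Φ.pos (Φ.time j)) (ε • (Φ.dir j : Vel) + (s - Φ.time j) • Φ.bgVel j s)

/-- Membership in the set of collision trees: increasing collision times in `[0, T]`. -/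
def IsTree (T : ℝ) (Φ : CollisionTree) : Prop := StrictMono Φ.time ∧ ∀ j, Φ.time j ∈ Icc 0 T

/-- All velocities involved in the tree during `[0, T]` are bounded by `b`. -/
def SpeedLe (T : ℝ) (Φ : CollisionTree) (b : ℝ) : Prop :=
  ∀ s ∈ Icc 0 T, ‖Φ.vel s‖ ≤ b ∧ ∀ j, ‖Φ.bgVel j s‖ ≤ b

/-- Re-collision free at diameter `ε` up to time `t`. -/
def RecollisionFree (ε t : ℝ) (Φ : CollisionTree) : Prop :=
  ∀ j, ∀ s ∈ Icc 0 t, s ≠ Φ.time j → ε < torusDist (Φ.pos s) (Φ.bgPos ε j s)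

/-- All collisions are non-grazing. -/
def NonGrazing (Φ : CollisionTree) : Prop :=
  ∀ j : Fin Φ.n, 0 < inner ℝ (Φ.dir j : Vel) (velAfter Φ j - Φ.inVel j)

/-- Free from initial overlap at diameter `ε`. -/
def NoInitialOverlap (ε : ℝ) (Φ : CollisionTree) : Prop :=
  ∀ j, ε < torusDist Φ.x₀ (Φ.bgPos ε j 0)

end CollisionTree

/-- The cut-off functions `V`, `M` for velocities and numbers of collisions. -/
structure CutOffs (V M : ℝ → ℝ) : Prop where
  nonneg : ∀ ε > 0, 0 ≤ V ε ∧ 0 ≤ M ε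
  antitone_V : AntitoneOn V (Ioi 0)
  antitone_M : AntitoneOn M (Ioi 0)
  tendsto_V : Tendsto V (𝓝[>] 0) atTop
  tendsto_M : Tendsto M (𝓝[>] 0) atTop
  bound : ∀ ε ∈ Ioo (0 : ℝ) 1, ε * V ε ^ 3 ≤ 1 / 8 ∧ M ε ≤ 1 / √ε

/-- The set of good trees of diameter `ε`. -/
def goodTrees (T : ℝ) (V M : ℝ → ℝ) (ε : ℝ) : Set CollisionTree :=
  {Φ | Φ.IsTree T ∧ (Φ.n : ℝ) ≤ M ε ∧ Φ.SpeedLe T (V ε) ∧ Φ.RecollisionFree ε T ∧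
    Φ.NoInitialOverlap ε ∧ Φ.NonGrazing}

/-- Trees that are re-collision free up to time `t` (rather than `T`), non-grazing and free from initial
overlap. They include the good trees, and at time `t = τ` the pruned good trees. -/
def regularTrees (T ε t : ℝ) : Set CollisionTree :=
  {Φ | Φ.IsTree T ∧ Φ.RecollisionFree ε t ∧ Φ.NoInitialOverlap ε ∧ Φ.NonGrazing}

/-- The empirical distribution: the probability that initially no background particle overlaps the
tagged one, and that the tree formed by the initial state of the tagged particle and by its collisions
up to time `t` belongs to `A`. -/
def empirical (f₀ g₀ : Phase → ℝ) (N : ℕ) (ε t : ℝ) (A : Set CollisionTree) : ENNReal :=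
  initialLaw f₀ g₀ N
    {ω | ∃ Φ ∈ A, Φ.2.1 = ω.1 ∧ ∃ S, Evolves ε ω t (List.ofFn Φ.2.2) S}

/-! ### The empirical equation -/

/-- The initial states `(x, v)` for which the free flight `x + s v` stays farther than `ε` from the tagged
particle of `Φ` for `s ∈ (0, t)`: the indicator function of this set is `1_t^ε[Φ]`. -/
def avoiding (ε t : ℝ) (Φ : CollisionTree) : Set Phase :=
  {q | ∀ s ∈ Ioo 0 t, ε < torusDist (Φ.pos s) (shift q.1 (s • q.2))}

/-- The mass of background particles not yet hit, `∫ g₀ 1_t^ε[Φ]`. -/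
def freeMass (g₀ : Phase → ℝ) (ε t : ℝ) (Φ : CollisionTree) : ℝ := ∫ q in avoiding ε t Φ, g₀ q

/-- The initial states whose free flight collides with the tagged particle of `Φ` at some time in
`(t, t + h)`. -/
def hitting (ε t h : ℝ) (Φ : CollisionTree) : Set Phase :=
  {q | ∃ s ∈ Ioo t (t + h), ∃ ν : Sph,
    shift (Φ.pos s) (ε • (ν : Vel)) = shift q.1 (s • q.2) ∧ 0 < inner ℝ (Φ.vel s - q.2) (ν : Vel)}

/-- The initial states whose free flight meets the tagged particle of `Φ` both in `(0, t)` and in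
`(t, t + h)`. -/
def hittingTwice (ε t h : ℝ) (Φ : CollisionTree) : Set Phase := hitting ε t h Φ \ avoiding ε t Φ

/-- The collision rate
`∫_{S²} ∫_{ℝ³} g_t (x(t) + ε ν, w) [(v(τ) - w)·ν]_+ dw dν`. -/
def collisionRate (g₀ : Phase → ℝ) (ε t : ℝ) (Φ : CollisionTree) : ℝ :=
  ∫ ν : Sph, (∫ w : Vel, transported g₀ t (shift (Φ.pos t) (ε • (ν : Vel)), w) *
    max (inner ℝ (Φ.vel Φ.tau - w) (ν : Vel)) 0) ∂sphereMeasure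

/-- The loss operator applied to `P` at time `t`, with correction `C` to the collision rate. -/
def lossTerm (g₀ : Phase → ℝ) (C : ℝ) (ε t : ℝ) (P : CollisionTree → ℝ) (Φ : CollisionTree) : ℝ :=
  P Φ * ((collisionRate g₀ ε t Φ - C) / freeMass g₀ ε t Φ)

/-- The coefficient of `δ(t - τ)` in the gain operator applied to `P`, the distribution at time `τ`. -/
def gainCoeff (g₀ : Phase → ℝ) (ε : ℝ) (P : CollisionTree → ℝ) (Φ : CollisionTree) : ℝ :=
  if h : 0 < Φ.n then
    let j : Fin Φ.n := ⟨Φ.n - 1, Nat.sub_lt h Nat.one_pos⟩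
    P Φ.prune *
      (transported g₀ Φ.tau (shift (Φ.pos Φ.tau) (ε • (Φ.dir j : Vel)), Φ.inVel j) *
        max (inner ℝ (Φ.velAfter (Φ.n - 1) - Φ.inVel j) (Φ.dir j : Vel)) 0
        / freeMass g₀ ε Φ.tau Φ)
  else 0

/-- The function `γ^ε`. -/
def gam (ε t : ℝ) (Φ : CollisionTree) : ℝ :=
  if t < Φ.tau then 1 else if t = Φ.tau then Φ.prune.n * ε ^ 2 else Φ.n * ε ^ 2

/-- The function `ζ^ε`. -/
def zeta (g₀ : Phase → ℝ) (N : ℕ) (ε : ℝ) (Φ : CollisionTree) : ℝ :=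
  (1 - ∫ x in {x : Torus | torusDist x Φ.x₀ < ε}, ∫ v : Vel, g₀ (x, v)) ^ N

/-- `P` solves, at the tree `Φ` and on `[0, T]`, the equation
`∂_t P_t(Φ) = (1 - γ(t)) (Q⁺ - Q⁻)[P_t](Φ)` with initial datum `ζ f₀ 1_{n = 0}`. The gain term is a
multiple of `δ(t - τ)`: away from `τ` the function `t ↦ P_t(Φ)` has the derivative given by the loss term,
and at `τ` it is right continuous and jumps by `1 - γ(τ)` times the coefficient of the gain term. -/
structure SolvesEmpirical (f₀ g₀ : Phase → ℝ) (T : ℝ) (N : ℕ) (ε : ℝ) (C : ℝ → CollisionTree → ℝ)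
    (P : ℝ → CollisionTree → ℝ) (Φ : CollisionTree) : Prop where
  initial : P 0 Φ = if Φ.n = 0 then zeta g₀ N ε Φ * f₀ (Φ.x₀, Φ.v₀) else 0
  loss : ∀ t ∈ Icc 0 T, t ≠ Φ.tau →
    HasDerivWithinAt (fun s => P s Φ)
      ((1 - gam ε t Φ) * (0 - lossTerm g₀ (C t Φ) ε t (P t) Φ)) (Icc 0 T) t
  gain : Tendsto (fun s => P s Φ) (𝓝[Ico 0 Φ.tau] Φ.tau)
    (𝓝 (P Φ.tau Φ - (1 - gam ε Φ.tau Φ) * gainCoeff g₀ ε (P Φ.tau) Φ))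
  right_cont : ContinuousWithinAt (fun s => P s Φ) (Icc Φ.tau T) Φ.tau

end RayleighGas

end

open RayleighGas

noncomputable section

namespace RayleighGas

/-! ### Geometry of the torus -/

/-! Background particles are independent and ignore each other, so the law of a tree without
re-collisions is explicit. Such a tree with n collisions occurs up to time t exactly when n distinct
background particles start in the states prescribed by the marks and each of the other N - n stays
farther than ε from the path on [0, t]. Passing from the initial state of a met particle to its mark
has Jacobian ε²[(v - w)·ν]₊, the volume swept by the moving sphere. Write m_t (`unhitMass`) for the
probability that one background particle avoids the path on [0, t]; for t > 0 it equals `freeMass`.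
Then the density (`treeDensity`) is N(N-1)⋯(N-n+1) · f₀ · ∏ ε²[(v - w)·ν]₊ g₀ · m_t^(N-n) once all
collision times are in (0, t], and 0 before.

The density formula rests on three facts. `exists_evolves_iff` replaces the dynamics by the static
description above. `Realizes.unique` shows that an initial state yields at most one tree and one
assignment of particles, so probabilities of the different choices add up. `lintegral_flux`,
iterated over the collisions in `lintegral_starts`, is the change of variables. They combine in
`initialLaw_event` and `empirical_eq`.

The equation is then calculus (`solvesEmpirical`). After τ the only time dependence is m_t^(N-n),
and `hasDerivAt_unhitMass` gives m_t' = -ε² times the rate of first hits; since Nε² = 1, the factor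
(N-n)ε² is 1 - γ. The full collision rate is the rate of first hits plus the rate at which particles
met before are hit again, so the correction C is defined as the latter (`rehitRate`). At τ the
densities of the tree and of the pruned tree differ by one factor of the product, one factor of the
falling factorial and one power of m_τ, which is the jump.

To differentiate m_t, `lawOf_avoidSet_eq_add` identifies the mass lost in a short interval with the
particles first hit there, up to null sets of grazing particles. `tendsto_lawOf_hitSet` computes the
rate of hits: the flux formula is exact for particles too slow to go round the torus, fast ones are
negligible by the moment bound, and dominated convergence does the rest. The same limit, with the
complementary condition on the past, shows that C measures second hits. The grazing sets are null
because they are porous (`volume_eq_zero_of_porous`), which needs only continuity of the path.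

C tends to 0 (`tendsto_rehitRate`) because, for almost every velocity, the backward line through
x(t) misses the earlier path altogether. Finally m_t > 0 for good trees because a tube of radius ε
around a path has mass O(ε) under the cut-offs (`exists_lawOf_compl_avoidSet_lt_one`). -/

instance : IsFiniteMeasure sphereMeasure := by
  unfold sphereMeasure; infer_instance

theorem torusDist_eq_norm (x y : Torus) :
    torusDist x y = ‖(WithLp.toLp 2 (x - y) : PiLp 2 fun _ : Fin 3 => UnitAddCircle)‖ := by
  rw [PiLp.norm_eq_of_L2]; rfl

theorem torusDist_nonneg (x y : Torus) : 0 ≤ torusDist x y := Real.sqrt_nonneg _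

theorem torusDist_comm (x y : Torus) : torusDist x y = torusDist y x := by
  simp only [torusDist, norm_sub_rev]

theorem torusDist_triangle (x y z : Torus) : torusDist x z ≤ torusDist x y + torusDist y z := by
  simp only [torusDist_eq_norm]
  have : (WithLp.toLp 2 (x - z) : PiLp 2 fun _ : Fin 3 => UnitAddCircle)
      = WithLp.toLp 2 (x - y) + WithLp.toLp 2 (y - z) := by
    rw [← WithLp.toLp_add]; congr 1; abel
  rw [this]; exact norm_add_le _ _

theorem shift_zero (x : Torus) : shift x 0 = x := by
  funext i; simp [shift]

theorem shift_shift (x : Torus) (u v : Vel) : shift (shift x u) v = shift x (u + v) := by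
  funext i; simp [shift, add_assoc]

theorem torusDist_shift_shift (x y : Torus) (u : Vel) :
    torusDist (shift x u) (shift y u) = torusDist x y := by
  simp [torusDist, shift]

theorem torusDist_shift_left (x y : Torus) (u : Vel) :
    torusDist (shift x u) y = torusDist x (shift y (-u)) := by
  rw [← torusDist_shift_shift x (shift y (-u)) u, shift_shift, neg_add_cancel, shift_zero]

theorem norm_coe_le_abs (r : ℝ) : ‖(r : UnitAddCircle)‖ ≤ |r| := by
  rw [UnitAddCircle.norm_eq]
  simpa using round_le r 0

theorem torusDist_shift_self_le (x : Torus) (u : Vel) : torusDist x (shift x u) ≤ ‖u‖ := by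
  rw [EuclideanSpace.norm_eq, torusDist]
  gcongr with i
  simpa [shift] using norm_coe_le_abs (u i)

theorem torusDist_shift_le (x : Torus) (u v : Vel) :
    torusDist (shift x u) (shift x v) ≤ ‖u - v‖ := by
  have h : shift x u = shift (shift x v) (u - v) := by rw [shift_shift, add_sub_cancel]
  rw [h, torusDist_comm]; exact torusDist_shift_self_le _ _

theorem abs_apply_le_norm (u : Vel) (i : Fin 3) : |u i| ≤ ‖u‖ := by
  simpa using PiLp.norm_apply_le u i

/-- Within half a period no coordinate wraps around. The thresholds 1/4 and 1/8 used below come from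
here: a relative displacement of at most 1/4 plus a diameter ε ≤ 1/8 stays below 1/2. -/
theorem torusDist_shift_self (x : Torus) (u : Vel) (hu : ‖u‖ ≤ 1 / 2) :
    torusDist x (shift x u) = ‖u‖ := by
  rw [EuclideanSpace.norm_eq, torusDist]
  congr 1
  refine Finset.sum_congr rfl fun i _ => ?_
  have : ‖((u i : ℝ) : UnitAddCircle)‖ = |u i| := by
    rw [AddCircle.norm_coe_eq_abs_iff _ one_ne_zero]
    simpa using (abs_apply_le_norm u i).trans hu
  simp [shift, this]

/-- Subtracting the nearest integer in every coordinate gives a shortest representative of the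
difference. It turns statements about torus distance into statements about vectors. -/
theorem exists_shift_eq (x y : Torus) : ∃ u : Vel, y = shift x u ∧ ‖u‖ = torusDist x y := by
  have h : ∀ i, ∃ r : ℝ, (r : UnitAddCircle) = y i - x i ∧ |r| = ‖x i - y i‖ := by
    intro i
    obtain ⟨r, hr⟩ := QuotientAddGroup.mk_surjective (y i - x i)
    refine ⟨r - round r, ?_, ?_⟩
    · rw [← hr]
      have : ((round r : ℝ) : UnitAddCircle) = 0 := by
        rw [AddCircle.coe_eq_zero_iff]; exact ⟨round r, by simp⟩
      rw [AddCircle.coe_sub, this, sub_zero]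
    · rw [norm_sub_rev, ← hr]
      exact (UnitAddCircle.norm_eq (x := r)).symm
  choose r hr hr' using h
  refine ⟨WithLp.toLp 2 r, ?_, ?_⟩
  · funext i; simp [shift, hr]
  · rw [EuclideanSpace.norm_eq, torusDist]; simp [hr']

/-- Two lifts of one point differ by a lattice vector, and a lattice vector shorter than 1 is zero.
-/
theorem shift_eq_shift_iff_of_norm_lt {x : Torus} {u v : Vel} (h : ‖u - v‖ < 1) :
    shift x u = shift x v ↔ u = v := by
  refine ⟨fun h' => ?_, fun h' => by rw [h']⟩
  ext i
  have h1 := congrFun h' i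
  simp only [shift, add_right_inj] at h1
  have h2 : ((u i - v i : ℝ) : UnitAddCircle) = 0 := by rw [AddCircle.coe_sub, h1, sub_self]
  obtain ⟨k, hk⟩ := (AddCircle.coe_eq_zero_iff (1 : ℝ)).1 h2
  have h3 : |u i - v i| < 1 := (abs_apply_le_norm (u - v) i).trans_lt h
  simp only [zsmul_eq_mul, mul_one] at hk
  rw [← hk] at h3
  have h4 : k = 0 := by
    have h5 : ((|k| : ℤ) : ℝ) < ((1 : ℤ) : ℝ) := by
      rw [Int.cast_abs, Int.cast_one]; exact h3
    exact Int.abs_lt_one_iff.1 (Int.cast_lt.1 h5)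
  rw [h4] at hk
  simp at hk; linarith

theorem continuous_shift : Continuous fun p : Torus × Vel => shift p.1 p.2 := by
  refine continuous_pi fun i => ?_
  simp only [shift]
  refine ((continuous_apply i).comp continuous_fst).add ?_
  exact (AddCircle.continuous_mk' (1 : ℝ)).comp (by fun_prop)

theorem continuous_torusDist : Continuous fun p : Torus × Torus => torusDist p.1 p.2 := by
  unfold torusDist; fun_prop

theorem continuous_shift_comp {X : Type*} [TopologicalSpace X] {f : X → Torus} {g : X → Vel}
    (hf : Continuous f) (hg : Continuous g) : Continuous fun x => shift (f x) (g x) := by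
  have h := continuous_shift.comp (hf.prodMk hg)
  simpa only [Function.comp_def] using h

theorem continuous_torusDist_comp {X : Type*} [TopologicalSpace X] {f : X → Torus} {g : X → Torus}
    (hf : Continuous f) (hg : Continuous g) : Continuous fun x => torusDist (f x) (g x) := by
  have h := continuous_torusDist.comp (hf.prodMk hg)
  simpa only [Function.comp_def] using h

theorem measurable_shift_comp {X : Type*} [MeasurableSpace X] {f : X → Torus} {g : X → Vel}
    (hf : Measurable f) (hg : Measurable g) : Measurable fun x => shift (f x) (g x) := by
  have h := continuous_shift.measurable.comp (hf.prodMk hg)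
  simpa only [Function.comp_def] using h

theorem measurable_torusDist_comp {X : Type*} [MeasurableSpace X] {f : X → Torus} {g : X → Torus}
    (hf : Measurable f) (hg : Measurable g) : Measurable fun x => torusDist (f x) (g x) := by
  have h := continuous_torusDist.measurable.comp (hf.prodMk hg)
  simpa only [Function.comp_def] using h

/-! ### Sets that are null because they are porous, and volumes of small balls -/

/-- Every point of E lies in the closure of a ball disjoint from E, so it cannot be a Lebesgue
density point, while almost every point of E is one. The density theorem is used with off-centre
balls, and E need not be measurable. -/
theorem volume_eq_zero_of_porous {E : Set Vel}
    (h : ∀ p ∈ E, ∃ c : Vel, ∃ ρ > 0, dist p c ≤ ρ ∧ ∀ z ∈ Metric.ball c ρ, z ∉ E) :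
    volume E = 0 := by
  by_contra hE
  have h1 := IsUnifLocDoublingMeasure.ae_tendsto_measure_inter_div (volume : Measure Vel) E 2
  have h2 : (ae ((volume : Measure Vel).restrict E)).NeBot := by
    rw [ae_neBot]; intro h0; exact hE (Measure.restrict_eq_zero.1 h0)
  have h1' : ∀ᵐ x ∂(volume : Measure Vel).restrict E, ∀ (w : ℕ → Vel) (δ : ℕ → ℝ),
      Tendsto δ atTop (𝓝[>] 0) → (∀ᶠ j in atTop, x ∈ Metric.closedBall (w j) (2 * δ j)) →
      Tendsto (fun j => volume (E ∩ Metric.closedBall (w j) (δ j)) /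
        volume (Metric.closedBall (w j) (δ j))) atTop (𝓝 1) := by
    filter_upwards [h1] with x hx w δ using hx w δ
  by_cases hmem : ∃ x ∈ E, ∀ (w : ℕ → Vel) (δ : ℕ → ℝ),
      Tendsto δ atTop (𝓝[>] 0) → (∀ᶠ j in atTop, x ∈ Metric.closedBall (w j) (2 * δ j)) →
      Tendsto (fun j => volume (E ∩ Metric.closedBall (w j) (δ j)) /
        volume (Metric.closedBall (w j) (δ j))) atTop (𝓝 1)
  · obtain ⟨p, hp, hlim⟩ := hmem
    obtain ⟨c, ρ, hρ, hpc, hball⟩ := h p hp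
    set δ : ℕ → ℝ := fun j => ρ / 2 * (1 / ((j : ℝ) + 1)) with hδ
    have hδpos : ∀ j, 0 < δ j := fun j => by simp only [hδ]; positivity
    have hδle : ∀ j, δ j ≤ ρ / 2 := fun j => by
      simp only [hδ]
      have : 1 / ((j : ℝ) + 1) ≤ 1 := by
        rw [div_le_one (by positivity)]; linarith [(Nat.cast_nonneg j : (0 : ℝ) ≤ j)]
      nlinarith
    have hδ0 : Tendsto δ atTop (𝓝[>] 0) := by
      refine tendsto_nhdsWithin_iff.2 ⟨?_, Eventually.of_forall hδpos⟩
      have := (tendsto_one_div_add_atTop_nhds_zero_nat (𝕜 := ℝ)).const_mul (ρ / 2)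
      rwa [mul_zero] at this
    -- The centre moves from p towards c by at most 2δ, as far as the density theorem allows; the
    -- closed ball of radius δ around it then lies in the open ball around c, which misses E.
    set w : ℕ → Vel := fun j => p + (2 * δ j / ρ) • (c - p) with hw
    have hpw : ∀ j, dist p (w j) ≤ 2 * δ j := fun j => by
      rw [dist_eq_norm, hw]
      have hn : ‖c - p‖ ≤ ρ := by rwa [← dist_eq_norm, dist_comm]
      have hj := hδpos j
      rw [sub_add_cancel_left, norm_neg, norm_smul, Real.norm_of_nonneg (by positivity)]
      calc 2 * δ j / ρ * ‖c - p‖ ≤ 2 * δ j / ρ * ρ := by gcongr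
        _ = 2 * δ j := by field_simp
    have hdisj : ∀ j, E ∩ Metric.closedBall (w j) (δ j) = ∅ := fun j => by
      rw [Set.eq_empty_iff_forall_notMem]
      rintro z ⟨hzE, hz⟩
      refine hball z ?_ hzE
      rw [Metric.mem_ball]
      have hwc : dist (w j) c ≤ ρ - 2 * δ j := by
        have hn : ‖c - p‖ ≤ ρ := by rwa [← dist_eq_norm, dist_comm]
        have : w j - c = -(1 - 2 * δ j / ρ) • (c - p) := by
          simp only [hw]; module
        have h1 : 2 * δ j / ρ ≤ 1 := by rw [div_le_one hρ]; linarith [hδle j]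
        rw [dist_eq_norm, this, norm_smul, norm_neg, Real.norm_of_nonneg (by linarith)]
        calc (1 - 2 * δ j / ρ) * ‖c - p‖ ≤ (1 - 2 * δ j / ρ) * ρ := by gcongr
          _ = ρ - 2 * δ j := by field_simp
      have := dist_triangle z (w j) c
      rw [Metric.mem_closedBall] at hz
      linarith [hδpos j]
    have hl := hlim w δ hδ0 (Eventually.of_forall fun j => by
      rw [Metric.mem_closedBall]; exact hpw j)
    simp only [hdisj, measure_empty, ENNReal.zero_div] at hl
    exact zero_ne_one (tendsto_nhds_unique tendsto_const_nhds hl)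
  · push Not at hmem
    apply hE
    set G := {x : Vel | ¬ ∀ (w : ℕ → Vel) (δ : ℕ → ℝ),
      Tendsto δ atTop (𝓝[>] 0) → (∀ᶠ j in atTop, x ∈ Metric.closedBall (w j) (2 * δ j)) →
      Tendsto (fun j => volume (E ∩ Metric.closedBall (w j) (δ j)) /
        volume (Metric.closedBall (w j) (δ j))) atTop (𝓝 1)} with hG
    have hsub : E ⊆ G := by
      intro x hx
      obtain ⟨w, δ, h1, h2, h3⟩ := hmem x hx
      exact fun hall => h3 (hall w δ h1 h2)
    have h3 : (volume : Measure Vel).restrict E G = 0 := h1'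
    have h4 := measure_mono_null hsub h3
    rwa [Measure.restrict_apply_self] at h4

/-- The point of the torus with given coordinates. -/
def toTorus (z : Vel) : Torus := fun i => ((z i : ℝ) : UnitAddCircle)

/-- The half-open unit cube. -/
def unitCube : Set Vel := {z | ∀ i, z i ∈ Ioc (0 : ℝ) 1}

theorem toTorus_add (z u : Vel) : toTorus (z + u) = shift (toTorus z) u := by
  funext i; simp [toTorus, shift]

theorem continuous_toTorus : Continuous toTorus :=
  continuous_pi fun i => (AddCircle.continuous_mk' (1 : ℝ)).comp (by fun_prop)

theorem measurableSet_unitCube : MeasurableSet unitCube := by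
  have : unitCube = ⋂ i : Fin 3, (fun z : Vel => z i) ⁻¹' Ioc (0 : ℝ) 1 := by
    ext z; simp [unitCube]
  rw [this]
  refine MeasurableSet.iInter fun i => ?_
  exact (by fun_prop : Measurable fun z : Vel => z i) measurableSet_Ioc

theorem measurePreserving_toTorus :
    MeasurePreserving toTorus ((volume : Measure Vel).restrict unitCube) volume := by
  have h1 : MeasurePreserving (fun (a : Fin 3 → ℝ) (i : Fin 3) => ((a i : ℝ) : UnitAddCircle))
      (Measure.pi fun _ => (volume : Measure ℝ).restrict (Ioc 0 1)) (Measure.pi fun _ => volume) :=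
    measurePreserving_pi _ _ fun _ => by simpa using UnitAddCircle.measurePreserving_mk 0
  have h2 := (PiLp.volume_preserving_ofLp (Fin 3)).restrict_preimage
    (s := Set.pi univ fun _ : Fin 3 => Ioc (0 : ℝ) 1) (MeasurableSet.univ_pi fun _ => measurableSet_Ioc)
  have h3 : (WithLp.ofLp : Vel → Fin 3 → ℝ) ⁻¹' (Set.pi univ fun _ : Fin 3 => Ioc (0 : ℝ) 1)
      = unitCube := by
    ext z; simp [unitCube]
  rw [h3, volume_pi, Measure.restrict_pi_pi] at h2
  rw [volume_pi]
  exact h1.comp h2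

/-- A set in the torus is null if the set of its representatives is. -/
theorem volume_eq_zero_of_preimage {A : Set Torus} (hA : volume (toTorus ⁻¹' A) = 0) :
    volume A = 0 := by
  obtain ⟨B, hB, hBm, hB0⟩ := exists_measurable_superset_of_null hA
  rw [← measurePreserving_toTorus.map_eq]
  -- A need not be measurable, so it is covered by the complement of an injective Borel image, whose
  -- preimage in the cube lies in the null set B.
  have hsub : A ⊆ (toTorus '' (unitCube ∩ Bᶜ))ᶜ := by
    rintro x hx ⟨z, ⟨-, hz⟩, rfl⟩
    exact hz (hB hx)
  have hinj : InjOn toTorus (unitCube ∩ Bᶜ) := by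
    rintro z ⟨hz, -⟩ z' ⟨hz', -⟩ h
    ext i
    have h1 := congrFun h i
    have h2 : ((z i - z' i : ℝ) : UnitAddCircle) = 0 := by
      simp only [toTorus] at h1; rw [AddCircle.coe_sub, h1, sub_self]
    obtain ⟨k, hk⟩ := (AddCircle.coe_eq_zero_iff (1 : ℝ)).1 h2
    simp only [zsmul_eq_mul, mul_one] at hk
    have h3 := hz i; have h4 := hz' i
    have h5 : (k : ℝ) < 1 := by rw [hk]; linarith [h3.2, h4.1]
    have h6 : (-1 : ℝ) < k := by rw [hk]; linarith [h3.1, h4.2]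
    have h7 : k = 0 := by
      have h5' : k < 1 := by exact_mod_cast h5
      have h6' : -1 < k := by exact_mod_cast h6
      omega
    rw [h7] at hk
    simp at hk; linarith
  have hm : MeasurableSet (toTorus '' (unitCube ∩ Bᶜ)) :=
    (measurableSet_unitCube.inter hBm.compl).image_of_measurable_injOn
      continuous_toTorus.measurable hinj
  refine measure_mono_null hsub ?_
  rw [Measure.map_apply continuous_toTorus.measurable hm.compl,
    Measure.restrict_apply (continuous_toTorus.measurable hm.compl)]
  refine measure_mono_null ?_ hB0
  rintro z ⟨hz1, hz2⟩
  by_contra hzB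
  exact hz1 ⟨z, ⟨hz2, hzB⟩, rfl⟩

/-- The points of the torus at distance exactly `ε` from a family of points are null, where points
closer than `ε` to the family are discarded. -/
theorem volume_sphere_union_eq_zero {ι : Type*} (I : Set ι) (c : ι → Torus) {ε : ℝ} (hε : 0 < ε) :
    volume {x : Torus | (∃ s ∈ I, torusDist (c s) x = ε) ∧ ∀ s ∈ I, ε ≤ torusDist (c s) x} = 0 := by
  apply volume_eq_zero_of_preimage
  apply volume_eq_zero_of_porous
  rintro p ⟨⟨s, hs, hds⟩, -⟩
  obtain ⟨u, hu, hun⟩ := exists_shift_eq (toTorus p) (c s)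
  rw [torusDist_comm, hds] at hun
  -- The ball of radius ε around the lift of `c s` nearest to p has p on its boundary and contains
  -- only discarded points.
  refine ⟨p + u, ε, hε, ?_, ?_⟩
  · rw [dist_eq_norm]; simp [hun]
  · rintro z hz ⟨-, h2⟩
    have h3 := h2 s hs
    have h4 : z = p + (z - p) := by abel
    rw [hu, h4, toTorus_add] at h3
    have h5 := torusDist_shift_le (toTorus p) u (z - p)
    rw [Metric.mem_ball, dist_eq_norm, ← norm_neg] at hz
    have : u - (z - p) = -(z - (p + u)) := by abel
    rw [this] at h5
    linarith

theorem volume_torusDist_le (y : Torus) {r : ℝ} (hr : 0 ≤ r) :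
    volume {x : Torus | torusDist y x ≤ r} ≤ ENNReal.ofReal ((2 * r) ^ 3) := by
  have hsub : {x : Torus | torusDist y x ≤ r} ⊆ Set.pi univ fun i => Metric.closedBall (y i) r := by
    intro x hx i _
    rw [Metric.mem_closedBall, dist_comm, dist_eq_norm]
    refine le_trans ?_ hx
    rw [torusDist_eq_norm]
    exact PiLp.norm_apply_le (WithLp.toLp 2 (y - x) : PiLp 2 fun _ : Fin 3 => UnitAddCircle) i
  refine (measure_mono hsub).trans ?_
  rw [volume_pi, Measure.pi_pi, ENNReal.ofReal_pow (by positivity)]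
  simp only [AddCircle.volume_closedBall, Finset.prod_const, Finset.card_univ, Fintype.card_fin]
  gcongr
  exact min_le_right _ _

/-! ### Polar coordinates and the volume swept by a moving sphere -/

theorem lintegral_polar (H : ℝ × Vel → ENNReal) (hH : Measurable H) :
    ∫⁻ p in Ioi (0 : ℝ) ×ˢ (univ : Set Sph), ENNReal.ofReal (p.1 ^ 2) * H (p.1, (p.2 : Vel))
        ∂((volume : Measure ℝ).prod sphereMeasure)
      = ∫⁻ y in ({0}ᶜ : Set Vel), H (‖y‖, ‖y‖⁻¹ • y) := by
  have hmp := (volume : Measure Vel).measurePreserving_homeomorphUnitSphereProd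
  have hK : Measurable fun p : Sph × Ioi (0 : ℝ) => H ((p.2 : ℝ), (p.1 : Vel)) :=
    hH.comp (by fun_prop)
  have h1 := hmp.lintegral_comp hK
  have h2 := lintegral_subtype_comap (μ := (volume : Measure Vel))
    (measurableSet_singleton (0 : Vel)).compl (fun y => H (‖y‖, ‖y‖⁻¹ • y))
  rw [← h2]
  have h3 : (fun y : ({0}ᶜ : Set Vel) => H (‖(y : Vel)‖, ‖(y : Vel)‖⁻¹ • (y : Vel)))
      = fun y => H (((homeomorphUnitSphereProd Vel y).2 : ℝ),
        ((homeomorphUnitSphereProd Vel y).1 : Vel)) := by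
    funext y; simp
  rw [h3, h1, lintegral_prod _ hK.aemeasurable]
  have hfin : Module.finrank ℝ Vel - 1 = 2 := by simp
  rw [← Measure.prod_restrict, Measure.restrict_univ, lintegral_prod_symm]
  · refine lintegral_congr fun ν => ?_
    rw [hfin, Measure.volumeIoiPow, lintegral_withDensity_eq_lintegral_mul]
    · rw [← lintegral_subtype_comap measurableSet_Ioi]; rfl
    · fun_prop
    · exact hH.comp (by fun_prop)
  · refine Measurable.aemeasurable ?_
    exact Measurable.mul (by fun_prop) (hH.comp (by fun_prop))

/-- The derivative of the map `y ↦ |y| u + ε y / |y|`. -/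
theorem hasFDerivAt_sweep (u : Vel) {ε : ℝ} (hε : 0 < ε) {y : Vel} (hy : y ≠ 0) :
    ∃ D : Vel →L[ℝ] Vel, HasFDerivAt (fun z : Vel => ‖z‖ • u + ε • (‖z‖⁻¹ • z)) D y ∧
      D.det = ε ^ 2 * inner ℝ u (‖y‖⁻¹ • y) / ‖y‖ ^ 2 := by
  have hr : 0 < ‖y‖ := norm_pos_iff.2 hy
  have hn : HasFDerivAt (fun z : Vel => ‖z‖) (‖y‖⁻¹ • innerSL ℝ y) y := by
    have h1 := (hasStrictFDerivAt_norm_sq (F := Vel) y).hasFDerivAt.sqrt (by positivity)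
    have h2 : (fun z : Vel => √(‖z‖ ^ 2)) = fun z => ‖z‖ := by
      funext z; exact Real.sqrt_sq (norm_nonneg z)
    rw [h2] at h1
    convert! h1 using 1
    rw [Real.sqrt_sq hr.le]
    ext z
    simp
    field_simp
  have hi : HasFDerivAt (fun z : Vel => ‖z‖⁻¹) ((-(‖y‖ ^ 2)⁻¹) • (‖y‖⁻¹ • innerSL ℝ y)) y :=
    (hasDerivAt_inv hr.ne').comp_hasFDerivAt y hn
  have hD := (hn.smul_const u).add ((hi.smul (hasFDerivAt_id y)).const_smul ε)
  refine ⟨_, hD, ?_⟩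
  set f : Module.Dual ℝ Vel := (‖y‖⁻¹ • innerSL ℝ y : Vel →L[ℝ] ℝ).toLinearMap with hf
  set x : Vel := (‖y‖ / ε) • u - ‖y‖⁻¹ • y with hx
  -- The derivative is ε/|y| times a transvection 1 + f ⊗ x with f = ⟨y/|y|, ·⟩, so its determinant
  -- is (ε/|y|)³(1 + f x), and 1 + f x = ⟨y, u⟩/ε.
  have heq : ((‖y‖⁻¹ • innerSL ℝ y).smulRight u + ε • (‖y‖⁻¹ • ContinuousLinearMap.id ℝ Vel +
      ((-(‖y‖ ^ 2)⁻¹) • (‖y‖⁻¹ • innerSL ℝ y)).smulRight (id y)) : Vel →L[ℝ] Vel).toLinearMap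
      = (ε / ‖y‖) • LinearMap.transvection f x := by
    ext1 z
    simp only [hf, hx, LinearMap.smul_apply, LinearMap.transvection.apply]
    simp
    set a := inner ℝ y z
    match_scalars <;> field_simp
  rw [ContinuousLinearMap.det, heq, LinearMap.det_smul, LinearMap.transvection.det]
  have hfin : Module.finrank ℝ Vel = 3 := by simp
  have hfx : f x = inner ℝ y u / ε - 1 := by
    simp [hf, hx, inner_sub_right, inner_smul_right]
    field_simp
  rw [hfin, hfx, inner_smul_right, real_inner_comm]
  field_simp
  ring

/-- A line in direction u enters a ball once and leaves it once, and only one of these points has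
u·ν > 0. In formulas: equality of lengths, after elimination of |u|², leaves (s' - s)(u·ν + u·ν') =
0. -/
theorem sweep_injective {u : Vel} {ε : ℝ} (hε : 0 < ε) {s s' : ℝ} {ν ν' : Sph}
    (hν : 0 < inner ℝ u (ν : Vel)) (hν' : 0 < inner ℝ u (ν' : Vel))
    (h : s • u + ε • (ν : Vel) = s' • u + ε • (ν' : Vel)) : s = s' ∧ ν = ν' := by
  have hn : ‖(ν : Vel)‖ = 1 := by simp
  have hn' : ‖(ν' : Vel)‖ = 1 := by simp
  have e : ε • (ν' : Vel) = ε • (ν : Vel) - (s' - s) • u := by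
    rw [sub_smul]; rw [← sub_eq_iff_eq_add'] at h
    rw [← h]; abel
  have h1 : inner ℝ u (ε • (ν' : Vel)) = ε * inner ℝ u (ν : Vel) - (s' - s) * ‖u‖ ^ 2 := by
    rw [e, inner_sub_right, inner_smul_right, inner_smul_right, real_inner_self_eq_norm_sq]
  rw [inner_smul_right] at h1
  have h2 : ‖ε • (ν' : Vel)‖ ^ 2
      = ε ^ 2 - 2 * ((s' - s) * (ε * inner ℝ u (ν : Vel))) + (s' - s) ^ 2 * ‖u‖ ^ 2 := by
    rw [e, norm_sub_sq_real, inner_smul_left, inner_smul_right, norm_smul, norm_smul, hn,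
      real_inner_comm, mul_pow, mul_pow]
    simp
    ring
  rw [norm_smul, hn', mul_one, Real.norm_of_nonneg hε.le] at h2
  have h3 : (s' - s) * (ε * inner ℝ u (ν : Vel) + ε * inner ℝ u (ν' : Vel)) = 0 := by
    rw [h1]; nlinarith
  have h4 : s' - s = 0 := by
    rcases mul_eq_zero.1 h3 with h | h
    · exact h
    · have := mul_pos hε hν; have := mul_pos hε hν'; linarith
  refine ⟨by linarith, ?_⟩
  rw [h4, zero_smul, sub_zero] at e
  exact (Subtype.ext (smul_right_injective Vel hε.ne' e)).symm

/-- Time serves as the radius in polar coordinates, hence the requirement that times be positive.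
The weight r² of polar coordinates cancels the 1/|y|² in the Jacobian of `hasFDerivAt_sweep`, and
the flux ε² u·ν remains. -/
theorem lintegral_sweep (u : Vel) {ε : ℝ} (hε : 0 < ε) {S : Set (ℝ × Sph)} (hS : MeasurableSet S)
    (hpos : ∀ p ∈ S, 0 < p.1 ∧ 0 < inner ℝ u (p.2 : Vel)) (F : Vel → ENNReal) (hF : Measurable F) :
    ∫⁻ p in S, ENNReal.ofReal (ε ^ 2 * inner ℝ u (p.2 : Vel)) * F (p.1 • u + ε • (p.2 : Vel))
        ∂((volume : Measure ℝ).prod sphereMeasure)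
      = ∫⁻ x in (fun p : ℝ × Sph => p.1 • u + ε • (p.2 : Vel)) '' S, F x := by
  have hemb : MeasurableEmbedding (Prod.map id Subtype.val : ℝ × Sph → ℝ × Vel) :=
    MeasurableEmbedding.id.prodMap (MeasurableEmbedding.subtype_coe (by
      exact Metric.isClosed_sphere.measurableSet))
  set S' : Set (ℝ × Vel) := (Prod.map id Subtype.val) '' S with hS'
  have hS'm : MeasurableSet S' := hemb.measurableSet_image.2 hS
  have hmem : ∀ p : ℝ × Sph, (p.1, (p.2 : Vel)) ∈ S' ↔ p ∈ S := fun p =>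
    hemb.injective.mem_set_image (a := p)
  set H : ℝ × Vel → ENNReal := S'.indicator fun p =>
    ENNReal.ofReal (ε ^ 2 * inner ℝ u p.2 / p.1 ^ 2) * F (p.1 • u + ε • p.2) with hH
  have hHm : Measurable H := by
    refine Measurable.indicator ?_ hS'm
    exact Measurable.mul (by fun_prop) (hF.comp (by fun_prop))
  have hpol := lintegral_polar H hHm
  have hSsub : S ⊆ Ioi (0 : ℝ) ×ˢ (univ : Set Sph) := fun p hp => ⟨(hpos p hp).1, mem_univ _⟩
  have hL : ∫⁻ p in S, ENNReal.ofReal (ε ^ 2 * inner ℝ u (p.2 : Vel)) *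
        F (p.1 • u + ε • (p.2 : Vel)) ∂((volume : Measure ℝ).prod sphereMeasure)
      = ∫⁻ p in Ioi (0 : ℝ) ×ˢ (univ : Set Sph), ENNReal.ofReal (p.1 ^ 2) * H (p.1, (p.2 : Vel))
        ∂((volume : Measure ℝ).prod sphereMeasure) := by
    rw [← lintegral_indicator hS, ← lintegral_indicator (measurableSet_Ioi.prod MeasurableSet.univ)]
    refine lintegral_congr fun p => ?_
    by_cases hp : p ∈ S
    · have h0 := (hpos p hp).1
      rw [indicator_of_mem hp, indicator_of_mem (hSsub hp), hH,
        indicator_of_mem ((hmem p).2 hp), ← mul_assoc, ← ENNReal.ofReal_mul (by positivity)]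
      congr 2
      simp only
      field_simp
    · rw [indicator_of_notMem hp]
      by_cases hp' : p ∈ Ioi (0 : ℝ) ×ˢ (univ : Set Sph)
      · rw [indicator_of_mem hp', hH, indicator_of_notMem (mt (hmem p).1 hp), mul_zero]
      · rw [indicator_of_notMem hp']
  rw [hL, hpol]
  set D : Set Vel := {0}ᶜ ∩ {y | (‖y‖, ‖y‖⁻¹ • y) ∈ S'} with hD
  have hDm : MeasurableSet D :=
    (measurableSet_singleton (0 : Vel)).compl.inter
      ((by fun_prop : Measurable fun y : Vel => (‖y‖, ‖y‖⁻¹ • y)) hS'm)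
  have hDS : ∀ y ∈ D, ∃ ν : Sph, (ν : Vel) = ‖y‖⁻¹ • y ∧ (‖y‖, ν) ∈ S := by
    rintro y ⟨hy, p, hp, hpe⟩
    have h1 := congrArg Prod.fst hpe
    have h2 := congrArg Prod.snd hpe
    simp only [Prod.map_fst, Prod.map_snd, id] at h1 h2
    refine ⟨p.2, h2, ?_⟩
    rw [← h1]; exact hp
  choose! D' hD' using fun (y : Vel) (hy : y ∈ D) => hasFDerivAt_sweep u hε (y := y) hy.1
  have himg : (fun z : Vel => ‖z‖ • u + ε • (‖z‖⁻¹ • z)) '' D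
      = (fun p : ℝ × Sph => p.1 • u + ε • (p.2 : Vel)) '' S := by
    ext x
    constructor
    · rintro ⟨y, hy, rfl⟩
      obtain ⟨ν, hν, hm⟩ := hDS y hy
      exact ⟨_, hm, by simp only [hν]⟩
    · rintro ⟨⟨s, ν⟩, hp, rfl⟩
      have hs := (hpos _ hp).1
      simp only at hs
      have hn : ‖s • (ν : Vel)‖ = s := by
        rw [norm_smul, Real.norm_of_nonneg hs.le]; simp
      have hν0 : (ν : Vel) ≠ 0 := by
        intro h; have : ‖(ν : Vel)‖ = 1 := by simp
        rw [h, norm_zero] at this; exact zero_ne_one this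
      refine ⟨s • (ν : Vel), ⟨smul_ne_zero hs.ne' hν0, ?_⟩, ?_⟩
      · simp only [mem_ofPred_eq, hn, smul_smul, inv_mul_cancel₀ hs.ne', one_smul]
        exact (hmem (s, ν)).2 hp
      · simp only [hn, smul_smul, inv_mul_cancel₀ hs.ne', mul_one]
  have hinj : InjOn (fun z : Vel => ‖z‖ • u + ε • (‖z‖⁻¹ • z)) D := by
    intro y hy y' hy' h
    obtain ⟨ν, hν, hm⟩ := hDS y hy
    obtain ⟨ν', hν', hm'⟩ := hDS y' hy'
    simp only [← hν, ← hν'] at h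
    obtain ⟨h1, h2⟩ := sweep_injective hε (hpos _ hm).2 (hpos _ hm').2 h
    have hy0 : ‖y‖ ≠ 0 := norm_ne_zero_iff.2 hy.1
    simp only at h1 h2
    rw [h2, hν', h1] at hν
    exact (smul_right_injective Vel (inv_ne_zero (h1 ▸ hy0)) hν).symm
  rw [← himg, lintegral_image_eq_lintegral_abs_det_fderiv_mul volume hDm
    (fun y hy => (hD' y hy).1.hasFDerivWithinAt) hinj, ← lintegral_indicator hDm,
    ← lintegral_indicator (measurableSet_singleton (0 : Vel)).compl]
  refine lintegral_congr fun y => ?_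
  by_cases hy : y ∈ D
  · obtain ⟨ν, hν, hm⟩ := hDS y hy
    have hip := (hpos _ hm).2
    rw [indicator_of_mem hy, indicator_of_mem hy.1, hH,
      indicator_of_mem (show (‖y‖, ‖y‖⁻¹ • y) ∈ S' from hy.2), (hD' y hy).2,
      abs_of_nonneg]
    rw [← hν]; simp only at hip; positivity
  · rw [indicator_of_notMem hy]
    by_cases hy0 : y ∈ ({0}ᶜ : Set Vel)
    · rw [indicator_of_mem hy0, hH,
        indicator_of_notMem (show (‖y‖, ‖y‖⁻¹ • y) ∉ S' from fun h => hy ⟨hy0, h⟩)]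
    · rw [indicator_of_notMem hy0]

/-! ### Integrals over sets on which the projection to the torus is injective -/

/-- The integer lattice point `k`. -/
def latticePoint (k : Fin 3 → ℤ) : Vel := WithLp.toLp 2 fun i => (k i : ℝ)

theorem toTorus_add_latticePoint (z : Vel) (k : Fin 3 → ℤ) :
    toTorus (z + latticePoint k) = toTorus z := by
  rw [toTorus_add]
  funext i
  have : ((k i : ℝ) : UnitAddCircle) = 0 := by
    rw [AddCircle.coe_eq_zero_iff]; exact ⟨k i, by simp⟩
  simp [shift, latticePoint, this]

theorem exists_lattice_of_toTorus_eq {z z' : Vel} (h : toTorus z = toTorus z') :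
    ∃ k, z' = z + latticePoint k := by
  have : ∀ i, ∃ k : ℤ, (k : ℝ) = z' i - z i := by
    intro i
    have h2 : ((z' i - z i : ℝ) : UnitAddCircle) = 0 := by
      have := congrFun h i
      simp only [toTorus] at this
      rw [AddCircle.coe_sub, this, sub_self]
    obtain ⟨k, hk⟩ := (AddCircle.coe_eq_zero_iff (1 : ℝ)).1 h2
    exact ⟨k, by simpa using hk⟩
  choose k hk using this
  refine ⟨k, ?_⟩
  ext i
  simp [latticePoint, hk]

theorem exists_mem_unitCube (z : Vel) : ∃ k, z - latticePoint k ∈ unitCube := by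
  refine ⟨fun i => ⌈z i⌉ - 1, fun i => ?_⟩
  simp only [latticePoint, PiLp.sub_apply]
  push_cast
  constructor
  · linarith [Int.ceil_lt_add_one (z i)]
  · linarith [Int.le_ceil (z i)]

theorem latticePoint_unique {z : Vel} {k k' : Fin 3 → ℤ} (h : z - latticePoint k ∈ unitCube)
    (h' : z - latticePoint k' ∈ unitCube) : k = k' := by
  funext i
  have h1 := h i
  have h2 := h' i
  simp only [latticePoint, PiLp.sub_apply, mem_Ioc] at h1 h2
  have h3 : (k i : ℝ) < k' i + 1 := by linarith
  have h4 : (k' i : ℝ) < k i + 1 := by linarith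
  have h3' : k i < k' i + 1 := by exact_mod_cast h3
  have h4' : k' i < k i + 1 := by exact_mod_cast h4
  omega

/-- The set is cut along the translates of the unit cube; each piece, translated back to the cube,
is covered by `measurePreserving_toTorus`, and injectivity keeps the images of the pieces disjoint.
-/
theorem lintegral_toTorus_image {T : Set Vel} (hT : MeasurableSet T) (hinj : InjOn toTorus T)
    (F : Torus → ENNReal) (hF : Measurable F) :
    ∫⁻ z in T, F (toTorus z) = ∫⁻ x in toTorus '' T, F x := by
  set Tk : (Fin 3 → ℤ) → Set Vel := fun k => T ∩ {z | z - latticePoint k ∈ unitCube} with hTk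
  have hTkm : ∀ k, MeasurableSet (Tk k) := fun k =>
    hT.inter ((by fun_prop : Measurable fun z : Vel => z - latticePoint k) measurableSet_unitCube)
  have hU : T = ⋃ k, Tk k := by
    ext z
    simp only [hTk, mem_iUnion, mem_inter_iff, exists_and_left, mem_ofPred_eq]
    exact ⟨fun h => ⟨h, exists_mem_unitCube z⟩, fun h => h.1⟩
  have hd : Pairwise (Function.onFun Disjoint Tk) := fun k k' hk =>
    Set.disjoint_left.2 fun z hz hz' => hk (latticePoint_unique hz.2 hz'.2)
  have hd' : Pairwise (Function.onFun Disjoint fun k => toTorus '' Tk k) := fun k k' hk =>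
    Set.disjoint_left.2 fun x => by
      rintro ⟨z, hz, rfl⟩ ⟨z', hz', he⟩
      have := hinj hz.1 hz'.1 he.symm
      subst this
      exact hk (latticePoint_unique hz.2 hz'.2)
  have himg : ∀ k, MeasurableSet (toTorus '' Tk k) := fun k =>
    (hTkm k).image_of_measurable_injOn continuous_toTorus.measurable
      (hinj.mono inter_subset_left)
  rw [hU, image_iUnion, lintegral_iUnion hTkm hd, lintegral_iUnion himg hd']
  congr 1
  funext k
  have h1 : ∫⁻ z in Tk k, F (toTorus z)
      = ∫⁻ z, (Tk k).indicator (fun z => F (toTorus z)) (z + latticePoint k) := by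
    rw [lintegral_add_right_eq_self (μ := (volume : Measure Vel)), lintegral_indicator (hTkm k)]
  rw [h1, ← lintegral_indicator (himg k),
    ← measurePreserving_toTorus.lintegral_comp (hF.indicator (himg k)),
    ← lintegral_indicator measurableSet_unitCube]
  refine lintegral_congr fun z => ?_
  by_cases hz : z ∈ unitCube
  · rw [indicator_of_mem hz]
    by_cases hzk : z + latticePoint k ∈ Tk k
    · rw [indicator_of_mem hzk, toTorus_add_latticePoint, indicator_of_mem]
      exact ⟨_, hzk, toTorus_add_latticePoint z k⟩
    · rw [indicator_of_notMem hzk, indicator_of_notMem]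
      rintro ⟨z', hz', he⟩
      obtain ⟨k', hk'⟩ := exists_lattice_of_toTorus_eq he.symm
      have h2 : z' - latticePoint k' ∈ unitCube := by rw [hk']; simpa using hz
      rw [latticePoint_unique h2 hz'.2] at hk'
      exact hzk (hk' ▸ hz')
  · rw [indicator_of_notMem hz, indicator_of_notMem]
    intro hzk
    exact hz (by simpa using hzk.2)

theorem exists_toTorus_eq (a : Torus) : ∃ z, toTorus z = a := by
  obtain ⟨u, hu, -⟩ := exists_shift_eq (toTorus 0) a
  exact ⟨0 + u, by rw [toTorus_add, hu]⟩

theorem lintegral_shift_image (a : Torus) {T : Set Vel} (hT : MeasurableSet T)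
    (hinj : InjOn (fun z => shift a z) T) (F : Torus → ENNReal) (hF : Measurable F) :
    ∫⁻ z in T, F (shift a z) = ∫⁻ x in (fun z => shift a z) '' T, F x := by
  obtain ⟨b, rfl⟩ := exists_toTorus_eq a
  simp only [← toTorus_add] at hinj ⊢
  set T' : Set Vel := (fun z => b + z) '' T with hT'
  have hT'm : MeasurableSet T' := (measurableEmbedding_addLeft b).measurableSet_image.2 hT
  have hinj' : InjOn toTorus T' := by
    rintro _ ⟨z, hz, rfl⟩ _ ⟨z', hz', rfl⟩ h
    simp only [hinj hz hz' h]
  have h := lintegral_toTorus_image hT'm hinj' F hF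
  rw [hT', image_image, ← hT'] at h
  rw [← h, ← lintegral_indicator hT, ← lintegral_indicator hT'm,
    ← lintegral_add_left_eq_self (μ := (volume : Measure Vel)) (T'.indicator _) b]
  refine lintegral_congr fun z => ?_
  by_cases hz : z ∈ T
  · rw [indicator_of_mem hz, indicator_of_mem (show b + z ∈ T' from ⟨z, hz, rfl⟩)]
  · rw [indicator_of_notMem hz, indicator_of_notMem]
    rintro ⟨z', hz', he⟩
    exact hz (add_left_cancel he ▸ hz')

/-! ### The flux formula -/

/-- Lebesgue measure on marks. -/
def markMeasure : Measure Mark := (volume : Measure ℝ).prod (sphereMeasure.prod (volume : Measure Vel))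

instance : SFinite markMeasure := by unfold markMeasure; infer_instance
instance : SigmaFinite markMeasure := by unfold markMeasure; infer_instance

/-- The initial state of a background particle which meets a tagged particle on the path `a + s v` in
the way described by the mark. -/
def flyBack (ε : ℝ) (a : Torus) (v : Vel) (m : Mark) : Phase :=
  (shift a (m.1 • (v - m.2.2) + ε • (m.2.1 : Vel)), m.2.2)

/-- The density `ε² (v - w)·ν` of the flux. -/
def fluxDensity (ε : ℝ) (v : Vel) (m : Mark) : ENNReal :=
  ENNReal.ofReal (ε ^ 2 * max (inner ℝ (v - m.2.2) (m.2.1 : Vel)) 0)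

theorem continuous_flyBack (ε : ℝ) (a : Torus) (v : Vel) : Continuous (flyBack ε a v) :=
  (continuous_shift_comp continuous_const (by fun_prop)).prodMk (by fun_prop)

theorem measurable_fluxDensity (ε : ℝ) (v : Vel) : Measurable (fluxDensity ε v) := by
  unfold fluxDensity; fun_prop

theorem lintegral_markMeasure (H : Mark → ENNReal) (hH : Measurable H) :
    ∫⁻ m, H m ∂markMeasure
      = ∫⁻ w : Vel, ∫⁻ p : ℝ × Sph, H (p.1, p.2, w) ∂((volume : Measure ℝ).prod sphereMeasure) := by
  have h := measurePreserving_prodAssoc (volume : Measure ℝ) sphereMeasure (volume : Measure Vel)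
  rw [markMeasure, ← h.lintegral_comp hH]
  exact lintegral_prod_symm _ (hH.comp h.measurable).aemeasurable

/-- For a fixed background velocity w, the sphere of radius ε around the tagged particle sweeps
space with relative velocity v - w, so `lintegral_sweep` applies with u = v - w. The hypothesis
`hinj` excludes that one initial state is counted twice, at two times or after a turn around the
torus. -/
theorem lintegral_flux (a : Torus) (v : Vel) {ε : ℝ} (hε : 0 < ε) {S : Set Mark}
    (hS : MeasurableSet S) (hpos : ∀ m ∈ S, 0 < m.1 ∧ 0 < inner ℝ (v - m.2.2) (m.2.1 : Vel))
    (hinj : InjOn (flyBack ε a v) S) (F : Phase → ENNReal) (hF : Measurable F) :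
    ∫⁻ m in S, fluxDensity ε v m * F (flyBack ε a v m) ∂markMeasure
      = ∫⁻ q in flyBack ε a v '' S, F q := by
  have himg : MeasurableSet (flyBack ε a v '' S) :=
    hS.image_of_measurable_injOn (continuous_flyBack ε a v).measurable hinj
  rw [← lintegral_indicator hS, ← lintegral_indicator himg, lintegral_markMeasure,
    Measure.volume_eq_prod, lintegral_prod_symm _ (hF.indicator himg).aemeasurable]
  swap
  · exact ((measurable_fluxDensity ε v).mul (hF.comp (continuous_flyBack ε a v).measurable)).indicator hS
  refine lintegral_congr fun w => ?_
  set Sw : Set (ℝ × Sph) := {p | ((p.1, p.2, w) : Mark) ∈ S} with hSw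
  have hSwm : MeasurableSet Sw := (by fun_prop : Measurable fun p : ℝ × Sph => ((p.1, p.2, w) : Mark)) hS
  set φ : ℝ × Sph → Vel := fun p => p.1 • (v - w) + ε • (p.2 : Vel) with hφ
  -- Injectivity is needed twice: here in Euclidean space, which is automatic for incoming
  -- directions, and in `hinj'` after projection to the torus, which is the hypothesis.
  have hφinj : InjOn φ Sw := by
    rintro ⟨s, ν⟩ hp ⟨s', ν'⟩ hp' h
    obtain ⟨h1, h2⟩ := sweep_injective hε (hpos _ hp).2 (hpos _ hp').2 h
    exact Prod.ext h1 h2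
  have hφm : MeasurableSet (φ '' Sw) :=
    hSwm.image_of_measurable_injOn (by fun_prop) hφinj
  have hFw : Measurable fun x : Torus => F (x, w) := hF.comp (by fun_prop)
  have e1 := lintegral_sweep (v - w) hε hSwm (fun p hp => hpos _ hp) (fun z => F (shift a z, w))
    (hFw.comp (measurable_shift_comp measurable_const measurable_id))
  have hinj' : InjOn (fun z => shift a z) (φ '' Sw) := by
    rintro _ ⟨p, hp, rfl⟩ _ ⟨p', hp', rfl⟩ h
    have h1 : flyBack ε a v (p.1, p.2, w) = flyBack ε a v (p'.1, p'.2, w) := Prod.ext h rfl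
    have h2 := hinj hp hp' h1
    simp only [Prod.mk.injEq, and_true] at h2
    simp only [hφ, h2.1, h2.2]
  have e2 := lintegral_shift_image a hφm hinj' (fun x => F (x, w)) hFw
  rw [← hφ] at e1
  have hT : (fun z => shift a z) '' (φ '' Sw) = {x | (x, w) ∈ flyBack ε a v '' S} := by
    ext x
    constructor
    · rintro ⟨_, ⟨p, hp, rfl⟩, rfl⟩
      exact ⟨_, hp, rfl⟩
    · rintro ⟨⟨s, ν, w'⟩, hm, he⟩
      obtain rfl : w' = w := congrArg Prod.snd he
      exact ⟨_, ⟨(s, ν), hm, rfl⟩, congrArg Prod.fst he⟩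
  have hTm : MeasurableSet {x | (x, w) ∈ flyBack ε a v '' S} :=
    (by fun_prop : Measurable fun x : Torus => (x, w)) himg
  rw [hT] at e2
  have hL : ∀ x : Torus, (flyBack ε a v '' S).indicator F (x, w)
      = {x | (x, w) ∈ flyBack ε a v '' S}.indicator (fun x => F (x, w)) x := fun x => rfl
  simp only [hL]
  rw [lintegral_indicator hTm, ← e2, ← e1, ← lintegral_indicator hSwm]
  refine lintegral_congr fun p => ?_
  by_cases hp : p ∈ Sw
  · rw [indicator_of_mem hp, indicator_of_mem (show ((p.1, p.2, w) : Mark) ∈ S from hp), fluxDensity,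
      max_eq_left (hpos _ hp).2.le]
    rfl
  · rw [indicator_of_notMem hp, indicator_of_notMem (show ((p.1, p.2, w) : Mark) ∉ S from hp)]

/-! ### Measurability of conditions on a continuous family -/

theorem isSigmaCompact_of_isLocallyClosed {S : Set ℝ} (hS : IsLocallyClosed S) :
    IsSigmaCompact S := by
  obtain ⟨U, Z, hU, hZ, rfl⟩ := hS
  obtain ⟨F, hF, -, hFU, -⟩ := hU.exists_iUnion_isClosed
  rw [← hFU, iUnion_inter]
  exact isSigmaCompact_iUnion _ fun n =>
    isSigmaCompact_univ.of_isClosed_subset ((hF n).inter hZ) (subset_univ _)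

theorem exists_countable_dense_subset (S : Set ℝ) :
    ∃ D ⊆ S, D.Countable ∧ S ⊆ closure D := by
  obtain ⟨D, hD, h1, h2⟩ := (TopologicalSpace.IsSeparable.of_separableSpace S).exists_countable_dense_subset
  exact ⟨D, hD, h1, h2⟩

theorem forall_mem_iff_of_subset_closure {S D : Set ℝ} (hDS : D ⊆ S) (hSD : S ⊆ closure D)
    {d : ℝ → ℝ} (hd : Continuous d) (c : ℝ) : (∀ s ∈ S, c ≤ d s) ↔ ∀ s ∈ D, c ≤ d s :=
  ⟨fun h s hs => h s (hDS hs), fun h _ hs =>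
    closure_minimal (t := {s | c ≤ d s}) h (isClosed_le continuous_const hd) (hSD hs)⟩

theorem measurableSet_forall_le {X : Type*} [MeasurableSpace X] {d : X → ℝ → ℝ}
    (hm : ∀ s, Measurable fun x => d x s) (hc : ∀ x, Continuous (d x)) (S : Set ℝ) (c : ℝ) :
    MeasurableSet {x | ∀ s ∈ S, c ≤ d x s} := by
  obtain ⟨D, hDS, hD, hSD⟩ := exists_countable_dense_subset S
  have : {x | ∀ s ∈ S, c ≤ d x s} = ⋂ s ∈ D, {x | c ≤ d x s} := by
    ext x
    simp only [mem_ofPred_eq, mem_iInter]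
    exact forall_mem_iff_of_subset_closure hDS hSD (hc x) c
  rw [this]
  exact MeasurableSet.biInter hD fun s _ => measurableSet_le measurable_const (hm s)

/-- A strict inequality cannot be tested on a dense subset. A locally closed set of times is
σ-compact, and on each compact piece the minimum is attained, so the inequality holds there with a
margin 1/(k+1) and the non-strict case applies. -/
theorem measurableSet_forall_lt {X : Type*} [MeasurableSpace X] {d : X → ℝ → ℝ}
    (hm : ∀ s, Measurable fun x => d x s) (hc : ∀ x, Continuous (d x)) {S : Set ℝ}
    (hS : IsLocallyClosed S) (c : ℝ) : MeasurableSet {x | ∀ s ∈ S, c < d x s} := by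
  obtain ⟨K, hK, hKS⟩ := isSigmaCompact_of_isLocallyClosed hS
  have : {x | ∀ s ∈ S, c < d x s}
      = ⋂ n, ⋃ k : ℕ, {x | ∀ s ∈ K n, c + 1 / ((k : ℝ) + 1) ≤ d x s} := by
    ext x
    simp only [mem_ofPred_eq, mem_iInter, mem_iUnion, ← hKS]
    constructor
    · intro h n
      rcases (K n).eq_empty_or_nonempty with h0 | h0
      · exact ⟨0, fun s hs => by simp [h0] at hs⟩
      · obtain ⟨s₀, hs₀, hmin⟩ := (hK n).exists_isMinOn h0 (hc x).continuousOn
        obtain ⟨k, hk⟩ := exists_nat_one_div_lt (sub_pos.2 (h s₀ ⟨n, hs₀⟩))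
        exact ⟨k, fun s hs => by have := isMinOn_iff.1 hmin s hs; linarith⟩
    · rintro h s ⟨n, hs⟩
      obtain ⟨k, hk⟩ := h n
      have := hk s hs
      have : 0 < 1 / ((k : ℝ) + 1) := by positivity
      linarith
  rw [this]
  exact MeasurableSet.iInter fun n => MeasurableSet.iUnion fun k =>
    measurableSet_forall_le hm hc _ _

/-! ### Paths of trees -/

namespace CollisionTree

theorem velAfter_succ (Φ : CollisionTree) {k : ℕ} (h : k < Φ.n) :
    velAfter Φ (k + 1)
      = velAfter Φ k - impulse (velAfter Φ k) (Φ.inVel ⟨k, h⟩) (Φ.dir ⟨k, h⟩) := by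
  rw [velAfter, dif_pos h]

theorem velAfter_prune {n : ℕ} (a : Phase × (Fin (n + 1) → Mark)) {k : ℕ} (hk : k ≤ n) :
    velAfter (prune ⟨n + 1, a⟩) k = velAfter ⟨n + 1, a⟩ k := by
  induction k with
  | zero => rfl
  | succ k ih =>
    have h1 : k < n := hk
    rw [velAfter_succ (prune ⟨n + 1, a⟩) h1,
      velAfter_succ (⟨n + 1, a⟩ : CollisionTree) (show k < n + 1 by omega), ih h1.le]
    rfl

/-- The final velocity of the tagged particle. -/
def endVel (Φ : CollisionTree) : Vel := velAfter Φ Φ.n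

/-- The position from which free flight with the final velocity leads to the final part of the path. -/
def anchor (Φ : CollisionTree) : Torus :=
  shift Φ.x₀ (-∑ j : Fin Φ.n, Φ.time j • (velAfter Φ (j + 1) - velAfter Φ j))

theorem pos_eq_anchor (Φ : CollisionTree) {s : ℝ} (hs : ∀ j, Φ.time j ≤ s) :
    Φ.pos s = shift Φ.anchor (s • Φ.endVel) := by
  rw [pos, anchor, shift_shift]
  congr 1
  have h1 : ∑ j : Fin Φ.n, (velAfter Φ (j + 1) - velAfter Φ j) = Φ.endVel - Φ.v₀ := by
    rw [Fin.sum_univ_eq_sum_range fun j => velAfter Φ (j + 1) - velAfter Φ j,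
      Finset.sum_range_sub]
    rfl
  have h2 : ∀ j : Fin Φ.n, max (s - Φ.time j) 0 • (velAfter Φ (j + 1) - velAfter Φ j)
      = s • (velAfter Φ (j + 1) - velAfter Φ j)
        - Φ.time j • (velAfter Φ (j + 1) - velAfter Φ j) := fun j => by
    rw [max_eq_left (sub_nonneg.2 (hs j)), sub_smul]
  simp only [h2]
  rw [Finset.sum_sub_distrib, ← Finset.smul_sum, h1, smul_sub]
  abel

theorem pos_succ {n : ℕ} (a : Phase × (Fin (n + 1) → Mark)) (s : ℝ) :
    pos ⟨n + 1, a⟩ s = shift (pos (prune ⟨n + 1, a⟩) s) (max (s - (a.2 (Fin.last n)).1) 0 •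
      (velAfter ⟨n + 1, a⟩ (n + 1) - velAfter ⟨n + 1, a⟩ n)) := by
  rw [pos, pos, shift_shift]
  congr 1
  have h1 := Fin.sum_univ_castSucc (n := n) fun j : Fin (n + 1) =>
    max (s - time (⟨n + 1, a⟩ : CollisionTree) j) 0 •
      (velAfter ⟨n + 1, a⟩ (j + 1) - velAfter ⟨n + 1, a⟩ j)
  have h2 : ∀ j : Fin n, max (s - time (prune ⟨n + 1, a⟩) j) 0 •
      (velAfter (prune ⟨n + 1, a⟩) (j + 1) - velAfter (prune ⟨n + 1, a⟩) j)
      = max (s - time (⟨n + 1, a⟩ : CollisionTree) j.castSucc) 0 •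
      (velAfter ⟨n + 1, a⟩ (j.castSucc + 1) - velAfter ⟨n + 1, a⟩ j.castSucc) := fun j => by
    rw [velAfter_prune a (show (j : ℕ) + 1 ≤ n from j.2), velAfter_prune a j.2.le]
    rfl
  change s • a.1.2 + ∑ j : Fin (n + 1), _ = _
  rw [h1, ← add_assoc]
  congr 2
  exact (Finset.sum_congr rfl fun j _ => (h2 j)).symm

theorem pos_prune {n : ℕ} (a : Phase × (Fin (n + 1) → Mark)) {s : ℝ}
    (hs : s ≤ (a.2 (Fin.last n)).1) : pos (prune ⟨n + 1, a⟩) s = pos ⟨n + 1, a⟩ s := by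
  rw [pos_succ, max_eq_right (by linarith), zero_smul, shift_zero]

theorem continuous_pos (Φ : CollisionTree) : Continuous Φ.pos := by
  unfold pos
  refine continuous_shift_comp continuous_const ?_
  fun_prop

theorem pos_zero_of_nonneg (Φ : CollisionTree) (h : ∀ j, 0 ≤ Φ.time j) : Φ.pos 0 = Φ.x₀ := by
  rw [pos]
  have : ∀ j : Fin Φ.n, max (0 - Φ.time j) 0 • (velAfter Φ (j + 1) - velAfter Φ j) = 0 := fun j => by
    rw [max_eq_right (by linarith [h j]), zero_smul]
  rw [Finset.sum_congr rfl fun j _ => this j, Finset.sum_const_zero, zero_smul, add_zero, shift_zero]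

theorem time_le_tau {Φ : CollisionTree} (h : StrictMono Φ.time) (j : Fin Φ.n) :
    Φ.time j ≤ Φ.tau := by
  obtain ⟨n, a⟩ := Φ
  cases n with
  | zero => exact j.elim0
  | succ n => exact h.monotone (Fin.le_last j)

theorem tau_nonneg {Φ : CollisionTree} (h : ∀ j, 0 ≤ Φ.time j) : 0 ≤ Φ.tau := by
  obtain ⟨n, a⟩ := Φ
  cases n with
  | zero => exact le_rfl
  | succ n => exact h (Fin.last n)

theorem vel_eq_endVel {Φ : CollisionTree} {s : ℝ} (h : ∀ j, Φ.time j ≤ s) :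
    Φ.vel s = Φ.endVel := by
  rw [vel, endVel]
  congr 1
  rw [Finset.filter_true_of_mem fun j _ => h j]
  simp

/-- The initial state of the background particle of collision `j`. -/
def startOf (ε : ℝ) (Φ : CollisionTree) (j : Fin Φ.n) : Phase :=
  (shift (Φ.pos (Φ.time j)) (ε • (Φ.dir j : Vel) - Φ.time j • Φ.inVel j), Φ.inVel j)

theorem bgPos_eq_of_le (ε : ℝ) (Φ : CollisionTree) (j : Fin Φ.n) {s : ℝ} (hs : s ≤ Φ.time j) :
    Φ.bgPos ε j s = shift (startOf ε Φ j).1 (s • Φ.inVel j) := by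
  rw [bgPos, startOf, shift_shift]
  congr 1
  rcases hs.lt_or_eq with h | h
  · rw [bgVel, if_pos h]; module
  · rw [h, sub_self, zero_smul]; module

theorem startOf_prune (ε : ℝ) {n : ℕ} (a : Phase × (Fin (n + 1) → Mark)) (j : Fin n)
    (hj : (a.2 j.castSucc).1 ≤ (a.2 (Fin.last n)).1) :
    startOf ε (prune ⟨n + 1, a⟩) j = startOf ε ⟨n + 1, a⟩ j.castSucc := by
  change ((shift (pos (prune ⟨n + 1, a⟩) (a.2 j.castSucc).1) _, _) : Phase) = _
  rw [pos_prune a hj]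
  rfl

/-- Up to its final collision the path is that of the pruned tree, which after its own last
collision moves with constant velocity. The last initial state therefore depends on the last mark
through `flyBack` alone, which makes a change of variables one collision at a time possible. -/
theorem startOf_last (ε : ℝ) {n : ℕ} (a : Phase × (Fin (n + 1) → Mark))
    (h : ∀ j : Fin n, (a.2 j.castSucc).1 ≤ (a.2 (Fin.last n)).1) :
    startOf ε ⟨n + 1, a⟩ (Fin.last n)
      = flyBack ε (anchor (prune ⟨n + 1, a⟩)) (endVel (prune ⟨n + 1, a⟩)) (a.2 (Fin.last n)) := by
  change ((shift (pos ⟨n + 1, a⟩ (a.2 (Fin.last n)).1) (ε • ((a.2 (Fin.last n)).2.1 : Vel)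
    - (a.2 (Fin.last n)).1 • (a.2 (Fin.last n)).2.2), _) : Phase) = _
  refine Prod.ext ?_ rfl
  simp only [flyBack]
  rw [← pos_prune a le_rfl, pos_eq_anchor (prune ⟨n + 1, a⟩) h, shift_shift]
  congr 1
  module

theorem bgVel_prune {n : ℕ} (a : Phase × (Fin (n + 1) → Mark)) (j : Fin n) (s : ℝ) :
    bgVel (prune ⟨n + 1, a⟩) j s = bgVel ⟨n + 1, a⟩ j.castSucc s := by
  have h := velAfter_prune a (k := j) j.2.le
  unfold bgVel
  rw [h]
  rfl

theorem bgPos_prune (ε : ℝ) {n : ℕ} (a : Phase × (Fin (n + 1) → Mark)) (j : Fin n) (s : ℝ)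
    (hj : (a.2 j.castSucc).1 ≤ (a.2 (Fin.last n)).1) :
    bgPos ε (prune ⟨n + 1, a⟩) j s = bgPos ε ⟨n + 1, a⟩ j.castSucc s := by
  change shift (pos (prune ⟨n + 1, a⟩) (a.2 j.castSucc).1) _ = _
  rw [pos_prune a hj]
  change shift _ (_ + (s - (a.2 j.castSucc).1) • bgVel (prune ⟨n + 1, a⟩) j s) = _
  rw [bgVel_prune]
  rfl

/-! ### Measurable dependence on the tree -/

section Measurability

variable {n : ℕ} {X : Type*} [MeasurableSpace X] {a : X → Phase × (Fin n → Mark)}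

theorem measurable_velAfter (ha : Measurable a) (k : ℕ) :
    Measurable fun x => velAfter ⟨n, a x⟩ k := by
  induction k with
  | zero =>
    change Measurable fun x => (a x).1.2
    fun_prop
  | succ k ih =>
    by_cases h : k < n
    · have : (fun x => velAfter ⟨n, a x⟩ (k + 1)) = fun x => velAfter ⟨n, a x⟩ k -
          impulse (velAfter ⟨n, a x⟩ k) ((a x).2 ⟨k, h⟩).2.2 ((a x).2 ⟨k, h⟩).2.1 := by
        funext x; exact velAfter_succ ⟨n, a x⟩ h
      rw [this]
      unfold impulse
      fun_prop
    · have : (fun x => velAfter ⟨n, a x⟩ (k + 1)) = fun x => velAfter ⟨n, a x⟩ k := by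
        funext x; rw [velAfter]; exact dif_neg h
      rw [this]; exact ih

theorem measurable_pos (ha : Measurable a) {s : X → ℝ} (hs : Measurable s) :
    Measurable fun x => pos ⟨n, a x⟩ (s x) := by
  have hv := fun k => measurable_velAfter ha k
  change Measurable fun x => shift (a x).1.1 (s x • (a x).1.2 +
    ∑ j : Fin n, max (s x - ((a x).2 j).1) 0 • (velAfter ⟨n, a x⟩ (j + 1) - velAfter ⟨n, a x⟩ j))
  refine measurable_shift_comp (by fun_prop) ?_
  fun_prop

theorem measurable_anchor (ha : Measurable a) : Measurable fun x => anchor ⟨n, a x⟩ := by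
  have hv := fun k => measurable_velAfter ha k
  change Measurable fun x => shift (a x).1.1
    (-∑ j : Fin n, ((a x).2 j).1 • (velAfter ⟨n, a x⟩ (j + 1) - velAfter ⟨n, a x⟩ j))
  refine measurable_shift_comp (by fun_prop) ?_
  fun_prop

end Measurability

end CollisionTree

/-! ### Sets of initial states that avoid a path -/

/-- The initial states whose free flight stays farther than `ε` from the path `p` at the times in `S`. -/
def avoidSet (p : ℝ → Torus) (ε : ℝ) (S : Set ℝ) : Set Phase :=
  {q | ∀ s ∈ S, ε < torusDist (p s) (shift q.1 (s • q.2))}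

theorem avoiding_eq (ε t : ℝ) (Φ : CollisionTree) : avoiding ε t Φ = avoidSet Φ.pos ε (Ioo 0 t) := rfl

theorem avoidSet_anti {p : ℝ → Torus} {ε : ℝ} {S S' : Set ℝ} (h : S ⊆ S') :
    avoidSet p ε S' ⊆ avoidSet p ε S := fun _ hq s hs => hq s (h hs)

theorem measurableSet_avoidSet {p : ℝ → Torus} (hp : Continuous p) (ε : ℝ) {S : Set ℝ}
    (hS : IsLocallyClosed S) : MeasurableSet (avoidSet p ε S) := by
  refine measurableSet_forall_lt (d := fun (q : Phase) s => torusDist (p s) (shift q.1 (s • q.2)))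
    (fun s => ?_) (fun q => ?_) hS ε
  · exact measurable_torusDist_comp measurable_const
      (measurable_shift_comp measurable_fst (by fun_prop))
  · exact continuous_torusDist_comp hp (continuous_shift_comp continuous_const (by fun_prop))

/-- The states avoiding the path of a tree depend measurably on the tree. -/
theorem measurableSet_avoidSet_tree {n : ℕ} (ε : ℝ) {S : Set ℝ} (hS : IsLocallyClosed S) :
    MeasurableSet {z : (Phase × (Fin n → Mark)) × Phase |
      z.2 ∈ avoidSet (CollisionTree.pos ⟨n, z.1⟩) ε S} := by
  refine measurableSet_forall_lt (d := fun (z : (Phase × (Fin n → Mark)) × Phase) s =>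
    torusDist (CollisionTree.pos ⟨n, z.1⟩ s) (shift z.2.1 (s • z.2.2))) (fun s => ?_) (fun z => ?_) hS ε
  · exact measurable_torusDist_comp (CollisionTree.measurable_pos measurable_fst measurable_const)
      (measurable_shift_comp (by fun_prop) (by fun_prop))
  · exact continuous_torusDist_comp (CollisionTree.continuous_pos _)
      (continuous_shift_comp continuous_const (by fun_prop))

/-! ### The background density -/

/-- The law of a particle with density `g`. -/
def lawOf (g : Phase → ℝ) : Measure Phase :=
  (volume : Measure Phase).withDensity fun q => ENNReal.ofReal (g q)

instance (g : Phase → ℝ) : SigmaFinite (lawOf g) := by unfold lawOf; infer_instance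

theorem lawOf_apply (g : Phase → ℝ) (s : Set Phase) :
    lawOf g s = ∫⁻ q in s, ENNReal.ofReal (g q) := withDensity_apply' _ _

theorem setIntegral_eq_lawOf {g : Phase → ℝ} (hm : Measurable g) (h0 : ∀ q, 0 ≤ g q)
    (s : Set Phase) : ∫ q in s, g q = (lawOf g s).toReal := by
  rw [lawOf_apply, integral_eq_lintegral_of_nonneg_ae (Eventually.of_forall h0)
    hm.aestronglyMeasurable]

/-- A measurable bound for the density, uniform in space, together with continuity in space. -/
structure IsMajorant (g₀ : Phase → ℝ) (G : Vel → ENNReal) : Prop where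
  measurable : Measurable G
  finite : ∫⁻ w, G w * ENNReal.ofReal (1 + ‖w‖ ^ 2) < ⊤
  bound : ∀ᵐ w : Vel, (Continuous fun x : Torus => g₀ (x, w)) ∧
    ∀ x, ENNReal.ofReal (g₀ (x, w)) ≤ G w

theorem continuous_of_holder {u : Torus → ℝ} {L α : ℝ} (hα : 0 < α)
    (h : ∀ x y, |u x - u y| ≤ L * torusDist x y ^ α) : Continuous u := by
  refine continuous_iff_continuousAt.2 fun x => ?_
  rw [ContinuousAt, tendsto_iff_dist_tendsto_zero]
  have h1 : Tendsto (fun y => L * torusDist y x ^ α) (𝓝 x) (𝓝 (L * 0 ^ α)) := by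
    refine Tendsto.const_mul L ?_
    have h2 : Tendsto (fun y => torusDist y x) (𝓝 x) (𝓝 (torusDist x x)) :=
      (continuous_torusDist_comp continuous_id continuous_const).tendsto x
    have h3 : torusDist x x = 0 := by simp [torusDist]
    rw [h3] at h2
    exact h2.rpow_const (Or.inr hα.le)
  rw [Real.zero_rpow hα.ne', mul_zero] at h1
  exact squeeze_zero (fun _ => dist_nonneg) (fun y => h y x) h1

/-- The supremum over a countable dense set of positions is measurable in the velocity. Continuity
in space, from the Hölder bound, makes it dominate g₀ at every position and keeps it below the
essential supremum, so that it inherits the second moment. -/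
theorem BackgroundAdmissible.exists_majorant {g₀ : Phase → ℝ} (hg : BackgroundAdmissible g₀) :
    ∃ G, IsMajorant g₀ G := by
  set G : Vel → ENNReal := fun w => ⨆ k, ENNReal.ofReal (g₀ (TopologicalSpace.denseSeq Torus k, w))
  have hGm : Measurable G := by
    refine Measurable.iSup fun k => ?_
    exact (hg.measurable.comp (by fun_prop)).ennreal_ofReal
  obtain ⟨L, -, α, hα, -, hae⟩ := hg.holder
  have hc : ∀ᵐ w : Vel, Continuous fun x : Torus => g₀ (x, w) := by
    filter_upwards [hae] with w hw using continuous_of_holder hα hw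
  refine ⟨G, hGm, ?_, ?_⟩
  · refine lt_of_le_of_lt (lintegral_mono_ae ?_) hg.moment
    filter_upwards [hc] with w hw
    gcongr
    refine iSup_le fun k => ?_
    have h1 : ∀ᵐ x : Torus, ENNReal.ofReal (g₀ (x, w)) ≤ gbar g₀ w := ENNReal.ae_le_essSup _
    have h2 := Measure.dense_of_ae h1
    have h3 : IsClosed {x : Torus | ENNReal.ofReal (g₀ (x, w)) ≤ gbar g₀ w} :=
      isClosed_le (ENNReal.continuous_ofReal.comp hw) continuous_const
    have h4 := h3.closure_eq ▸ h2.closure_eq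
    exact (eq_univ_iff_forall.1 h4) _
  · filter_upwards [hc] with w hw
    refine ⟨hw, fun x => ?_⟩
    have h3 : IsClosed {x : Torus | ENNReal.ofReal (g₀ (x, w)) ≤ G w} :=
      isClosed_le (ENNReal.continuous_ofReal.comp hw) continuous_const
    have h2 : range (TopologicalSpace.denseSeq Torus)
        ⊆ {x : Torus | ENNReal.ofReal (g₀ (x, w)) ≤ G w} := by
      rintro _ ⟨k, rfl⟩
      exact le_iSup (fun k => ENNReal.ofReal (g₀ (TopologicalSpace.denseSeq Torus k, w))) k
    exact (h3.closure_subset_iff.2 h2) (TopologicalSpace.denseRange_denseSeq Torus x)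

theorem IsMajorant.lintegral_lt_top {g₀ : Phase → ℝ} {G : Vel → ENNReal} (hG : IsMajorant g₀ G)
    {A : ℝ} {φ : Vel → ℝ} (hφ : ∀ w, φ w ≤ A * (1 + ‖w‖ ^ 2)) :
    ∫⁻ w, G w * ENNReal.ofReal (φ w) < ⊤ := by
  have hm : Measurable fun w : Vel => G w * ENNReal.ofReal (1 + ‖w‖ ^ 2) :=
    hG.measurable.mul (by fun_prop)
  calc ∫⁻ w, G w * ENNReal.ofReal (φ w)
      ≤ ∫⁻ w, ENNReal.ofReal A * (G w * ENNReal.ofReal (1 + ‖w‖ ^ 2)) := by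
        refine lintegral_mono fun w => ?_
        rw [mul_left_comm, ← ENNReal.ofReal_mul' (by positivity)]
        gcongr
        exact hφ w
    _ = ENNReal.ofReal A * ∫⁻ w, G w * ENNReal.ofReal (1 + ‖w‖ ^ 2) := lintegral_const_mul _ hm
    _ < ⊤ := ENNReal.mul_lt_top ENNReal.ofReal_lt_top hG.finite

/-! ### Volume of the neighbourhood of a path -/

/-- Time is cut into steps of length δ = ε/(Λ + |w| + 1), during which path and particle move
relative to each other by at most ε. The tube is then covered by balls of radius 2ε, one per step,
each of volume at most (4ε)³. -/
theorem volume_tube_le {p : ℝ → Torus} {Λ : ℝ} (hΛ : 0 ≤ Λ)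
    (hp : ∀ s s', torusDist (p s) (p s') ≤ Λ * |s - s'|) {a b ε : ℝ} (hab : a ≤ b) (hε : 0 < ε)
    (w : Vel) :
    volume {x : Torus | ∃ s ∈ Icc a b, torusDist (p s) (shift x (s • w)) ≤ ε}
      ≤ ENNReal.ofReal (64 * ε ^ 3 + 64 * ε ^ 2 * ((b - a) * (Λ + ‖w‖ + 1))) := by
  set δ : ℝ := ε / (Λ + ‖w‖ + 1) with hδ
  have hden : 0 < Λ + ‖w‖ + 1 := by positivity
  have hδ0 : 0 < δ := by positivity
  set K : ℕ := ⌊(b - a) / δ⌋₊ + 1 with hK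
  have hsub : {x : Torus | ∃ s ∈ Icc a b, torusDist (p s) (shift x (s • w)) ≤ ε}
      ⊆ ⋃ i ∈ Finset.range K, {x : Torus |
        torusDist (shift (p (a + i * δ)) (-((a + i * δ) • w))) x ≤ 2 * ε} := by
    rintro x ⟨s, hs, hd⟩
    simp only [mem_iUnion, Finset.mem_range]
    have hsa : 0 ≤ s - a := sub_nonneg.2 hs.1
    refine ⟨⌊(s - a) / δ⌋₊, ?_, ?_⟩
    · rw [hK, Nat.lt_succ_iff]
      exact Nat.floor_le_floor (by gcongr; exact hs.2)
    · set i := ⌊(s - a) / δ⌋₊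
      have h1 : (i : ℝ) * δ ≤ s - a := by
        rw [← le_div_iff₀ hδ0]; exact Nat.floor_le (by positivity)
      have h2 : s - a < (i + 1) * δ := by
        rw [← div_lt_iff₀ hδ0]; exact Nat.lt_floor_add_one _
      set r := a + i * δ with hr
      have hrs : |r - s| ≤ δ := by rw [abs_le]; constructor <;> linarith
      have h3 : torusDist (shift (p r) (-(r • w))) (shift (p s) (-(r • w))) ≤ Λ * δ := by
        rw [torusDist_shift_shift]
        exact (hp _ _).trans (by gcongr)
      have h4 : torusDist (shift (p s) (-(r • w))) (shift (p s) (-(s • w))) ≤ δ * ‖w‖ := by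
        refine (torusDist_shift_le _ _ _).trans ?_
        have : -(r • w) - -(s • w) = (-(r - s)) • w := by module
        rw [this, norm_smul, norm_neg, Real.norm_eq_abs]
        gcongr
      have h5 : torusDist (shift (p s) (-(s • w))) x ≤ ε := by
        rw [torusDist_shift_left, neg_neg]; exact hd
      have h6 : Λ * δ + δ * ‖w‖ ≤ ε := by
        have : δ * (Λ + ‖w‖ + 1) = ε := by rw [hδ]; field_simp
        nlinarith
      have t1 := torusDist_triangle (shift (p r) (-(r • w))) (shift (p s) (-(r • w))) x
      have t2 := torusDist_triangle (shift (p s) (-(r • w))) (shift (p s) (-(s • w))) x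
      change torusDist _ _ ≤ _
      linarith
  refine (measure_mono hsub).trans ((measure_biUnion_finset_le _ _).trans ?_)
  refine (Finset.sum_le_sum fun i _ => volume_torusDist_le _ (by positivity)).trans ?_
  rw [Finset.sum_const, Finset.card_range, nsmul_eq_mul, ← ENNReal.ofReal_natCast,
    ← ENNReal.ofReal_mul (by positivity)]
  refine ENNReal.ofReal_le_ofReal ?_
  have hKle : (K : ℝ) ≤ (b - a) / δ + 1 := by
    rw [hK]; push_cast
    have := Nat.floor_le (div_nonneg (sub_nonneg.2 hab) hδ0.le)
    linarith
  calc (K : ℝ) * (2 * (2 * ε)) ^ 3 ≤ ((b - a) / δ + 1) * (2 * (2 * ε)) ^ 3 := by gcongr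
    _ = 64 * ε ^ 3 + 64 * ε ^ 2 * ((b - a) * (Λ + ‖w‖ + 1)) := by
      rw [hδ]; field_simp; ring

/-- The restriction to velocities in W lets the bound serve for the whole background (positivity of
the free mass) and for the fast particles only (computation of the hit rate). -/
theorem lawOf_tube_le {g₀ : Phase → ℝ} (hgm : Measurable g₀) {G : Vel → ENNReal}
    (hG : IsMajorant g₀ G) {p : ℝ → Torus} (hpc : Continuous p) {Λ : ℝ} (hΛ : 0 ≤ Λ)
    (hp : ∀ s s', torusDist (p s) (p s') ≤ Λ * |s - s'|) {a b ε : ℝ} (hab : a ≤ b) (hε : 0 < ε)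
    {W : Set Vel} (hW : MeasurableSet W) :
    lawOf g₀ ((avoidSet p ε (Icc a b))ᶜ ∩ {q | q.2 ∈ W})
      ≤ ∫⁻ w in W, G w * ENNReal.ofReal
          (64 * ε ^ 3 + 64 * ε ^ 2 * ((b - a) * (Λ + ‖w‖ + 1))) := by
  have hB : MeasurableSet ((avoidSet p ε (Icc a b))ᶜ ∩ {q | q.2 ∈ W}) :=
    (measurableSet_avoidSet hpc ε isClosed_Icc.isLocallyClosed).compl.inter (measurable_snd hW)
  rw [lawOf_apply, ← lintegral_indicator hB, Measure.volume_eq_prod,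
    lintegral_prod_symm _ (hgm.ennreal_ofReal.indicator hB).aemeasurable, ← lintegral_indicator hW]
  refine lintegral_mono_ae ?_
  filter_upwards [hG.bound] with w hw
  by_cases hwW : w ∈ W
  · rw [indicator_of_mem hwW]
    set E : Set Torus := {x : Torus | ∃ s ∈ Icc a b, torusDist (p s) (shift x (s • w)) ≤ ε} with hE
    have hEm : MeasurableSet {x : Torus | (x, w) ∈ (avoidSet p ε (Icc a b))ᶜ ∩ {q | q.2 ∈ W}} :=
      (by fun_prop : Measurable fun x : Torus => (x, w)) hB
    have hEE : {x : Torus | (x, w) ∈ (avoidSet p ε (Icc a b))ᶜ ∩ {q | q.2 ∈ W}} ⊆ E := by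
      rintro x ⟨hx, -⟩
      simp only [mem_compl_iff, avoidSet, mem_ofPred_eq] at hx
      push Not at hx
      exact hx
    calc ∫⁻ x : Torus, ((avoidSet p ε (Icc a b))ᶜ ∩ {q | q.2 ∈ W}).indicator
          (fun q => ENNReal.ofReal (g₀ q)) (x, w)
        ≤ ∫⁻ x : Torus, {x : Torus | (x, w) ∈ (avoidSet p ε (Icc a b))ᶜ ∩ {q | q.2 ∈ W}}.indicator
          (fun _ => G w) x := by
          refine lintegral_mono fun x => ?_
          by_cases hx : (x, w) ∈ (avoidSet p ε (Icc a b))ᶜ ∩ {q | q.2 ∈ W}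
          · have hx' : x ∈ {x : Torus | (x, w) ∈ (avoidSet p ε (Icc a b))ᶜ ∩ {q | q.2 ∈ W}} := hx
            rw [indicator_of_mem hx, indicator_of_mem hx']
            exact hw.2 x
          · rw [indicator_of_notMem hx]; exact zero_le
      _ = G w * volume {x : Torus | (x, w) ∈ (avoidSet p ε (Icc a b))ᶜ ∩ {q | q.2 ∈ W}} := by
          rw [lintegral_indicator_const hEm]
      _ ≤ _ := by
          gcongr
          exact (measure_mono hEE).trans (volume_tube_le hΛ hp hab hε w)
  · rw [indicator_of_notMem hwW]
    refine le_of_eq (lintegral_eq_zero_of_ae_eq_zero (Eventually.of_forall fun x => ?_))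
    exact indicator_of_notMem (fun h => hwW h.2) _

/-! ### Positivity of the mass of background particles not yet hit -/

namespace CollisionTree

/-- A bound for the speed of the tagged particle. -/
def speedBound (Φ : CollisionTree) : ℝ :=
  ‖Φ.v₀‖ + ∑ j : Fin Φ.n, ‖velAfter Φ (j + 1) - velAfter Φ j‖

theorem speedBound_nonneg (Φ : CollisionTree) : 0 ≤ Φ.speedBound := by
  unfold speedBound; positivity

theorem torusDist_pos_le (Φ : CollisionTree) (s s' : ℝ) :
    torusDist (Φ.pos s) (Φ.pos s') ≤ Φ.speedBound * |s - s'| := by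
  rw [pos, pos]
  refine (torusDist_shift_le _ _ _).trans ?_
  rw [add_sub_add_comm, ← sub_smul, ← Finset.sum_sub_distrib, speedBound, add_mul, Finset.sum_mul]
  refine (norm_add_le _ _).trans (add_le_add ?_ ((norm_sum_le _ _).trans ?_))
  · rw [norm_smul, Real.norm_eq_abs, mul_comm]
  · refine Finset.sum_le_sum fun j _ => ?_
    rw [← sub_smul, norm_smul, mul_comm, Real.norm_eq_abs]
    have h := abs_max_sub_max_le_abs (s - Φ.time j) (s' - Φ.time j) 0
    rw [sub_sub_sub_cancel_right] at h
    exact mul_le_mul_of_nonneg_left h (norm_nonneg _)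

theorem speedBound_le {T b : ℝ} (hT : 0 ≤ T) {Φ : CollisionTree} (hpos : ∀ j, 0 < Φ.time j)
    (hle : ∀ j, Φ.time j ≤ T) (h : Φ.SpeedLe T b) : Φ.speedBound ≤ b * (1 + 2 * Φ.n) := by
  have h0 : ‖Φ.v₀‖ ≤ b := by
    have h1 := (h 0 ⟨le_rfl, hT⟩).1
    have h2 : Φ.vel 0 = Φ.v₀ := by
      rw [vel, Finset.filter_false_of_mem fun j _ => not_le.2 (hpos j)]
      rfl
    rwa [h2] at h1
  have h1 : ∀ j : Fin Φ.n, ‖velAfter Φ (j + 1) - velAfter Φ j‖ ≤ 2 * b := fun j => by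
    have e1 := (h 0 ⟨le_rfl, hT⟩).2 j
    have e2 := (h (Φ.time j) ⟨(hpos j).le, hle j⟩).2 j
    rw [bgVel, if_pos (hpos j)] at e1
    rw [bgVel, if_neg (lt_irrefl _)] at e2
    rw [velAfter_succ Φ j.2]
    -- By conservation of momentum the jump of the tagged velocity is minus the jump of the
    -- background velocity, whose values before and after the collision are both bounded by b.
    -- Positivity of the collision time is needed for time 0 to show the value before.
    have e3 : velAfter Φ j - impulse (velAfter Φ j) (Φ.inVel j) (Φ.dir j) - velAfter Φ j
        = Φ.inVel j - (Φ.inVel j + impulse (velAfter Φ j) (Φ.inVel j) (Φ.dir j)) := by abel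
    change ‖velAfter Φ j - impulse (velAfter Φ j) (Φ.inVel j) (Φ.dir j) - velAfter Φ j‖ ≤ _
    rw [e3]
    refine (norm_sub_le _ _).trans ?_
    linarith
  unfold speedBound
  have h2 := Finset.sum_le_sum fun j (_ : j ∈ Finset.univ) => h1 j
  rw [Finset.sum_const, Finset.card_univ, Fintype.card_fin, nsmul_eq_mul] at h2
  linarith

/-- In a tree without initial overlap all collision times are positive. -/
theorem time_pos_of_noInitialOverlap {ε T : ℝ} (hε : 0 ≤ ε) {Φ : CollisionTree} (hT : Φ.IsTree T)
    (h : Φ.NoInitialOverlap ε) (j : Fin Φ.n) : 0 < Φ.time j := by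
  refine lt_of_le_of_ne (hT.2 j).1 fun h0 => ?_
  have h1 := h j
  rw [bgPos, ← h0, sub_self, zero_smul, add_zero, pos_zero_of_nonneg Φ fun i => (hT.2 i).1] at h1
  have h2 := torusDist_shift_self_le Φ.x₀ (ε • (Φ.dir j : Vel))
  rw [norm_smul, Real.norm_of_nonneg hε] at h2
  simp at h2
  linarith

end CollisionTree

/-- With x = √ε the cut-offs give xV ≤ 1, since (xV)³ = x·εV³, and xn ≤ 1. Hence ε²V(1 + 2n) =
ε(xV)(x + 2xn) ≤ 3ε: the tube swept by a good tree has volume of order ε. -/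
theorem CutOffs.sq_mul_le {V M : ℝ → ℝ} (h : CutOffs V M) {ε : ℝ} (hε : ε ∈ Ioo (0 : ℝ) 1) {n : ℕ}
    (hn : (n : ℝ) ≤ M ε) : ε ^ 2 * (V ε * (1 + 2 * n)) ≤ 3 * ε := by
  obtain ⟨h1, h2⟩ := h.bound ε hε
  have hV := (h.nonneg ε hε.1).1
  set x := √ε with hx
  have hx0 : 0 < x := Real.sqrt_pos.2 hε.1
  have hxε : x ^ 2 = ε := Real.sq_sqrt hε.1.le
  have hx1 : x ≤ 1 := Real.sqrt_le_one.2 hε.2.le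
  have hxV : x * V ε ≤ 1 := by
    by_contra hcon
    push Not at hcon
    have h3 : 1 < (x * V ε) ^ 3 := one_lt_pow₀ hcon (by norm_num)
    have h4 : (x * V ε) ^ 3 = x * (ε * V ε ^ 3) := by rw [← hxε]; ring
    nlinarith
  have hxn : x * n ≤ 1 := by
    have h3 : x * n ≤ x * (1 / x) := by gcongr; exact hn.trans h2
    rwa [mul_one_div_cancel hx0.ne'] at h3
  have hn0 : (0 : ℝ) ≤ n := Nat.cast_nonneg n
  have h5 : x * (1 + 2 * n) ≤ 3 := by nlinarith
  calc ε ^ 2 * (V ε * (1 + 2 * n)) = ε * ((x * V ε) * (x * (1 + 2 * n))) := by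
        rw [← hxε]; ring
    _ ≤ ε * (1 * 3) := by gcongr; exact hε.1.le
    _ = 3 * ε := by ring

theorem one_add_le_two_mul (r : ℝ) : 1 + r ≤ 2 * (1 + r ^ 2) := by nlinarith [sq_nonneg (r - 1)]

/-- For small diameters the good trees leave some background particles unhit. -/
theorem exists_lawOf_compl_avoidSet_lt_one {T : ℝ} (hT : 0 < T) {g₀ : Phase → ℝ}
    (hg : BackgroundAdmissible g₀) {V M : ℝ → ℝ} (hVM : CutOffs V M) :
    ∃ ε₀ > 0, ∀ ε ∈ Ioo 0 ε₀, ∀ Φ ∈ goodTrees T V M ε,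
      lawOf g₀ (avoidSet Φ.pos ε (Icc 0 T))ᶜ < 1 := by
  obtain ⟨G, hG⟩ := hg.exists_majorant
  set I := ∫⁻ w, G w * ENNReal.ofReal (1 + ‖w‖ ^ 2) with hI
  -- 64(1 + 4T) is the constant of the tube estimate once ε²·`speedBound` ≤ 3ε is used, and the
  -- factor 2 comes from 1 + r ≤ 2(1 + r²). The bound for the mass of the tube is then εK times the
  -- moment, below 1 for ε under the chosen threshold.
  set K : ℝ := 64 * (1 + 4 * T) * 2 with hK
  have hK0 : 0 < K := by positivity
  refine ⟨min 1 (1 / (K * I.toReal + 1)), by positivity, ?_⟩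
  rintro ε ⟨hε0, hε⟩ Φ ⟨hTree, hn, hsp, -, hov, -⟩
  have hε1 : ε < 1 := hε.trans_le (min_le_left _ _)
  have hε2 : ε < 1 / (K * I.toReal + 1) := hε.trans_le (min_le_right _ _)
  have hΛ := CollisionTree.speedBound_le hT.le
    (CollisionTree.time_pos_of_noInitialOverlap hε0.le hTree hov) (fun j => (hTree.2 j).2) hsp
  have hcut := hVM.sq_mul_le ⟨hε0, hε1⟩ hn
  have h1 := lawOf_tube_le hg.measurable hG Φ.continuous_pos Φ.speedBound_nonneg Φ.torusDist_pos_le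
    hT.le hε0 (W := univ) MeasurableSet.univ
  have h2 : (avoidSet Φ.pos ε (Icc 0 T))ᶜ ∩ {q | q.2 ∈ (univ : Set Vel)}
      = (avoidSet Φ.pos ε (Icc 0 T))ᶜ := by simp
  rw [h2, Measure.restrict_univ] at h1
  refine h1.trans_lt ?_
  have hm : Measurable fun w : Vel => G w * ENNReal.ofReal (1 + ‖w‖ ^ 2) :=
    hG.measurable.mul (by fun_prop)
  calc ∫⁻ w, G w * ENNReal.ofReal
          (64 * ε ^ 3 + 64 * ε ^ 2 * ((T - 0) * (Φ.speedBound + ‖w‖ + 1)))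
      ≤ ∫⁻ w, ENNReal.ofReal (ε * K) * (G w * ENNReal.ofReal (1 + ‖w‖ ^ 2)) := by
        refine lintegral_mono fun w => ?_
        rw [mul_left_comm (ENNReal.ofReal (ε * K)), ← ENNReal.ofReal_mul (by positivity)]
        gcongr
        have hsp2 : ε ^ 2 * Φ.speedBound ≤ 3 * ε := le_trans (by gcongr) hcut
        have hw := one_add_le_two_mul ‖w‖
        have hw0 := norm_nonneg w
        have e1 : ε ^ 3 ≤ ε := by
          calc ε ^ 3 ≤ ε ^ 1 := pow_le_pow_of_le_one hε0.le hε1.le (by norm_num)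
            _ = ε := pow_one ε
        have e2 : ε ^ 2 ≤ ε := by
          calc ε ^ 2 ≤ ε ^ 1 := pow_le_pow_of_le_one hε0.le hε1.le (by norm_num)
            _ = ε := pow_one ε
        have e3 : ε ^ 2 * (Φ.speedBound + ‖w‖ + 1) ≤ ε * (4 * (1 + ‖w‖)) := by nlinarith
        calc 64 * ε ^ 3 + 64 * ε ^ 2 * ((T - 0) * (Φ.speedBound + ‖w‖ + 1))
            = 64 * ε ^ 3 + 64 * T * (ε ^ 2 * (Φ.speedBound + ‖w‖ + 1)) := by ring
          _ ≤ 64 * ε + 64 * T * (ε * (4 * (1 + ‖w‖))) := by gcongr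
          _ ≤ 64 * ε * (1 + ‖w‖) + 64 * T * (ε * (4 * (1 + ‖w‖))) := by nlinarith
          _ = ε * (64 * (1 + 4 * T)) * (1 + ‖w‖) := by ring
          _ ≤ ε * (64 * (1 + 4 * T)) * (2 * (1 + ‖w‖ ^ 2)) := by gcongr
          _ = ε * K * (1 + ‖w‖ ^ 2) := by rw [hK]; ring
    _ = ENNReal.ofReal (ε * K) * I := lintegral_const_mul _ hm
    _ = ENNReal.ofReal (ε * K * I.toReal) := by
        rw [ENNReal.ofReal_mul (mul_nonneg hε0.le hK0.le), ENNReal.ofReal_toReal hG.finite.ne]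
    _ < 1 := by
        rw [← ENNReal.ofReal_one, ENNReal.ofReal_lt_ofReal_iff one_pos]
        have hI0 : 0 ≤ I.toReal := ENNReal.toReal_nonneg
        rw [lt_div_iff₀ (by positivity)] at hε2
        nlinarith

/-! ### The rate at which a path with constant velocity hits background particles -/

/-- The measure on directions and velocities of incoming particles. -/
def dirVelMeasure : Measure (Sph × Vel) := sphereMeasure.prod volume

instance : SFinite dirVelMeasure := by unfold dirVelMeasure; infer_instance

theorem markMeasure_eq : markMeasure = (volume : Measure ℝ).prod dirVelMeasure := rfl

/-- The density of the collision rate at time `t` on the path `a + s v`. -/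
def rateDensity (g₀ : Phase → ℝ) (ε : ℝ) (a : Torus) (v : Vel) (t : ℝ) (p : Sph × Vel) : ENNReal :=
  ENNReal.ofReal (max (inner ℝ (v - p.2) (p.1 : Vel)) 0)
    * ENNReal.ofReal (g₀ (flyBack ε a v (t, p.1, p.2)))

/-- The initial states of the particles hit by the path `a + s v` at a time in `I`. -/
def hitSet (ε : ℝ) (a : Torus) (v : Vel) (I : Set ℝ) : Set Phase :=
  flyBack ε a v '' {m | m.1 ∈ I ∧ 0 < inner ℝ (v - m.2.2) (m.2.1 : Vel)}

theorem max_inner_le (u : Vel) (ν : Sph) : max (inner ℝ u (ν : Vel)) 0 ≤ ‖u‖ := by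
  refine max_le ?_ (norm_nonneg _)
  have := real_inner_le_norm u (ν : Vel)
  simpa using this

theorem measurable_rateDensity {g₀ : Phase → ℝ} (hg : Measurable g₀) (ε : ℝ) (a : Torus) (v : Vel)
    (t : ℝ) : Measurable (rateDensity g₀ ε a v t) := by
  unfold rateDensity
  refine Measurable.mul (by fun_prop) (Measurable.ennreal_ofReal ?_)
  exact hg.comp ((continuous_flyBack ε a v).measurable.comp (by fun_prop))

theorem ae_dirVel_of_ae {P : Vel → Prop} (h : ∀ᵐ w : Vel, P w) : ∀ᵐ p ∂dirVelMeasure, P p.2 :=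
  Measure.quasiMeasurePreserving_snd.ae h

theorem lintegral_rate_bound {g₀ : Phase → ℝ} {G : Vel → ENNReal} (hG : IsMajorant g₀ G) (v : Vel) :
    ∫⁻ p, G p.2 * ENNReal.ofReal ‖v - p.2‖ ∂dirVelMeasure < ⊤ := by
  have hm : Measurable fun p : Sph × Vel => G p.2 * ENNReal.ofReal ‖v - p.2‖ :=
    (hG.measurable.comp measurable_snd).mul (by fun_prop)
  rw [dirVelMeasure, lintegral_prod _ hm.aemeasurable]
  simp only [lintegral_const]
  refine ENNReal.mul_lt_top ?_ (measure_lt_top _ _)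
  refine hG.lintegral_lt_top (A := ‖v‖ + 1) fun w => ?_
  have h1 := norm_sub_le v w
  have h2 := norm_nonneg v
  have h3 := norm_nonneg w
  nlinarith [sq_nonneg (‖w‖ - 1)]

theorem rateDensity_le {g₀ : Phase → ℝ} {G : Vel → ENNReal} (hG : IsMajorant g₀ G) (v : Vel) :
    ∀ᵐ p ∂dirVelMeasure, ∀ ε a t, rateDensity g₀ ε a v t p ≤ G p.2 * ENNReal.ofReal ‖v - p.2‖ := by
  filter_upwards [ae_dirVel_of_ae hG.bound] with p hp ε a t
  rw [rateDensity, mul_comm]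
  gcongr
  · exact hp.2 _
  · exact max_inner_le _ _

/-- Over a time h the relative displacement is below 1/4, and two directions contribute at most 2ε ≤
1/4, so the two lifts are less than 1 apart. Equality on the torus is then equality of vectors, and
`sweep_injective` applies. -/
theorem flyBack_injOn {ε : ℝ} (hε : 0 < ε) (hε' : ε ≤ 1 / 8) (a : Torus) (v : Vel) {b h : ℝ}
    {S : Set Mark} (hS : ∀ m ∈ S, m.1 ∈ Ioo b (b + h) ∧ 0 < inner ℝ (v - m.2.2) (m.2.1 : Vel) ∧
      h * ‖v - m.2.2‖ < 1 / 4) : InjOn (flyBack ε a v) S := by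
  rintro ⟨s, ν, w⟩ hm ⟨s', ν', w'⟩ hm' he
  obtain ⟨⟨h1, h2⟩, h3, h4⟩ := hS _ hm
  obtain ⟨⟨h1', h2'⟩, h3', -⟩ := hS _ hm'
  obtain rfl : w = w' := congrArg Prod.snd he
  have he' := congrArg Prod.fst he
  simp only [flyBack] at he' h1 h2 h1' h2' h3 h4 h3'
  have hn : ‖(s • (v - w) + ε • (ν : Vel)) - (s' • (v - w) + ε • (ν' : Vel))‖ < 1 := by
    have e : (s • (v - w) + ε • (ν : Vel)) - (s' • (v - w) + ε • (ν' : Vel))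
        = (s - s') • (v - w) + (ε • (ν : Vel) - ε • (ν' : Vel)) := by module
    have e1 : ‖(s - s') • (v - w)‖ < 1 / 4 := by
      rw [norm_smul, Real.norm_eq_abs]
      have : |s - s'| ≤ h := by rw [abs_le]; constructor <;> linarith
      exact lt_of_le_of_lt (by gcongr) h4
    have e2 : ‖ε • (ν : Vel) - ε • (ν' : Vel)‖ ≤ ε + ε := by
      refine (norm_sub_le _ _).trans ?_
      rw [norm_smul, norm_smul, Real.norm_of_nonneg hε.le]; simp
    rw [e]
    refine (norm_add_le _ _).trans_lt ?_
    linarith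
  rw [shift_eq_shift_iff_of_norm_lt hn] at he'
  obtain ⟨rfl, rfl⟩ := sweep_injective hε h3 h3' he'
  rfl

/-- Rescaling the shrinking interval to (0, 1) puts all h on one measure space, as dominated
convergence requires. -/
theorem lintegral_Ioo_substitution {b h : ℝ} (hh : 0 < h) (k : ℝ → ENNReal) :
    ∫⁻ s in Ioo b (b + h), k s = ENNReal.ofReal h * ∫⁻ θ in Ioo (0 : ℝ) 1, k (b + h * θ) := by
  have himg : (fun θ : ℝ => b + h * θ) '' Ioo 0 1 = Ioo b (b + h) := by
    have := Set.image_affine_Ioo hh b 0 1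
    simp only [mul_zero, mul_one, zero_add] at this
    rw [add_comm b h, ← this]
    simp only [add_comm b]
  rw [← himg, lintegral_image_eq_lintegral_abs_deriv_mul (f' := fun _ => h) measurableSet_Ioo]
  · rw [abs_of_pos hh, lintegral_const_mul' _ _ ENNReal.ofReal_ne_top]
  · intro θ _
    have := ((hasDerivAt_id θ).const_mul h).const_add b
    simpa using this.hasDerivWithinAt
  · intro x _ y _ hxy
    simpa [hh.ne'] using hxy

/-- Particles that can be hit more than once in a short time are negligible. -/
theorem tendsto_lawOf_fast {g₀ : Phase → ℝ} (hgm : Measurable g₀) {G : Vel → ENNReal}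
    (hG : IsMajorant g₀ G) {ε : ℝ} (hε : 0 < ε) (a : Torus) (v : Vel) (α : ℝ → ℝ) :
    Tendsto (fun h => lawOf g₀ ((avoidSet (fun s => shift a (s • v)) ε (Icc (α h) (α h + h)))ᶜ ∩
        {q | q.2 ∈ {w : Vel | 1 / 4 ≤ h * ‖v - w‖}}) / ENNReal.ofReal (h * ε ^ 2)) (𝓝[>] 0) (𝓝 0) := by
  -- On fast particles 1 ≤ 4h|v - w|, which turns the term 64ε³ of the tube bound, not proportional
  -- to h, into 256ε³h|v - w|. Division by hε² leaves the integrable φ on a set of velocities that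
  -- shrinks to nothing.
  set φ : Vel → ℝ := fun w => 256 * ε * ‖v - w‖ + 64 * (‖v‖ + ‖w‖ + 1) with hφ
  have hφ0 : ∀ w, 0 ≤ φ w := fun w => by positivity
  have hbd : ∫⁻ w, G w * ENNReal.ofReal (φ w) < ⊤ := by
    refine hG.lintegral_lt_top (A := (256 * ε + 64) * (2 * (‖v‖ + 1))) fun w => ?_
    have h1 := norm_sub_le v w
    have h2 := norm_nonneg v
    have h3 := norm_nonneg w
    have h4 : ‖v‖ + ‖w‖ + 1 ≤ (2 * (‖v‖ + 1)) * (1 + ‖w‖ ^ 2) := by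
      nlinarith [sq_nonneg (‖w‖ - 1), mul_nonneg h2 (sq_nonneg ‖w‖)]
    have h5 : ‖v - w‖ ≤ ‖v‖ + ‖w‖ + 1 := by linarith
    calc φ w ≤ 256 * ε * (‖v‖ + ‖w‖ + 1) + 64 * (‖v‖ + ‖w‖ + 1) := by
          simp only [hφ]; gcongr
      _ = (256 * ε + 64) * (‖v‖ + ‖w‖ + 1) := by ring
      _ ≤ (256 * ε + 64) * ((2 * (‖v‖ + 1)) * (1 + ‖w‖ ^ 2)) := by gcongr
      _ = _ := by ring
  have hW : ∀ h : ℝ, MeasurableSet {w : Vel | 1 / 4 ≤ h * ‖v - w‖} := fun h =>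
    measurableSet_le measurable_const (by fun_prop)
  have hlim : Tendsto (fun h : ℝ => ∫⁻ w, {w : Vel | 1 / 4 ≤ h * ‖v - w‖}.indicator
      (fun w => G w * ENNReal.ofReal (φ w)) w) (𝓝[>] 0) (𝓝 (∫⁻ _ : Vel, 0)) := by
    have hmm : Measurable fun w => G w * ENNReal.ofReal (φ w) :=
      hG.measurable.mul (by simp only [hφ]; fun_prop)
    refine tendsto_lintegral_filter_of_dominated_convergence
      (fun w => G w * ENNReal.ofReal (φ w)) ?_ ?_ hbd.ne ?_
    · exact Eventually.of_forall fun h => hmm.indicator (hW h)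
    · exact Eventually.of_forall fun h => Eventually.of_forall fun w =>
        indicator_le_self' (fun _ _ => zero_le) w
    · refine Eventually.of_forall fun w => ?_
      refine tendsto_const_nhds.congr' ?_
      have h1 : Tendsto (fun h : ℝ => h * ‖v - w‖) (𝓝[>] 0) (𝓝 0) := by
        have : Tendsto (fun h : ℝ => h * ‖v - w‖) (𝓝 0) (𝓝 (0 * ‖v - w‖)) :=
          (continuous_id.mul continuous_const).tendsto 0
        rw [zero_mul] at this
        exact this.mono_left nhdsWithin_le_nhds
      filter_upwards [h1.eventually (gt_mem_nhds (show (0 : ℝ) < 1 / 4 by norm_num))] with h hh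
      rw [indicator_of_notMem]
      exact not_le.2 hh
  rw [lintegral_zero] at hlim
  refine tendsto_of_tendsto_of_tendsto_of_le_of_le' tendsto_const_nhds hlim
    (Eventually.of_forall fun _ => zero_le) ?_
  filter_upwards [self_mem_nhdsWithin] with h hh
  have hh0 : 0 < h := hh
  have hc : Continuous fun s : ℝ => shift a (s • v) :=
    continuous_shift_comp continuous_const (by fun_prop)
  have hLip : ∀ s s', torusDist (shift a (s • v)) (shift a (s' • v)) ≤ ‖v‖ * |s - s'| := fun s s' => by
    refine (torusDist_shift_le _ _ _).trans ?_
    rw [← sub_smul, norm_smul, mul_comm, Real.norm_eq_abs]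
  have h1 := lawOf_tube_le hgm hG hc (norm_nonneg v) hLip (a := α h) (b := α h + h) (by linarith) hε
    (hW h)
  rw [← lintegral_indicator (hW h)] at h1
  rw [ENNReal.div_le_iff (by simp; positivity) ENNReal.ofReal_ne_top, mul_comm,
    ← lintegral_const_mul' _ _ ENNReal.ofReal_ne_top]
  refine h1.trans (lintegral_mono fun w => ?_)
  by_cases hw : w ∈ {w : Vel | 1 / 4 ≤ h * ‖v - w‖}
  · rw [indicator_of_mem hw, indicator_of_mem hw,
      mul_left_comm (ENNReal.ofReal (h * ε ^ 2)), ← ENNReal.ofReal_mul (by positivity)]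
    gcongr
    have hw' : 1 / 4 ≤ h * ‖v - w‖ := hw
    have e : α h + h - α h = h := by ring
    rw [e]
    simp only [hφ]
    have h3 : 64 * ε ^ 3 ≤ 256 * ε ^ 3 * (h * ‖v - w‖) := by
      have : 0 < ε ^ 3 := by positivity
      nlinarith
    calc 64 * ε ^ 3 + 64 * ε ^ 2 * (h * (‖v‖ + ‖w‖ + 1))
        ≤ 256 * ε ^ 3 * (h * ‖v - w‖) + 64 * ε ^ 2 * (h * (‖v‖ + ‖w‖ + 1)) := by gcongr
      _ = h * ε ^ 2 * (256 * ε * ‖v - w‖ + 64 * (‖v‖ + ‖w‖ + 1)) := by ring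
  · rw [indicator_of_notMem hw]; exact zero_le

/-- The rate of hits among the initial states in `Y h`, where the sets `Y h` converge to `Y₀` along
the incoming trajectories. -/
theorem tendsto_lawOf_hitSet {g₀ : Phase → ℝ} (hgm : Measurable g₀) {G : Vel → ENNReal}
    (hG : IsMajorant g₀ G) {ε : ℝ} (hε : 0 < ε) (hε' : ε ≤ 1 / 8) (a : Torus) (v : Vel) {t : ℝ}
    (ht : 0 < t) {α : ℝ → ℝ} (hα : ∀ h > 0, t - h ≤ α h ∧ α h ≤ t) {Y : ℝ → Set Phase}
    (hY : ∀ h, MeasurableSet (Y h)) {Y₀ : Set Phase} (hY₀ : MeasurableSet Y₀)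
    (hconv : ∀ᵐ p : Sph × Vel ∂dirVelMeasure, 0 < inner ℝ (v - p.2) (p.1 : Vel) →
      ∀ θ ∈ Ioo (0 : ℝ) 1, ∀ᶠ h in 𝓝[>] 0,
        (flyBack ε a v (α h + h * θ, p.1, p.2) ∈ Y h ↔ flyBack ε a v (t, p.1, p.2) ∈ Y₀)) :
    Tendsto (fun h => lawOf g₀ (hitSet ε a v (Ioo (α h) (α h + h)) ∩ Y h) / ENNReal.ofReal (h * ε ^ 2))
      (𝓝[>] 0) (𝓝 (∫⁻ p in {p : Sph × Vel | flyBack ε a v (t, p.1, p.2) ∈ Y₀},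
        rateDensity g₀ ε a v t p ∂dirVelMeasure)) := by
  have hfb := (continuous_flyBack ε a v).measurable
  set Q : ℝ → ℝ → Set (Sph × Vel) := fun h s => {p | 0 < inner ℝ (v - p.2) (p.1 : Vel) ∧
    h * ‖v - p.2‖ < 1 / 4 ∧ flyBack ε a v (s, p.1, p.2) ∈ Y h} with hQ
  set S : ℝ → Set Mark := fun h => {m | m.1 ∈ Ioo (α h) (α h + h) ∧ m.2 ∈ Q h m.1} with hS
  have hSm : ∀ h, MeasurableSet (S h) := fun h => by
    have h1 : MeasurableSet {m : Mark | m.1 ∈ Ioo (α h) (α h + h)} := measurable_fst measurableSet_Ioo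
    have h2 : MeasurableSet {m : Mark | 0 < inner ℝ (v - m.2.2) (m.2.1 : Vel)} :=
      measurableSet_lt measurable_const (by fun_prop)
    have h3 : MeasurableSet {m : Mark | h * ‖v - m.2.2‖ < 1 / 4} :=
      measurableSet_lt (by fun_prop) measurable_const
    exact h1.inter (h2.inter (h3.inter (hfb (hY h))))
  have hSinj : ∀ h, InjOn (flyBack ε a v) (S h) := fun h =>
    flyBack_injOn hε hε' a v fun m hm => ⟨hm.1, hm.2.1, hm.2.2.1⟩
  set Fn : ℝ → ℝ × (Sph × Vel) → ENNReal := fun h z =>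
    (Q h (α h + h * z.1)).indicator (rateDensity g₀ ε a v (α h + h * z.1)) z.2 with hFn
  have hFnm : ∀ h, Measurable (Fn h) := fun h => by
    have hQm : MeasurableSet {z : ℝ × (Sph × Vel) | z.2 ∈ Q h (α h + h * z.1)} := by
      have h2 : MeasurableSet {z : ℝ × (Sph × Vel) | 0 < inner ℝ (v - z.2.2) (z.2.1 : Vel)} :=
        measurableSet_lt measurable_const (by fun_prop)
      have h3 : MeasurableSet {z : ℝ × (Sph × Vel) | h * ‖v - z.2.2‖ < 1 / 4} :=
        measurableSet_lt (by fun_prop) measurable_const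
      exact h2.inter (h3.inter ((hfb.comp (by fun_prop : Measurable
        fun z : ℝ × (Sph × Vel) => ((α h + h * z.1, z.2.1, z.2.2) : Mark))) (hY h)))
    have hR : Measurable fun z : ℝ × (Sph × Vel) => rateDensity g₀ ε a v (α h + h * z.1) z.2 := by
      unfold rateDensity
      refine Measurable.mul (by fun_prop) (Measurable.ennreal_ofReal ?_)
      exact hgm.comp (hfb.comp (by fun_prop))
    exact hR.indicator hQm
  -- For slow incoming particles `flyBack` is injective and the flux formula is exact; the factor
  -- hε² splits off after rescaling time. The condition h < t keeps the hit times positive.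
  have hmain : ∀ h, 0 < h → h < t → lawOf g₀ (flyBack ε a v '' S h) = ENNReal.ofReal (h * ε ^ 2) *
      ∫⁻ z, Fn h z ∂(((volume : Measure ℝ).restrict (Ioo 0 1)).prod dirVelMeasure) := by
    intro h hh hht
    have hpos : ∀ m ∈ S h, 0 < m.1 ∧ 0 < inner ℝ (v - m.2.2) (m.2.1 : Vel) := fun m hm =>
      ⟨by linarith [(hα h hh).1, hm.1.1], hm.2.1⟩
    have hfd : Measurable fun m : Mark => fluxDensity ε v m * ENNReal.ofReal (g₀ (flyBack ε a v m)) :=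
      (measurable_fluxDensity ε v).mul (hgm.comp hfb).ennreal_ofReal
    rw [lawOf_apply, ← lintegral_flux a v hε (hSm h) hpos (hSinj h) _ hgm.ennreal_ofReal,
      ← lintegral_indicator (hSm h), markMeasure_eq,
      lintegral_prod _ (hfd.indicator (hSm h)).aemeasurable,
      lintegral_prod _ (hFnm h).aemeasurable]
    have h1 : ∀ s, ∫⁻ p, (S h).indicator (fun m => fluxDensity ε v m *
        ENNReal.ofReal (g₀ (flyBack ε a v m))) (s, p) ∂dirVelMeasure
        = (Ioo (α h) (α h + h)).indicator (fun s => ENNReal.ofReal (ε ^ 2) *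
          ∫⁻ p, (Q h s).indicator (rateDensity g₀ ε a v s) p ∂dirVelMeasure) s := by
      intro s
      by_cases hs : s ∈ Ioo (α h) (α h + h)
      · rw [indicator_of_mem hs, ← lintegral_const_mul' _ _ ENNReal.ofReal_ne_top]
        refine lintegral_congr fun p => ?_
        by_cases hp : p ∈ Q h s
        · rw [indicator_of_mem (show (s, p) ∈ S h from ⟨hs, hp⟩), indicator_of_mem hp, fluxDensity,
            rateDensity, ← mul_assoc, ENNReal.ofReal_mul (by positivity)]
        · rw [indicator_of_notMem (show (s, p) ∉ S h from fun h' => hp h'.2),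
            indicator_of_notMem hp, mul_zero]
      · rw [indicator_of_notMem hs]
        refine lintegral_eq_zero_of_ae_eq_zero (Eventually.of_forall fun p => ?_)
        exact indicator_of_notMem (show (s, p) ∉ S h from fun h' => hs h'.1) _
    rw [lintegral_congr h1, lintegral_indicator measurableSet_Ioo, lintegral_Ioo_substitution hh,
      lintegral_const_mul' _ _ ENNReal.ofReal_ne_top, ← mul_assoc, ← ENNReal.ofReal_mul hh.le]
  have hαt : Tendsto α (𝓝[>] 0) (𝓝 t) := by
    have h1 : Tendsto (fun h : ℝ => t - h) (𝓝[>] 0) (𝓝 t) := by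
      have : Tendsto (fun h : ℝ => t - h) (𝓝 0) (𝓝 (t - 0)) :=
        (continuous_const.sub continuous_id).tendsto 0
      rw [sub_zero] at this
      exact this.mono_left nhdsWithin_le_nhds
    refine tendsto_of_tendsto_of_tendsto_of_le_of_le' h1 tendsto_const_nhds ?_ ?_
    · filter_upwards [self_mem_nhdsWithin] with h hh using (hα h hh).1
    · filter_upwards [self_mem_nhdsWithin] with h hh using (hα h hh).2
  have hid : Tendsto (fun h : ℝ => h) (𝓝[>] 0) (𝓝 0) := nhdsWithin_le_nhds
  set Q₀ : Set (Sph × Vel) := {p : Sph × Vel | flyBack ε a v (t, p.1, p.2) ∈ Y₀} with hQ₀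
  have hQ₀m : MeasurableSet Q₀ := (hfb.comp (by fun_prop : Measurable
    fun p : Sph × Vel => ((t, p.1, p.2) : Mark))) hY₀
  have hlimF : Tendsto (fun h => ∫⁻ z, Fn h z ∂(((volume : Measure ℝ).restrict (Ioo 0 1)).prod
      dirVelMeasure)) (𝓝[>] 0) (𝓝 (∫⁻ z : ℝ × (Sph × Vel), Q₀.indicator (rateDensity g₀ ε a v t) z.2
        ∂(((volume : Measure ℝ).restrict (Ioo 0 1)).prod dirVelMeasure))) := by
    refine tendsto_lintegral_filter_of_dominated_convergence
      (fun z => G z.2.2 * ENNReal.ofReal ‖v - z.2.2‖) (Eventually.of_forall hFnm) ?_ ?_ ?_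
    · refine Eventually.of_forall fun h => ?_
      filter_upwards [Measure.quasiMeasurePreserving_snd.ae (rateDensity_le hG v)] with z hz
      exact (indicator_le_self' (fun _ _ => zero_le) _).trans (hz _ _ _)
    · have hm : Measurable fun z : ℝ × (Sph × Vel) => G z.2.2 * ENNReal.ofReal ‖v - z.2.2‖ :=
        (hG.measurable.comp (by fun_prop)).mul (by fun_prop)
      rw [lintegral_prod _ hm.aemeasurable]
      simp only [lintegral_const]
      exact (ENNReal.mul_lt_top (lintegral_rate_bound hG v) (measure_lt_top _ _)).ne
    · have hθ : ∀ᵐ z ∂(((volume : Measure ℝ).restrict (Ioo 0 1)).prod dirVelMeasure),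
          z.1 ∈ Ioo (0 : ℝ) 1 :=
        Measure.quasiMeasurePreserving_fst.ae (ae_restrict_mem measurableSet_Ioo)
      filter_upwards [hθ, Measure.quasiMeasurePreserving_snd.ae hconv,
        Measure.quasiMeasurePreserving_snd.ae (ae_dirVel_of_ae hG.bound)] with z hz hzc hzg
      by_cases hin : 0 < inner ℝ (v - z.2.2) (z.2.1 : Vel)
      · have hs : Tendsto (fun h => α h + h * z.1) (𝓝[>] 0) (𝓝 t) := by
          have := hαt.add (hid.mul_const z.1)
          rwa [zero_mul, add_zero] at this
        have hR : Tendsto (fun h => rateDensity g₀ ε a v (α h + h * z.1) z.2) (𝓝[>] 0)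
            (𝓝 (rateDensity g₀ ε a v t z.2)) := by
          unfold rateDensity
          refine ENNReal.Tendsto.const_mul ?_ (Or.inr ENNReal.ofReal_ne_top)
          have hcont : Continuous fun s : ℝ =>
              ENNReal.ofReal (g₀ (flyBack ε a v (s, z.2.1, z.2.2))) := by
            refine ENNReal.continuous_ofReal.comp (hzg.1.comp
              (g := fun x : Torus => g₀ (x, z.2.2)) ?_)
            exact continuous_shift_comp continuous_const (by fun_prop)
          exact (hcont.tendsto t).comp hs
        have hsmall : ∀ᶠ h in 𝓝[>] (0 : ℝ), h * ‖v - z.2.2‖ < 1 / 4 := by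
          have := hid.mul_const ‖v - z.2.2‖
          rw [zero_mul] at this
          exact this.eventually (gt_mem_nhds (by norm_num))
        by_cases h0 : z.2 ∈ Q₀
        · rw [indicator_of_mem h0]
          refine hR.congr' ?_
          filter_upwards [hsmall, hzc hin z.1 hz] with h h1 h2
          simp only [hFn]
          rw [indicator_of_mem]
          exact ⟨hin, h1, h2.2 h0⟩
        · rw [indicator_of_notMem h0]
          refine tendsto_const_nhds.congr' ?_
          filter_upwards [hzc hin z.1 hz] with h h2
          simp only [hFn]
          rw [indicator_of_notMem]
          exact fun h' => h0 (h2.1 h'.2.2)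
      · have h0 : ∀ s, rateDensity g₀ ε a v s z.2 = 0 := fun s => by
          rw [rateDensity, max_eq_right (not_lt.1 hin), ENNReal.ofReal_zero, zero_mul]
        have h1 : ∀ (A : Set (Sph × Vel)) s, A.indicator (rateDensity g₀ ε a v s) z.2 = 0 :=
          fun A s => by
            by_cases hA : z.2 ∈ A
            · rw [indicator_of_mem hA, h0]
            · rw [indicator_of_notMem hA]
        simp only [hFn, h1]
        exact tendsto_const_nhds
  have hlim_eq : ∫⁻ z : ℝ × (Sph × Vel), Q₀.indicator (rateDensity g₀ ε a v t) z.2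
      ∂(((volume : Measure ℝ).restrict (Ioo 0 1)).prod dirVelMeasure)
      = ∫⁻ p in Q₀, rateDensity g₀ ε a v t p ∂dirVelMeasure := by
    have hm := (measurable_rateDensity hgm ε a v t).indicator hQ₀m
    have hm' : Measurable fun z : ℝ × (Sph × Vel) => Q₀.indicator (rateDensity g₀ ε a v t) z.2 :=
      hm.comp measurable_snd
    rw [lintegral_prod _ hm'.aemeasurable]
    simp only [lintegral_const, lintegral_indicator hQ₀m]
    simp
  rw [hlim_eq] at hlimF
  have hfast := tendsto_lawOf_fast hgm hG hε a v α
  have hup := hlimF.add hfast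
  rw [add_zero] at hup
  have hht : ∀ᶠ h in 𝓝[>] (0 : ℝ), h < t := hid.eventually (gt_mem_nhds ht)
  -- Slow hits bound the quotient from below; from above every hit is slow, or belongs to a fast
  -- particle which lies in the tube of the interval.
  refine tendsto_of_tendsto_of_tendsto_of_le_of_le' hlimF hup ?_ ?_
  · filter_upwards [self_mem_nhdsWithin, hht] with h hh hh2
    have hh0 : 0 < h := hh
    rw [ENNReal.le_div_iff_mul_le (by left; simp; positivity) (by left; exact ENNReal.ofReal_ne_top),
      mul_comm, ← hmain h hh0 hh2]
    refine measure_mono ?_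
    rintro _ ⟨m, hm, rfl⟩
    exact ⟨⟨m, ⟨hm.1, hm.2.1⟩, rfl⟩, hm.2.2.2⟩
  · filter_upwards [self_mem_nhdsWithin, hht] with h hh hh2
    have hh0 : 0 < h := hh
    rw [ENNReal.div_le_iff (by simp; positivity) ENNReal.ofReal_ne_top, add_mul,
      ENNReal.div_mul_cancel (by simp; positivity) ENNReal.ofReal_ne_top,
      mul_comm (∫⁻ z, Fn h z ∂_), ← hmain h hh0 hh2]
    refine (measure_mono ?_).trans (measure_union_le _ _)
    rintro _ ⟨⟨m, ⟨hm1, hm2⟩, rfl⟩, hmY⟩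
    by_cases hf : h * ‖v - m.2.2‖ < 1 / 4
    · exact Or.inl ⟨m, ⟨hm1, hm2, hf, hmY⟩, rfl⟩
    · refine Or.inr ⟨fun hav => ?_, not_lt.1 hf⟩
      have h1 := hav m.1 ⟨hm1.1.le, hm1.2.le⟩
      have h2 : shift (flyBack ε a v m).1 (m.1 • (flyBack ε a v m).2)
          = shift (shift a (m.1 • v)) (ε • (m.2.1 : Vel)) := by
        simp only [flyBack, shift_shift]
        congr 1; module
      rw [h2] at h1
      have h3 := torusDist_shift_self_le (shift a (m.1 • v)) (ε • (m.2.1 : Vel))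
      rw [norm_smul, Real.norm_of_nonneg hε.le] at h3
      simp at h3
      linarith

/-! ### The distance of a particle from the path before and after a hit -/

theorem shift_flyBack (ε : ℝ) (a : Torus) (v : Vel) (s r : ℝ) (ν : Sph) (w : Vel) :
    shift (flyBack ε a v (s, ν, w)).1 (r • w) = shift a (s • (v - w) + ε • (ν : Vel) + r • w) := by
  rw [flyBack, shift_shift]

theorem norm_sq_relative (ε : ℝ) (u : Vel) (ν : Sph) (δ : ℝ) :
    ‖δ • u + ε • (ν : Vel)‖ ^ 2 = ε ^ 2 + 2 * ε * δ * inner ℝ u (ν : Vel) + δ ^ 2 * ‖u‖ ^ 2 := by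
  rw [norm_add_sq_real, norm_smul, norm_smul, inner_smul_left, inner_smul_right, mul_pow, mul_pow]
  simp
  ring

theorem torusDist_flyBack {ε : ℝ} (hε : 0 < ε) (hε' : ε ≤ 1 / 8) (a : Torus) (v : Vel) {s r : ℝ}
    (ν : Sph) (w : Vel) (h : |s - r| * ‖v - w‖ ≤ 1 / 4) :
    torusDist (shift a (r • v)) (shift (flyBack ε a v (s, ν, w)).1 (r • w))
      = ‖(s - r) • (v - w) + ε • (ν : Vel)‖ := by
  have e : s • (v - w) + ε • (ν : Vel) + r • w = r • v + ((s - r) • (v - w) + ε • (ν : Vel)) := by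
    module
  rw [shift_flyBack, e, ← shift_shift]
  refine torusDist_shift_self _ _ ?_
  refine (norm_add_le _ _).trans ?_
  rw [norm_smul, norm_smul, Real.norm_eq_abs, Real.norm_of_nonneg hε.le]
  simp
  linarith

/-- Backwards in time from an incoming contact both corrections in ε² + 2εδ u·ν + δ²|u|² are
nonnegative and the first is positive, so the particle was strictly outside as long as the torus
does not interfere. -/
theorem lt_torusDist_flyBack {ε : ℝ} (hε : 0 < ε) (hε' : ε ≤ 1 / 8) (a : Torus) (v : Vel) {s r : ℝ}
    (ν : Sph) (w : Vel) (hin : 0 < inner ℝ (v - w) (ν : Vel)) (hr : r < s)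
    (h : (s - r) * ‖v - w‖ ≤ 1 / 4) :
    ε < torusDist (shift a (r • v)) (shift (flyBack ε a v (s, ν, w)).1 (r • w)) := by
  have hsr : 0 < s - r := sub_pos.2 hr
  rw [torusDist_flyBack hε hε' a v ν w (by rwa [abs_of_pos hsr])]
  refine lt_of_pow_lt_pow_left₀ 2 (norm_nonneg _) ?_
  rw [norm_sq_relative]
  have : 0 < 2 * ε * (s - r) * inner ℝ (v - w) (ν : Vel) := by positivity
  have : 0 ≤ (s - r) ^ 2 * ‖v - w‖ ^ 2 := by positivity
  linarith

theorem continuous_torusDist_flyBack {p : ℝ → Torus} (hp : Continuous p) (ε : ℝ) (a : Torus)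
    (v : Vel) (ν : Sph) (w : Vel) :
    Continuous fun z : ℝ × ℝ => torusDist (p z.2) (shift (flyBack ε a v (z.1, ν, w)).1 (z.2 • w)) := by
  simp only [shift_flyBack]
  exact continuous_torusDist_comp (hp.comp continuous_snd)
    (continuous_shift_comp continuous_const (by fun_prop))

/-! ### Null sets of grazing particles -/

/-- For a fixed direction, the velocities with which a particle touches the path without coming closer
than `ε` before time `t`. -/
theorem volume_touching_slice_eq_zero (p : ℝ → Torus) {ε : ℝ} (hε : 0 < ε) (a : Torus) (v : Vel)
    (t : ℝ) (ν : Sph) :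
    volume {w : Vel | (∀ r ∈ Ico 0 t,
        ε ≤ torusDist (p r) (shift (flyBack ε a v (t, ν, w)).1 (r • w))) ∧
      ¬ ∀ r ∈ Ico 0 t, ε < torusDist (p r) (shift (flyBack ε a v (t, ν, w)).1 (r • w))} = 0 := by
  apply volume_eq_zero_of_porous
  rintro w ⟨h1, h2⟩
  push Not at h2
  obtain ⟨r, hr, hdr⟩ := h2
  have htr : 0 < t - r := sub_pos.2 hr.2
  obtain ⟨u, hu, hun⟩ := exists_shift_eq (shift (flyBack ε a v (t, ν, w)).1 (r • w)) (p r)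
  have hue : ‖u‖ ≤ ε := by
    rw [hun, torusDist_comm]; exact hdr
  -- The position at time t is fixed, so changing w moves the position at time r by -(t - r) times
  -- the change. The ball of radius ε around `p r` becomes a ball of radius ε/(t - r) of velocities,
  -- all of which come too close.
  refine ⟨w - (t - r)⁻¹ • u, ε / (t - r), by positivity, ?_, ?_⟩
  · rw [dist_eq_norm, sub_sub_cancel, norm_smul, norm_inv, Real.norm_of_nonneg htr.le,
      div_eq_inv_mul]
    gcongr
  · rintro z hz ⟨h3, -⟩
    have h4 := h3 r hr
    rw [hu, shift_flyBack, shift_flyBack, shift_shift] at h4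
    have h5 := torusDist_shift_le a (t • (v - w) + ε • (ν : Vel) + r • w + u)
      (t • (v - z) + ε • (ν : Vel) + r • z)
    have e : t • (v - w) + ε • (ν : Vel) + r • w + u - (t • (v - z) + ε • (ν : Vel) + r • z)
        = (t - r) • (z - (w - (t - r)⁻¹ • u)) := by
      rw [← sub_add, smul_add, smul_smul, mul_inv_cancel₀ htr.ne', one_smul]; module
    rw [e, norm_smul, Real.norm_of_nonneg htr.le] at h5
    rw [Metric.mem_ball, dist_eq_norm, lt_div_iff₀ htr] at hz
    linarith

/-- Particles which touch the path, but never come closer than `ε`, before they are at a given place. -/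
theorem dirVelMeasure_touching_eq_zero {p : ℝ → Torus} (hp : Continuous p) {ε : ℝ} (hε : 0 < ε)
    (a : Torus) (v : Vel) (t : ℝ) :
    ∀ᵐ z : Sph × Vel ∂dirVelMeasure,
      (∀ r ∈ Ico 0 t, ε < torusDist (p r) (shift (flyBack ε a v (t, z.1, z.2)).1 (r • z.2))) ∨
      ∃ r ∈ Ico 0 t, torusDist (p r) (shift (flyBack ε a v (t, z.1, z.2)).1 (r • z.2)) < ε := by
  set d : Sph × Vel → ℝ → ℝ := fun z r =>
    torusDist (p r) (shift (flyBack ε a v (t, z.1, z.2)).1 (r • z.2)) with hd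
  have hdm : ∀ r, Measurable fun z => d z r := fun r => by
    have hfb : Measurable fun z : Sph × Vel => flyBack ε a v (t, z.1, z.2) :=
      (continuous_flyBack ε a v).measurable.comp
        (by fun_prop : Measurable fun z : Sph × Vel => ((t, z.1, z.2) : Mark))
    exact measurable_torusDist_comp measurable_const (measurable_shift_comp hfb.fst (by fun_prop))
  have hdc : ∀ z, Continuous (d z) := fun z => by
    simp only [hd, shift_flyBack]
    exact continuous_torusDist_comp hp (continuous_shift_comp continuous_const (by fun_prop))
  have hico : IsLocallyClosed (Ico (0 : ℝ) t) := by
    rw [← Ici_inter_Iio]; exact isClosed_Ici.isLocallyClosed.inter isOpen_Iio.isLocallyClosed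
  set E : Set (Sph × Vel) := {z | ∀ r ∈ Ico 0 t, ε ≤ d z r} \ {z | ∀ r ∈ Ico 0 t, ε < d z r} with hE
  have hEm : MeasurableSet E :=
    (measurableSet_forall_le hdm hdc _ _).diff (measurableSet_forall_lt hdm hdc hico _)
  have hE0 : dirVelMeasure E = 0 := by
    rw [dirVelMeasure, Measure.measure_prod_null hEm]
    refine Eventually.of_forall fun ν => ?_
    refine measure_mono_null ?_ (volume_touching_slice_eq_zero p hε a v t ν)
    rintro w ⟨h1, h2⟩
    exact ⟨h1, h2⟩
  filter_upwards [measure_eq_zero_iff_ae_notMem.1 hE0] with z hz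
  by_contra hcon
  push Not at hcon
  obtain ⟨⟨r, hr, hle⟩, hge⟩ := hcon
  exact hz ⟨hge, fun h => absurd (h r hr) (not_lt.2 hle)⟩

/-- For each fixed velocity w, particles which touch without entering have positions at distance
exactly ε from the family `p s` - sw and never closer; `volume_sphere_union_eq_zero` makes this
null. -/
theorem lawOf_touching_eq_zero (g : Phase → ℝ) {p : ℝ → Torus} (hp : Continuous p) {ε : ℝ}
    (hε : 0 < ε) (b c : ℝ) :
    lawOf g {q | (∀ s ∈ Icc b c, ε ≤ torusDist (p s) (shift q.1 (s • q.2))) ∧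
      ∃ s ∈ Icc b c, torusDist (p s) (shift q.1 (s • q.2)) ≤ ε} = 0 := by
  refine withDensity_absolutelyContinuous _ _ ?_
  set d : Phase → ℝ → ℝ := fun q s => torusDist (p s) (shift q.1 (s • q.2)) with hd
  have hdm : ∀ s, Measurable fun q => d q s := fun s =>
    measurable_torusDist_comp measurable_const (measurable_shift_comp measurable_fst (by fun_prop))
  have hdc : ∀ q, Continuous (d q) := fun q =>
    continuous_torusDist_comp hp (continuous_shift_comp continuous_const (by fun_prop))
  have hEm : MeasurableSet ({q | ∀ s ∈ Icc b c, ε ≤ d q s} \ {q | ∀ s ∈ Icc b c, ε < d q s}) :=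
    (measurableSet_forall_le hdm hdc _ _).diff
      (measurableSet_forall_lt hdm hdc isClosed_Icc.isLocallyClosed _)
  have hsub : {q | (∀ s ∈ Icc b c, ε ≤ d q s) ∧ ∃ s ∈ Icc b c, d q s ≤ ε}
      ⊆ {q | ∀ s ∈ Icc b c, ε ≤ d q s} \ {q | ∀ s ∈ Icc b c, ε < d q s} := by
    rintro q ⟨h1, s, hs, h2⟩
    exact ⟨h1, fun h => absurd (h s hs) (not_lt.2 h2)⟩
  refine measure_mono_null hsub ?_
  rw [Measure.volume_eq_prod, Measure.prod_apply_symm hEm]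
  refine lintegral_eq_zero_of_ae_eq_zero (Eventually.of_forall fun w => ?_)
  refine measure_mono_null ?_
    (volume_sphere_union_eq_zero (Icc b c) (fun s => shift (p s) (-(s • w))) hε)
  rintro x ⟨h1, h2⟩
  simp only [mem_ofPred_eq] at h1 h2 ⊢
  push Not at h2
  simp only [torusDist_shift_left, neg_neg]
  obtain ⟨s, hs, hds⟩ := h2
  exact ⟨⟨s, hs, le_antisymm hds (h1 s hs)⟩, h1⟩

theorem lawOf_torusDist_eq_zero (g : Phase → ℝ) {p : ℝ → Torus} (hp : Continuous p) {ε : ℝ}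
    (hε : 0 < ε) (b : ℝ) : lawOf g {q | torusDist (p b) (shift q.1 (b • q.2)) = ε} = 0 := by
  refine measure_mono_null ?_ (lawOf_touching_eq_zero g hp hε b b)
  intro q hq
  have hq' : torusDist (p b) (shift q.1 (b • q.2)) = ε := hq
  simp only [Icc_self, mem_singleton_iff, forall_eq, exists_eq_left, mem_ofPred_eq, hq', le_refl,
    and_self]

theorem exists_mem_Ioo_of_mem_Icc {b c s : ℝ} (hbc : b < c) (hs : s ∈ Icc b c) {U : Set ℝ}
    (hU : IsOpen U) (hsU : s ∈ U) : ∃ r ∈ Ioo b c, r ∈ U := by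
  have h1 : s ∈ closure (Ioo b c) := by rw [closure_Ioo hbc.ne]; exact hs
  obtain ⟨r, hr1, hr2⟩ := mem_closure_iff.1 h1 U hU hsU
  exact ⟨r, hr2, hr1⟩

/-- Avoiding a path during an open and during a closed interval of time is almost surely the same. -/
theorem lawOf_avoidSet_Ioo (g : Phase → ℝ) {p : ℝ → Torus} (hp : Continuous p) {ε : ℝ} (hε : 0 < ε)
    {b : ℝ} (hb : 0 < b) :
    ∀ᵐ q ∂lawOf g, q ∈ avoidSet p ε (Ioo 0 b) ↔ q ∈ avoidSet p ε (Icc 0 b) := by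
  filter_upwards [measure_eq_zero_iff_ae_notMem.1 (lawOf_torusDist_eq_zero g hp hε 0),
    measure_eq_zero_iff_ae_notMem.1 (lawOf_torusDist_eq_zero g hp hε b)] with q h0 hb'
  refine ⟨fun h s hs => ?_, fun h => avoidSet_anti Ioo_subset_Icc_self h⟩
  have hc : Continuous fun s : ℝ => torusDist (p s) (shift q.1 (s • q.2)) :=
    continuous_torusDist_comp hp (continuous_shift_comp continuous_const (by fun_prop))
  have hle : ε ≤ torusDist (p s) (shift q.1 (s • q.2)) := by
    by_contra hlt
    obtain ⟨r, hr, hrU⟩ := exists_mem_Ioo_of_mem_Icc hb hs (isOpen_lt hc continuous_const)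
      (not_le.1 hlt)
    exact lt_asymm (h r hr) hrU
  refine lt_of_le_of_ne hle fun he => ?_
  rcases hs.1.eq_or_lt with rfl | h1
  · exact h0 he.symm
  · rcases hs.2.eq_or_lt with rfl | h2
    · exact hb' he.symm
    · exact (h s ⟨h1, h2⟩).ne he

/-! ### Convergence of the condition that a particle has not been hit before -/

/-- Almost every particle placed in contact at time t has either stayed strictly outside or come
strictly inside before, by `dirVelMeasure_touching_eq_zero`. Both alternatives are stable under a
small change of the contact time: the second because it is open, the first by compactness away from
t and by `lt_torusDist_flyBack` close to t. -/
theorem ae_eventually_mem_avoidSet_iff {p : ℝ → Torus} (hp : Continuous p) {a : Torus} {v : Vel}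
    {τ t : ℝ} (hτ : 0 ≤ τ) (hτt : τ < t) (hpa : ∀ s, τ ≤ s → p s = shift a (s • v)) {ε : ℝ}
    (hε : 0 < ε) (hε' : ε ≤ 1 / 8) {α : ℝ → ℝ} (hα : ∀ h > 0, t - h ≤ α h ∧ α h ≤ t) :
    ∀ᵐ z : Sph × Vel ∂dirVelMeasure, 0 < inner ℝ (v - z.2) (z.1 : Vel) →
      ∀ θ ∈ Ioo (0 : ℝ) 1, ∀ᶠ h in 𝓝[>] 0,
        (flyBack ε a v (α h + h * θ, z.1, z.2) ∈ avoidSet p ε (Ioo 0 (α h)) ↔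
          flyBack ε a v (t, z.1, z.2) ∈ avoidSet p ε (Ioo 0 t)) := by
  filter_upwards [dirVelMeasure_touching_eq_zero hp hε a v t] with z hz hin θ hθ
  obtain ⟨ν, w⟩ := z
  simp only at hz hin ⊢
  set d : ℝ × ℝ → ℝ := fun y => torusDist (p y.2) (shift (flyBack ε a v (y.1, ν, w)).1 (y.2 • w)) with hd
  have hdc : Continuous d := continuous_torusDist_flyBack hp ε a v ν w
  have hid : Tendsto (fun h : ℝ => h) (𝓝[>] 0) (𝓝 0) := nhdsWithin_le_nhds
  have hαt : Tendsto α (𝓝[>] 0) (𝓝 t) := by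
    have h1 : Tendsto (fun h : ℝ => t - h) (𝓝[>] 0) (𝓝 t) := by
      have := (tendsto_const_nhds (x := t)).sub hid
      rwa [sub_zero] at this
    refine tendsto_of_tendsto_of_tendsto_of_le_of_le' h1 tendsto_const_nhds ?_ ?_
    · filter_upwards [self_mem_nhdsWithin] with h hh using (hα h hh).1
    · filter_upwards [self_mem_nhdsWithin] with h hh using (hα h hh).2
  have hs : Tendsto (fun h => α h + h * θ) (𝓝[>] 0) (𝓝 t) := by
    have := hαt.add (hid.mul_const θ)
    rwa [zero_mul, add_zero] at this
  rcases hz with hz | ⟨r, hr, hdr⟩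
  · have hmem : flyBack ε a v (t, ν, w) ∈ avoidSet p ε (Ioo 0 t) := fun r hr => hz r ⟨hr.1.le, hr.2⟩
    simp only [hmem, iff_true]
    -- δ < t - τ keeps the last stretch on the affine part of the path. The factor 2 is needed
    -- because the contact time may be as late as t + δ, so that it follows times r > t - δ by less
    -- than 2δ.
    obtain ⟨δ, hδ0, hδ1, hδ2⟩ : ∃ δ > 0, δ < t - τ ∧ 2 * δ * ‖v - w‖ ≤ 1 / 4 := by
      refine ⟨min ((t - τ) / 2) (1 / (8 * (‖v - w‖ + 1))), ?_, ?_, ?_⟩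
      · have := sub_pos.2 hτt; positivity
      · have := sub_pos.2 hτt
        exact (min_le_left _ _).trans_lt (by linarith)
      · have hn := norm_nonneg (v - w)
        calc 2 * min ((t - τ) / 2) (1 / (8 * (‖v - w‖ + 1))) * ‖v - w‖
            ≤ 2 * (1 / (8 * (‖v - w‖ + 1))) * (‖v - w‖ + 1) := by
              gcongr
              · exact min_le_right _ _
              · linarith
          _ = 1 / 4 := by field_simp; norm_num
    have hK : ∀ᶠ s in 𝓝 t, ∀ r ∈ Icc 0 (t - δ), ε < d (s, r) := by
      refine isCompact_Icc.eventually_forall_of_forall_eventually fun r hr => ?_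
      have h1 : ε < d (t, r) := hz r ⟨hr.1, by linarith [hr.2]⟩
      exact (hdc.tendsto (t, r)).eventually (lt_mem_nhds h1)
    filter_upwards [hs.eventually hK, hs.eventually (gt_mem_nhds (show t < t + δ by linarith)),
      self_mem_nhdsWithin] with h h1 h2 hh r hr
    have hh0 : 0 < h := hh
    by_cases hrt : r ≤ t - δ
    · exact h1 r ⟨hr.1.le, hrt⟩
    · push Not at hrt
      have hrs : r < α h + h * θ := by nlinarith [hr.2, hθ.1]
      rw [hpa r (by linarith)]
      refine lt_torusDist_flyBack hε hε' a v ν w hin hrs (le_trans ?_ hδ2)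
      gcongr
      linarith
  · have hc : Continuous fun r => d (t, r) := hdc.comp (by fun_prop)
    have h0t : 0 < t := hτ.trans_lt hτt
    obtain ⟨r', hr', hdr'⟩ := exists_mem_Ioo_of_mem_Icc h0t ⟨hr.1, hr.2.le⟩
      (isOpen_lt hc continuous_const) hdr
    have hnm : flyBack ε a v (t, ν, w) ∉ avoidSet p ε (Ioo 0 t) := fun h =>
      lt_asymm (h r' hr') hdr'
    simp only [hnm, iff_false]
    have hc2 : Continuous fun s => d (s, r') := hdc.comp (by fun_prop)
    filter_upwards [hs.eventually ((hc2.tendsto t).eventually (gt_mem_nhds hdr')),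
      hαt.eventually (lt_mem_nhds hr'.2)] with h h1 h2 hmem
    exact lt_asymm (hmem r' ⟨hr'.1, h2⟩) h1

/-! ### The loss of free mass is due to hits -/

theorem exists_direction {x y : Torus} {ε : ℝ} (hε : 0 < ε) (h : torusDist x y = ε) :
    ∃ ν : Sph, y = shift x (ε • (ν : Vel)) := by
  obtain ⟨u, hu, hun⟩ := exists_shift_eq x y
  refine ⟨⟨ε⁻¹ • u, ?_⟩, ?_⟩
  · rw [mem_sphere_zero_iff_norm, norm_smul, hun, h, norm_inv, Real.norm_of_nonneg hε.le,
      inv_mul_cancel₀ hε.ne']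
  · subst hu; simp [smul_smul, hε.ne']

/-- A particle that avoids the path up to b but not up to b + h has a first contact in between, at
distance exactly ε. Comparison with the moments just before shows (v - w)·ν ≥ 0, and equality means
grazing, a null event. Conversely, a hit is a contact. -/
theorem lawOf_avoidSet_eq_add (g : Phase → ℝ) {p : ℝ → Torus} (hp : Continuous p) {a : Torus}
    {v : Vel} {τ b h : ℝ} (hτb : τ ≤ b) (hb : 0 < b) (hh : 0 < h)
    (hpa : ∀ s, τ ≤ s → p s = shift a (s • v)) {ε : ℝ} (hε : 0 < ε) (hε' : ε ≤ 1 / 8) :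
    lawOf g (avoidSet p ε (Icc 0 b)) = lawOf g (avoidSet p ε (Icc 0 (b + h)))
      + lawOf g (hitSet ε a v (Ioo b (b + h)) ∩ avoidSet p ε (Ioo 0 b)) := by
  have hm : MeasurableSet (avoidSet p ε (Icc 0 (b + h))) :=
    measurableSet_avoidSet hp ε isClosed_Icc.isLocallyClosed
  have hsub : avoidSet p ε (Icc 0 (b + h)) ⊆ avoidSet p ε (Icc 0 b) :=
    avoidSet_anti (Icc_subset_Icc_right (by linarith))
  rw [← measure_inter_add_sdiff (avoidSet p ε (Icc 0 b)) hm, inter_eq_self_of_subset_right hsub]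
  congr 1
  refine measure_congr ?_
  -- Grazing is local in time, so it is excluded on all intervals with rational end points, of which
  -- there are countably many.
  have hN : ∀ᵐ q ∂lawOf g, ∀ x y : ℚ, ¬ ((∀ s ∈ Icc (x : ℝ) y,
      ε ≤ torusDist (p s) (shift q.1 (s • q.2))) ∧
      ∃ s ∈ Icc (x : ℝ) y, torusDist (p s) (shift q.1 (s • q.2)) ≤ ε) := by
    rw [ae_all_iff]; intro x
    rw [ae_all_iff]; intro y
    exact measure_eq_zero_iff_ae_notMem.1 (lawOf_touching_eq_zero g hp hε x y)
  filter_upwards [lawOf_avoidSet_Ioo g hp hε hb, hN,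
    measure_eq_zero_iff_ae_notMem.1 (lawOf_torusDist_eq_zero g hp hε (b + h))] with q h1 h2 h3
  refine propext ?_
  change (q ∈ avoidSet p ε (Icc 0 b) ∧ q ∉ avoidSet p ε (Icc 0 (b + h))) ↔
    (q ∈ hitSet ε a v (Ioo b (b + h)) ∧ q ∈ avoidSet p ε (Ioo 0 b))
  rw [h1, and_comm (a := q ∈ hitSet ε a v (Ioo b (b + h)))]
  refine and_congr_right fun hq => ?_
  set d : ℝ → ℝ := fun s => torusDist (p s) (shift q.1 (s • q.2)) with hd
  have hc : Continuous d :=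
    continuous_torusDist_comp hp (continuous_shift_comp continuous_const (by fun_prop))
  constructor
  · intro hq2
    have hne : ({s | d s ≤ ε} ∩ Icc 0 (b + h)).Nonempty := by
      simp only [avoidSet, mem_ofPred_eq] at hq2
      push Not at hq2
      obtain ⟨s, hs, hds⟩ := hq2
      exact ⟨s, hds, hs⟩
    have hcomp : IsCompact ({s | d s ≤ ε} ∩ Icc 0 (b + h)) :=
      isCompact_Icc.inter_left (isClosed_le hc continuous_const)
    obtain ⟨s, ⟨hs1, hs2⟩, hmin⟩ := hcomp.exists_isLeast hne
    have hbefore : ∀ r, 0 ≤ r → r < s → ε < d r := fun r hr0 hrs => by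
      by_contra hcon
      exact absurd (hmin ⟨not_lt.1 hcon, hr0, by linarith [hs2.2]⟩) (not_le.2 hrs)
    have hbs : b < s := by
      by_contra hcon
      exact absurd (hq s ⟨hs2.1, not_lt.1 hcon⟩) (not_lt.2 hs1)
    have hds : d s = ε := by
      refine le_antisymm hs1 ?_
      by_contra hcon
      obtain ⟨r, hr, hrU⟩ := exists_mem_Ioo_of_mem_Icc (hb.trans hbs) ⟨hs2.1, le_rfl⟩
        (isOpen_lt hc continuous_const) (not_le.1 hcon)
      exact lt_asymm (hbefore r hr.1.le hr.2) hrU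
    have hsh : s < b + h := by
      refine lt_of_le_of_ne hs2.2 fun he => h3 ?_
      rw [← he]; exact hds
    obtain ⟨ν, hν⟩ := exists_direction hε hds
    have hqe : q = flyBack ε a v (s, ν, q.2) := by
      refine Prod.ext ?_ rfl
      have e1 : q.1 = shift (shift q.1 (s • q.2)) (-(s • q.2)) := by
        rw [shift_shift, add_neg_cancel, shift_zero]
      rw [e1, hν, hpa s (hτb.trans hbs.le), shift_shift, shift_shift, flyBack]
      congr 1; module
    refine ⟨(s, ν, q.2), ⟨⟨hbs, hsh⟩, ?_⟩, hqe.symm⟩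
    simp only
    have hnear : ∃ δ > 0, δ < s - b ∧ δ * ‖v - q.2‖ ≤ 1 / 4 := by
      refine ⟨min ((s - b) / 2) (1 / (4 * (‖v - q.2‖ + 1))), ?_, ?_, ?_⟩
      · have := sub_pos.2 hbs; positivity
      · have := sub_pos.2 hbs
        exact (min_le_left _ _).trans_lt (by linarith)
      · have hn := norm_nonneg (v - q.2)
        calc min ((s - b) / 2) (1 / (4 * (‖v - q.2‖ + 1))) * ‖v - q.2‖
            ≤ (1 / (4 * (‖v - q.2‖ + 1))) * (‖v - q.2‖ + 1) := by
              gcongr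
              · exact min_le_right _ _
              · linarith
          _ = 1 / 4 := by field_simp
    obtain ⟨δ, hδ0, hδ1, hδ2⟩ := hnear
    have hdist : ∀ r, |s - r| ≤ δ → d r ^ 2 = ε ^ 2 +
        2 * ε * (s - r) * inner ℝ (v - q.2) (ν : Vel) + (s - r) ^ 2 * ‖v - q.2‖ ^ 2 := fun r hr => by
      have h4 := torusDist_flyBack (s := s) (r := r) hε hε' a v ν q.2 (le_trans (by gcongr) hδ2)
      rw [← norm_sq_relative, ← h4, ← hqe]
      simp only [hd]
      rw [hpa r (by rw [abs_le] at hr; linarith)]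
    by_contra hcon
    rcases (not_lt.1 hcon).lt_or_eq with hneg | hzero
    · have hu : 0 < ‖v - q.2‖ := by
        rw [norm_pos_iff]; intro h0; rw [h0, inner_zero_left] at hneg; exact lt_irrefl _ hneg
      set κ := inner ℝ (v - q.2) (ν : Vel)
      -- A time η before contact the squared distance is ε² + 2εηκ + η²|v - w|². This choice of η
      -- makes it at most ε² + εηκ < ε², which contradicts that contact is the first.
      set η := min δ (-(ε * κ) / ‖v - q.2‖ ^ 2) with hη
      have hη0 : 0 < η := by
        have : 0 < -(ε * κ) := by nlinarith
        positivity
      have hηδ : η ≤ δ := min_le_left _ _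
      have hη2 : η * ‖v - q.2‖ ^ 2 ≤ -(ε * κ) := by
        rw [← le_div_iff₀ (by positivity)]; exact min_le_right _ _
      have h5 := hdist (s - η) (by rw [sub_sub_cancel, abs_of_pos hη0]; exact hηδ)
      have h6 := hbefore (s - η) (by linarith) (by linarith)
      rw [sub_sub_cancel] at h5
      have h7 : ε ^ 2 < d (s - η) ^ 2 := by gcongr
      have h8 : η * (η * ‖v - q.2‖ ^ 2) ≤ η * (-(ε * κ)) := by gcongr
      have h9 : 0 < η * (-(ε * κ)) := by
        have : 0 < -(ε * κ) := by nlinarith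
        positivity
      nlinarith
    · obtain ⟨x, hx1, hx2⟩ := exists_rat_btwn (show s - δ < s by linarith)
      obtain ⟨y, hy1, hy2⟩ := exists_rat_btwn (show s < s + δ by linarith)
      refine h2 x y ⟨fun r hr => ?_, s, ⟨hx2.le, hy1.le⟩, hs1⟩
      have h5 := hdist r (by rw [abs_le]; constructor <;> linarith [hr.1, hr.2])
      rw [hzero, mul_zero, add_zero] at h5
      have h6 : 0 ≤ (s - r) ^ 2 * ‖v - q.2‖ ^ 2 := by positivity
      exact (sq_le_sq₀ hε.le (torusDist_nonneg _ _)).1 (by linarith)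
  · rintro ⟨⟨s, ν, w⟩, ⟨hs, -⟩, rfl⟩ hav
    simp only at hs
    have h4 := hav s ⟨hb.le.trans hs.1.le, hs.2.le⟩
    rw [hpa s (hτb.trans hs.1.le)] at h4
    have h5 := torusDist_flyBack (s := s) (r := s) hε hε' a v ν w (by simp)
    rw [show (flyBack ε a v (s, ν, w)).2 = w from rfl, h5, sub_self, zero_smul, zero_add, norm_smul,
      Real.norm_of_nonneg hε.le] at h4
    simp at h4

open CollisionTree

/-! ### The correction to the collision rate -/

/-- The rate, at time `t`, of collisions with particles which have not been met before. -/
def firstHitRate (g₀ : Phase → ℝ) (ε t : ℝ) (Φ : CollisionTree) : ENNReal :=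
  ∫⁻ z in {z : Sph × Vel | flyBack ε Φ.anchor Φ.endVel (t, z.1, z.2) ∈ avoiding ε t Φ},
    rateDensity g₀ ε Φ.anchor Φ.endVel t z ∂dirVelMeasure

/-- The rate, at time `t`, at which particles are met again. -/
def rehitRate (g₀ : Phase → ℝ) (ε t : ℝ) (Φ : CollisionTree) : ENNReal :=
  ∫⁻ z in {z : Sph × Vel | flyBack ε Φ.anchor Φ.endVel (t, z.1, z.2) ∈ (avoiding ε t Φ)ᶜ},
    rateDensity g₀ ε Φ.anchor Φ.endVel t z ∂dirVelMeasure

theorem isLocallyClosed_Ioo (b c : ℝ) : IsLocallyClosed (Ioo b c) := isOpen_Ioo.isLocallyClosed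

theorem measurableSet_avoiding (ε t : ℝ) (Φ : CollisionTree) : MeasurableSet (avoiding ε t Φ) :=
  measurableSet_avoidSet Φ.continuous_pos ε (isLocallyClosed_Ioo _ _)

theorem measurable_flyBack_dirVel (ε : ℝ) (a : Torus) (v : Vel) (t : ℝ) :
    Measurable fun z : Sph × Vel => flyBack ε a v (t, z.1, z.2) :=
  (continuous_flyBack ε a v).measurable.comp
    (by fun_prop : Measurable fun z : Sph × Vel => ((t, z.1, z.2) : Mark))

section Rates

variable {g₀ : Phase → ℝ} {G : Vel → ENNReal}

theorem lintegral_rateDensity_lt_top (hG : IsMajorant g₀ G) (ε : ℝ) (a : Torus) (v : Vel) (t : ℝ) :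
    ∫⁻ z, rateDensity g₀ ε a v t z ∂dirVelMeasure < ⊤ :=
  (lintegral_mono_ae ((rateDensity_le hG v).mono fun _ hz => hz ε a t)).trans_lt
    (lintegral_rate_bound hG v)

theorem firstHitRate_add_rehitRate (g₀ : Phase → ℝ) (ε t : ℝ) (Φ : CollisionTree) :
    firstHitRate g₀ ε t Φ + rehitRate g₀ ε t Φ
      = ∫⁻ z, rateDensity g₀ ε Φ.anchor Φ.endVel t z ∂dirVelMeasure := by
  have hm := measurable_flyBack_dirVel ε Φ.anchor Φ.endVel t (measurableSet_avoiding ε t Φ)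
  exact lintegral_add_compl _ hm

theorem firstHitRate_ne_top (hG : IsMajorant g₀ G) (ε t : ℝ) (Φ : CollisionTree) :
    firstHitRate g₀ ε t Φ ≠ ⊤ :=
  ((setLIntegral_le_lintegral _ _).trans_lt (lintegral_rateDensity_lt_top hG _ _ _ _)).ne

theorem rehitRate_ne_top (hG : IsMajorant g₀ G) (ε t : ℝ) (Φ : CollisionTree) :
    rehitRate g₀ ε t Φ ≠ ⊤ :=
  ((setLIntegral_le_lintegral _ _).trans_lt (lintegral_rateDensity_lt_top hG _ _ _ _)).ne

/-- After the last collision the integrand of the collision rate is `rateDensity` in the coordinates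
of `flyBack`. The majorant provides the integrability for Fubini, and the domain splits according to
whether the particle was met before. -/
theorem collisionRate_eq (hgm : Measurable g₀) (hg0 : ∀ q, 0 ≤ g₀ q) (hG : IsMajorant g₀ G)
    (ε : ℝ) {t : ℝ} {Φ : CollisionTree} (hmono : StrictMono Φ.time) (ht : ∀ j, Φ.time j ≤ t) :
    collisionRate g₀ ε t Φ = (firstHitRate g₀ ε t Φ).toReal + (rehitRate g₀ ε t Φ).toReal := by
  rw [← ENNReal.toReal_add (firstHitRate_ne_top hG _ _ _) (rehitRate_ne_top hG _ _ _),
    firstHitRate_add_rehitRate]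
  set F : Sph × Vel → ℝ := fun z =>
    g₀ (flyBack ε Φ.anchor Φ.endVel (t, z.1, z.2)) * max (inner ℝ (Φ.endVel - z.2) (z.1 : Vel)) 0 with hF
  have hF0 : ∀ z, 0 ≤ F z := fun z => mul_nonneg (hg0 _) (le_max_right _ _)
  have hFm : Measurable F :=
    (hgm.comp (measurable_flyBack_dirVel ε Φ.anchor Φ.endVel t)).mul (by fun_prop)
  have hFR : ∀ z, ENNReal.ofReal (F z) = rateDensity g₀ ε Φ.anchor Φ.endVel t z := fun z => by
    rw [rateDensity, hF, ENNReal.ofReal_mul (hg0 _), mul_comm]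
  have hint : Integrable F dirVelMeasure := by
    refine ⟨hFm.aestronglyMeasurable, ?_⟩
    rw [hasFiniteIntegral_iff_ofReal (Eventually.of_forall hF0)]
    simp only [hFR]
    exact lintegral_rateDensity_lt_top hG _ _ _ _
  have h1 : collisionRate g₀ ε t Φ = ∫ ν, (∫ w, F (ν, w)) ∂sphereMeasure := by
    rw [collisionRate]
    refine integral_congr_ae (Eventually.of_forall fun ν => ?_)
    refine integral_congr_ae (Eventually.of_forall fun w => ?_)
    simp only [hF, transported, flyBack]
    rw [vel_eq_endVel (time_le_tau hmono), pos_eq_anchor Φ ht, shift_shift, shift_shift]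
    congr 4
    module
  rw [h1, ← integral_prod _ hint, integral_eq_lintegral_of_nonneg_ae (Eventually.of_forall hF0)
    hFm.aestronglyMeasurable]
  simp only [hFR]
  rfl

theorem hitting_eq (ε : ℝ) {t h : ℝ} {Φ : CollisionTree} (ht : ∀ j, Φ.time j ≤ t) :
    hitting ε t h Φ = hitSet ε Φ.anchor Φ.endVel (Ioo t (t + h)) := by
  ext q
  constructor
  · rintro ⟨s, hs, ν, he, hin⟩
    have hs' : ∀ j, Φ.time j ≤ s := fun j => (ht j).trans hs.1.le
    rw [vel_eq_endVel hs'] at hin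
    refine ⟨(s, ν, q.2), ⟨hs, hin⟩, Prod.ext ?_ rfl⟩
    calc (flyBack ε Φ.anchor Φ.endVel (s, ν, q.2)).1
        = shift (shift (Φ.pos s) (ε • (ν : Vel))) (-(s • q.2)) := by
          rw [pos_eq_anchor Φ hs', shift_shift, shift_shift]
          change shift _ (s • (Φ.endVel - q.2) + ε • (ν : Vel)) = _
          congr 1; module
      _ = q.1 := by rw [he, shift_shift, add_neg_cancel, shift_zero]
  · rintro ⟨⟨s, ν, w⟩, ⟨hs, hin⟩, rfl⟩
    simp only at hs hin
    have hs' : ∀ j, Φ.time j ≤ s := fun j => (ht j).trans hs.1.le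
    refine ⟨s, hs, ν, ?_, ?_⟩
    · change _ = shift (flyBack ε _ _ (s, ν, w)).1 (s • w)
      rw [shift_flyBack, pos_eq_anchor Φ hs', shift_shift]
      congr 1; module
    · rwa [vel_eq_endVel hs']

theorem eventually_tau_le {Φ : CollisionTree} {t : ℝ} (ht : Φ.tau < t) {α : ℝ → ℝ}
    (hα : ∀ h > 0, t - h ≤ α h ∧ α h ≤ t) : ∀ᶠ h in 𝓝[>] 0, Φ.tau < α h ∧ 0 < h := by
  have hid : Tendsto (fun h : ℝ => h) (𝓝[>] 0) (𝓝 0) := nhdsWithin_le_nhds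
  filter_upwards [self_mem_nhdsWithin, hid.eventually (gt_mem_nhds (sub_pos.2 ht))] with h hh h1
  exact ⟨by linarith [(hα h hh).1], hh⟩

theorem tendsto_real_of_lawOf {g : Phase → ℝ} {D : ℝ → Set Phase} {ε : ℝ} {R : ENNReal}
    (hR : R ≠ ⊤)
    (h : Tendsto (fun h => lawOf g (D h) / ENNReal.ofReal (h * ε ^ 2)) (𝓝[>] 0) (𝓝 R)) :
    Tendsto (fun h => (lawOf g (D h)).toReal / (h * ε ^ 2)) (𝓝[>] 0) (𝓝 R.toReal) := by
  refine ((ENNReal.tendsto_toReal hR).comp h).congr' ?_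
  filter_upwards [self_mem_nhdsWithin] with h hh
  have hh0 : 0 < h := hh
  rw [Function.comp_apply, ENNReal.toReal_div, ENNReal.toReal_ofReal (by positivity)]

/-- The left end `α h` of the interval is left free between t - h and t: the constant t yields right
derivatives, t - h yields left derivatives. -/
theorem tendsto_firstHit (hgm : Measurable g₀) (hG : IsMajorant g₀ G) {ε : ℝ} (hε : 0 < ε)
    (hε' : ε ≤ 1 / 8) {Φ : CollisionTree} (hmono : StrictMono Φ.time) (h0 : ∀ j, 0 ≤ Φ.time j) {t : ℝ}
    (ht : Φ.tau < t) {α : ℝ → ℝ} (hα : ∀ h > 0, t - h ≤ α h ∧ α h ≤ t) :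
    Tendsto (fun h => (lawOf g₀ (hitSet ε Φ.anchor Φ.endVel (Ioo (α h) (α h + h)) ∩
      avoiding ε (α h) Φ)).toReal / (h * ε ^ 2)) (𝓝[>] 0) (𝓝 (firstHitRate g₀ ε t Φ).toReal) := by
  have hpa : ∀ s, Φ.tau ≤ s → Φ.pos s = shift Φ.anchor (s • Φ.endVel) := fun s hs =>
    pos_eq_anchor Φ fun j => (time_le_tau hmono j).trans hs
  refine tendsto_real_of_lawOf (firstHitRate_ne_top hG _ _ _) ?_
  exact tendsto_lawOf_hitSet hgm hG hε hε' Φ.anchor Φ.endVel ((tau_nonneg h0).trans_lt ht) hα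
    (fun h => measurableSet_avoiding ε (α h) Φ) (measurableSet_avoiding ε t Φ)
    (ae_eventually_mem_avoidSet_iff Φ.continuous_pos (tau_nonneg h0) ht hpa hε hε' hα)

theorem tendsto_hittingTwice (hgm : Measurable g₀) (hG : IsMajorant g₀ G) {ε : ℝ} (hε : 0 < ε)
    (hε' : ε ≤ 1 / 8) {Φ : CollisionTree} (hmono : StrictMono Φ.time) (h0 : ∀ j, 0 ≤ Φ.time j) {t : ℝ}
    (ht : Φ.tau < t) {α : ℝ → ℝ} (hα : ∀ h > 0, t - h ≤ α h ∧ α h ≤ t) :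
    Tendsto (fun h => (lawOf g₀ (hittingTwice ε (α h) h Φ)).toReal / (h * ε ^ 2)) (𝓝[>] 0)
      (𝓝 (rehitRate g₀ ε t Φ).toReal) := by
  have hpa : ∀ s, Φ.tau ≤ s → Φ.pos s = shift Φ.anchor (s • Φ.endVel) := fun s hs =>
    pos_eq_anchor Φ fun j => (time_le_tau hmono j).trans hs
  have h1 := tendsto_lawOf_hitSet hgm hG hε hε' Φ.anchor Φ.endVel ((tau_nonneg h0).trans_lt ht) hα
    (fun h => (measurableSet_avoiding ε (α h) Φ).compl) (measurableSet_avoiding ε t Φ).compl (by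
      filter_upwards [ae_eventually_mem_avoidSet_iff Φ.continuous_pos (tau_nonneg h0) ht hpa hε hε' hα]
        with z hz hin θ hθ
      filter_upwards [hz hin θ hθ] with h hh
      exact not_congr hh)
  refine (tendsto_real_of_lawOf (rehitRate_ne_top hG _ _ _) h1).congr' ?_
  filter_upwards [eventually_tau_le ht hα] with h hh
  rw [hittingTwice, hitting_eq ε fun j => (time_le_tau hmono j).trans hh.1.le]
  rfl

/-! ### The mass of the background particles not yet hit -/

/-- The probability that a background particle is not met during `[0, t]`. -/
def unhitMass (g₀ : Phase → ℝ) (ε t : ℝ) (Φ : CollisionTree) : ℝ :=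
  (lawOf g₀ (avoidSet Φ.pos ε (Icc 0 t))).toReal

theorem unhitMass_nonneg (g₀ : Phase → ℝ) (ε t : ℝ) (Φ : CollisionTree) : 0 ≤ unhitMass g₀ ε t Φ :=
  ENNReal.toReal_nonneg

theorem freeMass_eq (hgm : Measurable g₀) (hg0 : ∀ q, 0 ≤ g₀ q) (ε t : ℝ) (Φ : CollisionTree) :
    freeMass g₀ ε t Φ = (lawOf g₀ (avoiding ε t Φ)).toReal :=
  setIntegral_eq_lawOf hgm hg0 _

theorem freeMass_eq_unhitMass (hgm : Measurable g₀) (hg0 : ∀ q, 0 ≤ g₀ q) {ε : ℝ} (hε : 0 < ε)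
    {t : ℝ} (ht : 0 < t) (Φ : CollisionTree) : freeMass g₀ ε t Φ = unhitMass g₀ ε t Φ := by
  rw [freeMass_eq hgm hg0, unhitMass]
  congr 1
  refine measure_congr ?_
  filter_upwards [lawOf_avoidSet_Ioo g₀ Φ.continuous_pos hε ht] with q hq using propext hq

theorem unhitMass_eq_add [IsFiniteMeasure (lawOf g₀)] {ε : ℝ} (hε : 0 < ε)
    (hε' : ε ≤ 1 / 8) {Φ : CollisionTree} (hmono : StrictMono Φ.time) {b h : ℝ} (hτb : Φ.tau ≤ b)
    (hb : 0 < b) (hh : 0 < h) :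
    unhitMass g₀ ε b Φ = unhitMass g₀ ε (b + h) Φ
      + (lawOf g₀ (hitSet ε Φ.anchor Φ.endVel (Ioo b (b + h)) ∩ avoiding ε b Φ)).toReal := by
  have hpa : ∀ s, Φ.tau ≤ s → Φ.pos s = shift Φ.anchor (s • Φ.endVel) := fun s hs =>
    pos_eq_anchor Φ fun j => (time_le_tau hmono j).trans hs
  rw [unhitMass, unhitMass, lawOf_avoidSet_eq_add g₀ Φ.continuous_pos hτb hb hh hpa hε hε',
    ENNReal.toReal_add (measure_ne_top _ _) (measure_ne_top _ _)]
  rfl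

/-- By `unhitMass_eq_add` an increment of the mass is minus the mass of first hits, whose rate is
`tendsto_firstHit`. The two one-sided derivatives coincide. -/
theorem hasDerivAt_unhitMass (hgm : Measurable g₀) [IsFiniteMeasure (lawOf g₀)]
    (hG : IsMajorant g₀ G) {ε : ℝ} (hε : 0 < ε) (hε' : ε ≤ 1 / 8) {Φ : CollisionTree}
    (hmono : StrictMono Φ.time) (h0 : ∀ j, 0 ≤ Φ.time j) {t : ℝ} (ht : Φ.tau < t) :
    HasDerivAt (fun s => unhitMass g₀ ε s Φ) (-(ε ^ 2 * (firstHitRate g₀ ε t Φ).toReal)) t := by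
  have hτ0 := tau_nonneg h0
  have hε2 : ε ^ 2 ≠ 0 := by positivity
  have hr : HasDerivWithinAt (fun s => unhitMass g₀ ε s Φ)
      (-(ε ^ 2 * (firstHitRate g₀ ε t Φ).toReal)) (Ioi t) t := by
    rw [hasDerivWithinAt_iff_tendsto_slope' self_notMem_Ioi]
    have h1 := (tendsto_firstHit hgm hG hε hε' hmono h0 ht (α := fun _ => t)
      fun h hh => ⟨by linarith, le_rfl⟩).const_mul (-ε ^ 2)
    have h2 : Tendsto (fun s => s - t) (𝓝[>] t) (𝓝[>] 0) := by
      refine tendsto_nhdsWithin_iff.2 ⟨?_, ?_⟩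
      · have : Tendsto (fun s => s - t) (𝓝 t) (𝓝 (t - t)) := tendsto_id.sub tendsto_const_nhds
        rw [sub_self] at this
        exact this.mono_left nhdsWithin_le_nhds
      · filter_upwards [self_mem_nhdsWithin] with s hs using (sub_pos.2 (show t < s from hs) : (0 : ℝ) < s - t)
    rw [← neg_mul]
    refine (h1.comp h2).congr' ?_
    filter_upwards [self_mem_nhdsWithin] with s hs
    have hst : 0 < s - t := sub_pos.2 hs
    have h3 := unhitMass_eq_add (g₀ := g₀) hε hε' hmono ht.le (hτ0.trans_lt ht) hst
    rw [add_sub_cancel] at h3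
    rw [Function.comp_apply, slope_def_field, add_sub_cancel, h3]
    field_simp
    ring
  have hl : HasDerivWithinAt (fun s => unhitMass g₀ ε s Φ)
      (-(ε ^ 2 * (firstHitRate g₀ ε t Φ).toReal)) (Iio t) t := by
    rw [hasDerivWithinAt_iff_tendsto_slope' self_notMem_Iio]
    have hα : ∀ h > 0, t - h ≤ t - h ∧ t - h ≤ t := fun h hh => ⟨le_rfl, by linarith⟩
    have h1 := (tendsto_firstHit hgm hG hε hε' hmono h0 ht (α := fun h => t - h) hα).const_mul (-ε ^ 2)
    have h2 : Tendsto (fun s => t - s) (𝓝[<] t) (𝓝[>] 0) := by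
      refine tendsto_nhdsWithin_iff.2 ⟨?_, ?_⟩
      · have : Tendsto (fun s => t - s) (𝓝 t) (𝓝 (t - t)) := tendsto_const_nhds.sub tendsto_id
        rw [sub_self] at this
        exact this.mono_left nhdsWithin_le_nhds
      · filter_upwards [self_mem_nhdsWithin] with s hs using (sub_pos.2 (show s < t from hs) : (0 : ℝ) < t - s)
    rw [← neg_mul]
    refine (h1.comp h2).congr' ?_
    filter_upwards [self_mem_nhdsWithin, mem_nhdsWithin_of_mem_nhds (lt_mem_nhds ht)] with s hs hs2
    have hst : 0 < t - s := sub_pos.2 hs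
    have h3 := unhitMass_eq_add (g₀ := g₀) hε hε' hmono (show Φ.tau ≤ s from le_of_lt hs2)
      (hτ0.trans_lt hs2) hst
    rw [add_sub_cancel] at h3
    rw [Function.comp_apply, slope_def_field, sub_sub_cancel, add_sub_cancel, h3]
    have h4 : s - t ≠ 0 := by linarith
    field_simp
    ring
  have h := (hasDerivWithinAt_Iio_iff_Iic.1 hl).union (hasDerivWithinAt_Ioi_iff_Ici.1 hr)
  rwa [Iic_union_Ici, hasDerivWithinAt_univ] at h

/-- Being strictly outside at time t persists for a short while, so the avoiding sets increase to
the one at t as s decreases to t. This provides continuity at τ itself, where the derivative above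
is not available. -/
theorem tendsto_unhitMass_right [IsFiniteMeasure (lawOf g₀)] (ε t : ℝ) (Φ : CollisionTree) :
    ContinuousWithinAt (fun s => unhitMass g₀ ε s Φ) (Ici t) t := by
  have h1 : Tendsto (fun s => ∫⁻ q, (avoidSet Φ.pos ε (Icc 0 s)).indicator 1 q ∂lawOf g₀) (𝓝[≥] t)
      (𝓝 (∫⁻ q, (avoidSet Φ.pos ε (Icc 0 t)).indicator 1 q ∂lawOf g₀)) := by
    have hm : ∀ s, MeasurableSet (avoidSet Φ.pos ε (Icc 0 s)) := fun s =>
      measurableSet_avoidSet Φ.continuous_pos ε isClosed_Icc.isLocallyClosed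
    refine tendsto_lintegral_filter_of_dominated_convergence (fun _ => 1)
      (Eventually.of_forall fun s => measurable_one.indicator (hm s)) ?_ (by simp) ?_
    · exact Eventually.of_forall fun s => Eventually.of_forall fun q =>
        indicator_le_self' (fun _ _ => zero_le) q
    · refine Eventually.of_forall fun q => ?_
      refine tendsto_const_nhds.congr' ?_
      by_cases hq : q ∈ avoidSet Φ.pos ε (Icc 0 t)
      · have hev : ∀ᶠ s in 𝓝[≥] t, q ∈ avoidSet Φ.pos ε (Icc 0 s) := by
          rcases lt_or_ge t 0 with h0 | h0
          · filter_upwards [mem_nhdsWithin_of_mem_nhds (gt_mem_nhds h0)] with s hs r hr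
            have : s < 0 := hs
            exact absurd (hr.1.trans hr.2) (not_le.2 this)
          · have hc : Continuous fun s : ℝ => torusDist (Φ.pos s) (shift q.1 (s • q.2)) :=
              continuous_torusDist_comp Φ.continuous_pos
                (continuous_shift_comp continuous_const (by fun_prop))
            have h2 := (hc.tendsto t).eventually (lt_mem_nhds (hq t ⟨h0, le_rfl⟩))
            obtain ⟨δ, hδ, hball⟩ := Metric.eventually_nhds_iff.1 h2
            filter_upwards [mem_nhdsWithin_of_mem_nhds (gt_mem_nhds (show t < t + δ by linarith))]
              with s hs r hr
            have hs' : s < t + δ := hs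
            by_cases hrt : r ≤ t
            · exact hq r ⟨hr.1, hrt⟩
            · push Not at hrt
              refine hball ?_
              rw [Real.dist_eq, abs_of_pos (by linarith)]
              linarith [hr.2]
        filter_upwards [hev] with s hs
        rw [indicator_of_mem hq, indicator_of_mem hs]
      · filter_upwards [self_mem_nhdsWithin] with s hs
        rw [indicator_of_notMem hq, indicator_of_notMem]
        exact fun h => hq (avoidSet_anti (Icc_subset_Icc_right hs) h)
  have h2 : ∀ s, ∫⁻ q, (avoidSet Φ.pos ε (Icc 0 s)).indicator 1 q ∂lawOf g₀
      = lawOf g₀ (avoidSet Φ.pos ε (Icc 0 s)) := fun s =>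
    lintegral_indicator_one (measurableSet_avoidSet Φ.continuous_pos ε isClosed_Icc.isLocallyClosed)
  simp only [h2] at h1
  exact (ENNReal.tendsto_toReal (measure_ne_top _ _)).comp h1

/-! ### The correction vanishes in the limit -/

/-- With J the set of collisions before s, the path lies on an affine line indexed by J, one of
finitely many. This finiteness makes the exceptional velocities of `ae_ne_pos` a countable union of
lines. -/
theorem pos_eq_shift_affine (Φ : CollisionTree) (s : ℝ) :
    ∃ J : Finset (Fin Φ.n), Φ.pos s = shift Φ.x₀
      (-(∑ j ∈ J, Φ.time j • (velAfter Φ (j + 1) - velAfter Φ j)) +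
        s • (Φ.v₀ + ∑ j ∈ J, (velAfter Φ (j + 1) - velAfter Φ j))) := by
  classical
  refine ⟨Finset.univ.filter fun j => Φ.time j ≤ s, ?_⟩
  rw [pos, Finset.sum_filter, Finset.sum_filter]
  congr 1
  have h : ∑ j : Fin Φ.n, max (s - Φ.time j) 0 • (velAfter Φ (j + 1) - velAfter Φ j)
      = s • (∑ j : Fin Φ.n, if Φ.time j ≤ s then velAfter Φ (j + 1) - velAfter Φ j else 0)
        - ∑ j : Fin Φ.n, if Φ.time j ≤ s then
            Φ.time j • (velAfter Φ (j + 1) - velAfter Φ j) else 0 := by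
    rw [Finset.smul_sum, ← Finset.sum_sub_distrib]
    refine Finset.sum_congr rfl fun j _ => ?_
    by_cases hj : Φ.time j ≤ s
    · rw [if_pos hj, if_pos hj, max_eq_left (sub_nonneg.2 hj), sub_smul]
    · rw [if_neg hj, if_neg hj, max_eq_right (by linarith), zero_smul, smul_zero, sub_zero]
  rw [h, smul_add]
  abel

theorem volume_span_singleton_eq_zero (c e : Vel) :
    volume {w : Vel | w - c ∈ Submodule.span ℝ {e}} = 0 := by
  have h1 : volume ((Submodule.span ℝ {e} : Submodule ℝ Vel) : Set Vel) = 0 := by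
    refine Measure.addHaar_submodule _ _ fun htop => ?_
    have h2 := finrank_span_le_card (R := ℝ) ({e} : Set Vel)
    rw [htop, finrank_top] at h2
    simp at h2
  have h2 := measure_preimage_add_right (volume : Measure Vel) (-c)
    ((Submodule.span ℝ {e} : Submodule ℝ Vel) : Set Vel)
  rw [h1] at h2
  simp only [← sub_eq_add_neg] at h2
  exact h2

/-- Almost all particles which are at a given place at time `t` have not been on the path before. -/
theorem ae_ne_pos (Φ : CollisionTree) (a : Torus) (t : ℝ) :
    ∀ᵐ w : Vel, ∀ r < t, Φ.pos r ≠ shift a (-((t - r) • w)) := by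
  obtain ⟨z₀, hz₀⟩ := exists_toTorus_eq Φ.x₀
  obtain ⟨z₁, hz₁⟩ := exists_toTorus_eq a
  set b : Finset (Fin Φ.n) → Vel := fun J =>
    -(∑ j ∈ J, Φ.time j • (velAfter Φ (j + 1) - velAfter Φ j))
  set c : Finset (Fin Φ.n) → Vel := fun J => Φ.v₀ + ∑ j ∈ J, (velAfter Φ (j + 1) - velAfter Φ j)
  -- If the backward flight meets the piece J of the path after the lattice translation k, then (t -
  -- r)(w - c J) is a vector independent of r and w. So for each J and k the bad velocities lie on
  -- one line.
  have h : ∀ᵐ w : Vel, ∀ (J : Finset (Fin Φ.n)) (k : Fin 3 → ℤ), w ∉ {w : Vel | w - c J ∈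
      Submodule.span ℝ {z₁ - (z₀ + b J + t • c J + latticePoint k)}} := by
    rw [ae_all_iff]; intro J
    rw [ae_all_iff]; intro k
    exact measure_eq_zero_iff_ae_notMem.1 (volume_span_singleton_eq_zero _ _)
  filter_upwards [h] with w hw r hr he
  obtain ⟨J, hJ⟩ := pos_eq_shift_affine Φ r
  rw [he, ← hz₀, ← hz₁, ← toTorus_add, ← toTorus_add] at hJ
  obtain ⟨k, hk⟩ := exists_lattice_of_toTorus_eq hJ.symm
  refine hw J k (Submodule.mem_span_singleton.2 ⟨(t - r)⁻¹, ?_⟩)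
  have htr : t - r ≠ 0 := by linarith
  have h1 : z₁ - (z₀ + b J + t • c J + latticePoint k) = (t - r) • (w - c J) := by
    have h2 : z₁ = z₀ + (b J + r • c J) + latticePoint k + (t - r) • w := by
      rw [← hk]; abel
    rw [h2]; module
  rw [h1, smul_smul, inv_mul_cancel₀ htr, one_smul]

/-- For almost every w the backward flight from x(t) itself misses the path before t. On [0, t - δ]
it does so by a positive margin, which survives the displacement by εν for small ε; on (t - δ, t) an
incoming particle is automatically outside. Dominated convergence concludes. -/
theorem tendsto_rehitRate (hgm : Measurable g₀) (hG : IsMajorant g₀ G) {Φ : CollisionTree}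
    (hmono : StrictMono Φ.time) {t : ℝ} (ht : Φ.tau < t) :
    Tendsto (fun ε => (rehitRate g₀ ε t Φ).toReal) (𝓝[>] 0) (𝓝 0) := by
  have hpa : ∀ s, Φ.tau ≤ s → Φ.pos s = shift Φ.anchor (s • Φ.endVel) := fun s hs =>
    pos_eq_anchor Φ fun j => (time_le_tau hmono j).trans hs
  set a := Φ.anchor with ha
  set v := Φ.endVel with hv
  set Q : ℝ → Set (Sph × Vel) := fun ε => {z | flyBack ε a v (t, z.1, z.2) ∈ (avoiding ε t Φ)ᶜ} with hQ
  have hQm : ∀ ε, MeasurableSet (Q ε) := fun ε =>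
    measurable_flyBack_dirVel ε a v t (measurableSet_avoiding ε t Φ).compl
  have hlim : Tendsto (fun ε => ∫⁻ z, (Q ε).indicator (rateDensity g₀ ε a v t) z ∂dirVelMeasure)
      (𝓝[>] 0) (𝓝 (∫⁻ _, 0 ∂dirVelMeasure)) := by
    refine tendsto_lintegral_filter_of_dominated_convergence
      (fun z => G z.2 * ENNReal.ofReal ‖v - z.2‖)
      (Eventually.of_forall fun ε => (measurable_rateDensity hgm ε a v t).indicator (hQm ε)) ?_
      (lintegral_rate_bound hG v).ne ?_
    · refine Eventually.of_forall fun ε => ?_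
      filter_upwards [rateDensity_le hG v] with z hz
      exact (indicator_le_self' (fun _ _ => zero_le) _).trans (hz _ _ _)
    · filter_upwards [ae_dirVel_of_ae (ae_ne_pos Φ (shift a (t • v)) t)] with z hz
      refine tendsto_const_nhds.congr' ?_
      obtain ⟨ν, w⟩ := z
      simp only at hz
      by_cases hin : 0 < inner ℝ (v - w) (ν : Vel)
      · have hδ : ∃ δ > 0, δ < t - Φ.tau ∧ δ * ‖v - w‖ ≤ 1 / 4 := by
          refine ⟨min ((t - Φ.tau) / 2) (1 / (4 * (‖v - w‖ + 1))), ?_, ?_, ?_⟩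
          · have := sub_pos.2 ht; positivity
          · have := sub_pos.2 ht
            exact (min_le_left _ _).trans_lt (by linarith)
          · have hn := norm_nonneg (v - w)
            calc min ((t - Φ.tau) / 2) (1 / (4 * (‖v - w‖ + 1))) * ‖v - w‖
                ≤ (1 / (4 * (‖v - w‖ + 1))) * (‖v - w‖ + 1) := by
                  gcongr
                  · exact min_le_right _ _
                  · linarith
              _ = 1 / 4 := by field_simp
        obtain ⟨δ, hδ0, hδ1, hδ2⟩ := hδ
        -- The diameter is the first variable, so that d is continuous down to diameter 0 and
        -- compactness in time gives a uniform threshold.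
        set d : ℝ × ℝ → ℝ := fun y => torusDist (Φ.pos y.2)
          (shift a (t • (v - w) + y.1 • (ν : Vel) + y.2 • w)) - y.1 with hd
        have hdc : Continuous d := by
          refine Continuous.sub (continuous_torusDist_comp (Φ.continuous_pos.comp continuous_snd)
            (continuous_shift_comp continuous_const (by fun_prop))) continuous_fst
        have hK : ∀ᶠ ε in 𝓝 (0 : ℝ), ∀ r ∈ Icc 0 (t - δ), 0 < d (ε, r) := by
          refine isCompact_Icc.eventually_forall_of_forall_eventually fun r hr => ?_
          have h1 : 0 < d (0, r) := by
            simp only [hd, zero_smul, add_zero, sub_zero]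
            refine lt_of_le_of_ne (torusDist_nonneg _ _) fun he => ?_
            obtain ⟨u, hu, hun⟩ := exists_shift_eq (Φ.pos r) (shift a (t • (v - w) + r • w))
            rw [← he, norm_eq_zero] at hun
            rw [hun, shift_zero] at hu
            refine hz r (by linarith [hr.2]) ?_
            rw [← hu, shift_shift]
            congr 1; module
          exact (hdc.tendsto (0, r)).eventually (lt_mem_nhds h1)
        filter_upwards [nhdsWithin_le_nhds hK, self_mem_nhdsWithin,
          mem_nhdsWithin_of_mem_nhds (gt_mem_nhds (show (0 : ℝ) < 1 / 8 by norm_num))] with ε h1 h2 h3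
        rw [indicator_of_notMem]
        simp only [hQ, mem_ofPred_eq, mem_compl_iff, not_not]
        intro r hr
        change ε < torusDist (Φ.pos r) (shift (flyBack ε a v (t, ν, w)).1 (r • w))
        by_cases hrt : r ≤ t - δ
        · have := h1 r ⟨hr.1.le, hrt⟩
          rw [shift_flyBack]
          simp only [hd] at this
          linarith
        · push Not at hrt
          rw [hpa r (by linarith)]
          refine lt_torusDist_flyBack h2 (le_of_lt h3) a v ν w hin hr.2 (le_trans ?_ hδ2)
          gcongr
          linarith
      · refine Eventually.of_forall fun ε => ?_
        have h1 : rateDensity g₀ ε a v t (ν, w) = 0 := by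
          rw [rateDensity, max_eq_right (not_lt.1 hin), ENNReal.ofReal_zero, zero_mul]
        change (0 : ENNReal) = (Q ε).indicator (rateDensity g₀ ε a v t) (ν, w)
        by_cases hz : (ν, w) ∈ Q ε
        · rw [indicator_of_mem hz, h1]
        · rw [indicator_of_notMem hz]
  rw [lintegral_zero] at hlim
  simp only [lintegral_indicator (hQm _)] at hlim
  have := (ENNReal.tendsto_toReal ENNReal.zero_ne_top).comp hlim
  rwa [ENNReal.toReal_zero] at this

end Rates

/-! ### The trees produced by the dynamics -/

section Dynamics

variable {N n : ℕ} {ε : ℝ} {ω : Config N}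

/-- The state at time `s` of a system started in `ω` in which the tagged particle has followed the tree,
and has met the particles `σ 0, σ 1, …` in this order. -/
structure IsState (ε : ℝ) (ω : Config N) (a : Phase × (Fin n → Mark)) (σ : Fin n → Fin N) (s : ℝ)
    (S : Config N) : Prop where
  tagged : S.1 = (pos ⟨n, a⟩ s, endVel ⟨n, a⟩)
  met : ∀ j, S.2 (σ j) = (bgPos ε ⟨n, a⟩ j s, bgVel ⟨n, a⟩ j s)
  unmet : ∀ i ∉ range σ, S.2 i = flyOne s (ω.2 i)

/-- In the system started in `ω` the tagged particle follows the tree up to time `t`, and meets the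
particles `σ 0, σ 1, …` in this order. -/
structure Realizes (ε t : ℝ) (ω : Config N) (a : Phase × (Fin n → Mark)) (σ : Fin n → Fin N) :
    Prop where
  root : a.1 = ω.1
  inj : Function.Injective σ
  times : ∀ j, (a.2 j).1 ∈ Ioc 0 t
  met : ∀ j, ω.2 (σ j) = startOf ε ⟨n, a⟩ j
  unmet : ∀ i ∉ range σ, ω.2 i ∈ avoidSet (pos ⟨n, a⟩) ε (Icc 0 t)

theorem flyOne_flyOne (s r : ℝ) (q : Phase) : flyOne r (flyOne s q) = flyOne (s + r) q := by
  simp only [flyOne, shift_shift, add_smul]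

theorem pos_eq_shift_pos (Φ : CollisionTree) {s s' : ℝ} (hs : ∀ j, Φ.time j ≤ s) (h : s ≤ s') :
    Φ.pos s' = shift (Φ.pos s) ((s' - s) • Φ.endVel) := by
  rw [pos_eq_anchor Φ hs, pos_eq_anchor Φ fun j => (hs j).trans h, shift_shift]
  congr 1
  module

theorem bgVel_eq_of_le (Φ : CollisionTree) (j : Fin Φ.n) {s s' : ℝ} (hs : Φ.time j ≤ s)
    (h : s ≤ s') : Φ.bgVel j s' = Φ.bgVel j s := by
  rw [bgVel, bgVel, if_neg (not_lt.2 hs), if_neg (not_lt.2 (hs.trans h))]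

theorem bgPos_eq_shift_bgPos (ε : ℝ) (Φ : CollisionTree) (j : Fin Φ.n) {s s' : ℝ}
    (hs : Φ.time j ≤ s) (h : s ≤ s') :
    Φ.bgPos ε j s' = shift (Φ.bgPos ε j s) ((s' - s) • Φ.bgVel j s) := by
  rw [bgPos, bgPos, shift_shift, bgVel_eq_of_le Φ j hs h]
  congr 1
  module

theorem IsState.fly {a : Phase × (Fin n → Mark)} {σ : Fin n → Fin N} {s s' : ℝ} {S : Config N}
    (hS : IsState ε ω a σ s S) (hs : ∀ j, (a.2 j).1 ≤ s) (h : s ≤ s') :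
    IsState ε ω a σ s' (fly (s' - s) S) where
  tagged := by
    change flyOne (s' - s) S.1 = _
    rw [hS.tagged, pos_eq_shift_pos ⟨n, a⟩ hs h]
    rfl
  met j := by
    change flyOne (s' - s) (S.2 (σ j)) = _
    rw [hS.met, bgPos_eq_shift_bgPos ε ⟨n, a⟩ j (hs j) h, bgVel_eq_of_le ⟨n, a⟩ j (hs j) h]
    rfl
  unmet i hi := by
    change flyOne (s' - s) (S.2 i) = _
    rw [hS.unmet i hi, flyOne_flyOne, add_sub_cancel]

theorem IsState.apart_met_iff {a : Phase × (Fin n → Mark)} {σ : Fin n → Fin N} {s : ℝ}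
    {S : Config N} (hS : IsState ε ω a σ s S) (j : Fin n) :
    Apart ε S (σ j) ↔ ε < torusDist (pos ⟨n, a⟩ s) (bgPos ε ⟨n, a⟩ j s) := by
  rw [Apart, hS.tagged, hS.met]

theorem IsState.apart_unmet_iff {a : Phase × (Fin n → Mark)} {σ : Fin n → Fin N} {s : ℝ}
    {S : Config N} (hS : IsState ε ω a σ s S) {i : Fin N} (hi : i ∉ range σ) :
    Apart ε S i ↔ ε < torusDist (pos ⟨n, a⟩ s) (shift (ω.2 i).1 (s • (ω.2 i).2)) := by
  rw [Apart, hS.tagged, hS.unmet i hi]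
  rfl

theorem range_snoc (σ : Fin n → Fin N) (i : Fin N) :
    range (Fin.snoc σ i : Fin (n + 1) → Fin N) = insert i (range σ) := by
  ext k
  simp only [mem_range, mem_insert_iff]
  constructor
  · rintro ⟨j, rfl⟩
    induction j using Fin.lastCases with
    | last => left; simp
    | cast j => right; exact ⟨j, by simp⟩
  · rintro (rfl | ⟨j, rfl⟩)
    · exact ⟨Fin.last n, by simp⟩
    · exact ⟨j.castSucc, by simp⟩

theorem IsState.collide {a : Phase × (Fin (n + 1) → Mark)} {σ : Fin n → Fin N} {S : Config N}
    (hS : IsState ε ω (a.1, Fin.init a.2) σ (a.2 (Fin.last n)).1 S)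
    (hs : ∀ j : Fin n, (a.2 j.castSucc).1 ≤ (a.2 (Fin.last n)).1) {i : Fin N} (hi : i ∉ range σ)
    (hstart : ω.2 i = startOf ε ⟨n + 1, a⟩ (Fin.last n)) :
    IsState ε ω a (Fin.snoc σ i : Fin (n + 1) → Fin N) (a.2 (Fin.last n)).1
      (collide i (a.2 (Fin.last n)).2.1 S) := by
  have hv : endVel ⟨n, (a.1, Fin.init a.2)⟩ = velAfter ⟨n + 1, a⟩ n := velAfter_prune a le_rfl
  have hp : pos ⟨n, (a.1, Fin.init a.2)⟩ (a.2 (Fin.last n)).1 = pos ⟨n + 1, a⟩ (a.2 (Fin.last n)).1 :=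
    pos_prune a le_rfl
  have hSi : S.2 i = (shift (pos ⟨n + 1, a⟩ (a.2 (Fin.last n)).1)
      (ε • ((a.2 (Fin.last n)).2.1 : Vel)), (a.2 (Fin.last n)).2.2) := by
    rw [hS.unmet i hi, hstart]
    refine Prod.ext ?_ rfl
    change shift (shift (pos ⟨n + 1, a⟩ (a.2 (Fin.last n)).1) (_ - (a.2 (Fin.last n)).1 • _)) _ = _
    rw [shift_shift]
    congr 1
    change ε • ((a.2 (Fin.last n)).2.1 : Vel) - (a.2 (Fin.last n)).1 • (a.2 (Fin.last n)).2.2 +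
      (a.2 (Fin.last n)).1 • (a.2 (Fin.last n)).2.2 = _
    abel
  refine ⟨?_, fun j => ?_, fun k hk => ?_⟩
  · refine Prod.ext ?_ ?_
    · change S.1.1 = _
      rw [hS.tagged, ← hp]
    · change S.1.2 - impulse S.1.2 (S.2 i).2 _ = _
      rw [hSi, hS.tagged, endVel]
      change endVel ⟨n, (a.1, Fin.init a.2)⟩ - impulse (endVel ⟨n, (a.1, Fin.init a.2)⟩) _ _ = _
      rw [hv]
      exact (velAfter_succ ⟨n + 1, a⟩ (Nat.lt_succ_self n)).symm
  · induction j using Fin.lastCases with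
    | last =>
      change Function.update S.2 i _ _ = _
      rw [Fin.snoc_last, Function.update_self, hSi, hS.tagged]
      have hb : bgVel ⟨n + 1, a⟩ (Fin.last n) (a.2 (Fin.last n)).1 = (a.2 (Fin.last n)).2.2
          + impulse (velAfter ⟨n + 1, a⟩ n) (a.2 (Fin.last n)).2.2 (a.2 (Fin.last n)).2.1 :=
        if_neg (lt_irrefl _)
      refine Prod.ext ?_ ?_
      · change shift _ _ = shift (pos ⟨n + 1, a⟩ (a.2 (Fin.last n)).1) (ε • ((a.2 (Fin.last n)).2.1 : Vel)
          + ((a.2 (Fin.last n)).1 - (a.2 (Fin.last n)).1) • _)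
        rw [sub_self, zero_smul, add_zero]
      · rw [hb, ← hv]
    | cast j =>
      change Function.update S.2 i _ _ = _
      rw [Fin.snoc_castSucc, Function.update_of_ne fun h => hi ⟨j, h⟩, hS.met]
      exact Prod.ext (bgPos_prune ε a j _ (hs j)) (bgVel_prune a j _)
  · rw [range_snoc, mem_insert_iff, not_or] at hk
    change Function.update S.2 i _ _ = _
    rw [Function.update_of_ne hk.1, hS.unmet k hk.2]

theorem recollisionFree_prune {t : ℝ} {a : Phase × (Fin (n + 1) → Mark)}
    (h : RecollisionFree ε t ⟨n + 1, a⟩)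
    (hs : ∀ j : Fin n, (a.2 j.castSucc).1 ≤ (a.2 (Fin.last n)).1) {s : ℝ} (hst : s ≤ t)
    (hsτ : s ≤ (a.2 (Fin.last n)).1) : RecollisionFree ε s ⟨n, (a.1, Fin.init a.2)⟩ := by
  intro j r hr hne
  have h1 := h (Fin.castSucc (n := n) j) r ⟨hr.1, hr.2.trans hst⟩ hne
  rw [← pos_prune a (hr.2.trans hsτ)] at h1
  exact h1.trans_eq (congrArg _ (bgPos_prune ε a j r (hs j)).symm)

theorem nonGrazing_prune {a : Phase × (Fin (n + 1) → Mark)} (h : NonGrazing ⟨n + 1, a⟩) :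
    NonGrazing ⟨n, (a.1, Fin.init a.2)⟩ := by
  intro j
  have h1 := h (Fin.castSucc (n := n) j)
  have h2 : velAfter ⟨n, (a.1, Fin.init a.2)⟩ j = velAfter ⟨n + 1, a⟩ j := velAfter_prune a j.2.le
  rw [h2]
  exact h1

theorem Evolves.nonneg {t : ℝ} {h : List Mark} {S : Config N} (hE : Evolves ε ω t h S) : 0 ≤ t := by
  induction hE with
  | start => exact le_rfl
  | free _ h _ ih => exact ih.trans h
  | collision _ _ _ h _ _ _ _ ih => exact ih.trans h.le

theorem torusDist_shift_smul_le (hε : 0 ≤ ε) (x : Torus) (ν : Sph) :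
    torusDist x (shift x (ε • (ν : Vel))) ≤ ε := by
  refine (torusDist_shift_self_le _ _).trans ?_
  rw [norm_smul, norm_eq_of_mem_sphere, mul_one, Real.norm_of_nonneg hε]

/-- Induction along the evolution. Carrying the state along (`IsState`) translates each condition of
the dynamics into one on the paths of the tree and on free flights from the initial state. -/
theorem Evolves.realizes (hε : 0 ≤ ε) {t : ℝ} {h : List Mark} {S : Config N} (hE : Evolves ε ω t h S)
    {a : Phase × (Fin n → Mark)} (hh : h = List.ofFn a.2) (hroot : a.1 = ω.1)
    (hmono : StrictMono fun j => (a.2 j).1) (hrec : RecollisionFree ε t ⟨n, a⟩) :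
    ∃ σ, Realizes ε t ω a σ ∧ IsState ε ω a σ t S := by
  induction hE generalizing n with
  | start hap =>
    cases n with
    | succ n => simp [List.ofFn_succ] at hh
    | zero =>
      have hS : IsState ε ω a Fin.elim0 0 ω := by
        refine ⟨?_, fun j => j.elim0, fun i _ => ?_⟩
        · rw [pos_zero_of_nonneg ⟨0, a⟩ fun j => Fin.elim0 j]
          change _ = (a.1.1, a.1.2)
          rw [hroot]
        · simp [flyOne, shift_zero]
      refine ⟨Fin.elim0, ⟨hroot, fun j => j.elim0, fun j => j.elim0, fun j => j.elim0, ?_⟩, hS⟩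
      intro i hi s hs
      obtain rfl : s = 0 := le_antisymm hs.2 hs.1
      exact (hS.apart_unmet_iff hi).1 (hap i)
  | @free s s' h S hE hss hap ih =>
    obtain ⟨σ, hR, hS⟩ := ih hh hroot hmono fun j r hr => hrec j r ⟨hr.1, hr.2.trans hss⟩
    have hts : ∀ j, (a.2 j).1 ≤ s := fun j => (hR.times j).2
    refine ⟨σ, ⟨hroot, hR.inj, fun j => ⟨(hR.times j).1, (hts j).trans hss⟩, hR.met, ?_⟩,
      hS.fly hts hss⟩
    intro i hi r hr
    by_cases hrs : r ≤ s
    · exact hR.unmet i hi r ⟨hr.1, hrs⟩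
    · push Not at hrs
      exact ((hS.fly hts hrs.le).apart_unmet_iff hi).1 (hap r ⟨hrs, hr.2⟩ i)
  | @collision s s' h S i ν hE hss hap hap' hpos hin ih =>
    cases n with
    | zero => simp at hh
    | succ n =>
      rw [List.ofFn_succ', List.concat_eq_append] at hh
      obtain ⟨hh1, hh2⟩ := List.append_inj' hh rfl
      have hlast : a.2 (Fin.last n) = (s', ν, (S.2 i).2) := by simpa using hh2.symm
      have hlt : (a.2 (Fin.last n)).1 = s' := by rw [hlast]
      have hm : ∀ j : Fin n, (a.2 j.castSucc).1 ≤ (a.2 (Fin.last n)).1 := fun j =>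
        (hmono (Fin.castSucc_lt_last j)).le
      obtain ⟨σ, hR, hS⟩ := ih (a := (a.1, Fin.init a.2)) hh1 hroot
        (fun j k hjk => hmono (Fin.castSucc_lt_castSucc_iff.2 hjk))
        (recollisionFree_prune hrec hm hss.le (hss.le.trans hlt.ge))
      have hts : ∀ j : Fin n, (Fin.init a.2 j).1 ≤ s := fun j => (hR.times j).2
      have hS' := hS.fly hts hss.le
      -- A particle already met cannot be the next collision partner: it would be at distance at
      -- most ε from the path at `s'`, which is a re-collision.
      have hi : i ∉ range σ := by
        rintro ⟨j, rfl⟩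
        have h1 := recollisionFree_prune hrec hm le_rfl hlt.ge j s' ⟨?_, le_rfl⟩ ((hts j).trans_lt hss).ne'
        · rw [← hS'.apart_met_iff, Apart, hpos] at h1
          exact absurd h1 (not_lt.2 (torusDist_shift_smul_le hε _ _))
        · exact (hR.times j).1.le.trans ((hts j).trans hss.le)
      have hstart : ω.2 i = startOf ε ⟨n + 1, a⟩ (Fin.last n) := by
        have h1 := hS'.unmet i hi
        have h2 : (S.2 i).2 = (ω.2 i).2 := by rw [hS.unmet i hi]; rfl
        have h3 : shift (ω.2 i).1 (s' • (ω.2 i).2)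
            = shift (pos ⟨n + 1, a⟩ s') (ε • (ν : Vel)) := by
          rw [← pos_prune a hlt.ge]
          rw [h1, hS'.tagged] at hpos
          exact hpos
        refine Prod.ext ?_ ?_
        · change _ = shift (pos ⟨n + 1, a⟩ (a.2 (Fin.last n)).1) (ε • ((a.2 (Fin.last n)).2.1 : Vel)
            - (a.2 (Fin.last n)).1 • (a.2 (Fin.last n)).2.2)
          rw [hlast, h2, sub_eq_add_neg, ← shift_shift, ← h3, shift_shift, add_neg_cancel, shift_zero]
        · change _ = (a.2 (Fin.last n)).2.2
          rw [hlast, h2]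
      have hC := IsState.collide (a := a) (by rw [hlt]; exact hS') hm hi hstart
      rw [hlast] at hC
      refine ⟨_, ⟨hroot, ?_, fun j => ?_, fun j => ?_, fun k hk => ?_⟩, hC⟩
      · exact Fin.snoc_injective_iff.2 ⟨hR.inj, hi⟩
      · induction j using Fin.lastCases with
        | last => rw [hlt]; exact ⟨hE.nonneg.trans_lt hss, le_rfl⟩
        | cast j => exact ⟨(hR.times j).1, (hts j).trans hss.le⟩
      · induction j using Fin.lastCases with
        | last => rw [Fin.snoc_last, hstart]
        | cast j => rw [Fin.snoc_castSucc, hR.met j]; exact startOf_prune ε a j (hm j)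
      · rw [range_snoc, mem_insert_iff, not_or] at hk
        intro r hr
        rw [← pos_prune a (hr.2.trans hlt.ge)]
        rcases le_or_gt r s with hrs | hrs
        · exact hR.unmet k hk.2 r ⟨hr.1, hrs⟩
        · refine ((hS.fly hts hrs.le).apart_unmet_iff hk.2).1 ?_
          rcases hr.2.lt_or_eq with h1 | rfl
          · exact hap r ⟨hrs, h1⟩ k
          · exact hap' k hk.1

theorem bgPos_of_met {a : Phase × (Fin n → Mark)} {j : Fin n} {i : Fin N}
    (h : ω.2 i = startOf ε ⟨n, a⟩ j) {r : ℝ} (hr : r ≤ (a.2 j).1) :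
    bgPos ε ⟨n, a⟩ j r = shift (ω.2 i).1 (r • (ω.2 i).2) := by
  rw [h]
  exact bgPos_eq_of_le ε ⟨n, a⟩ j hr

theorem notMem_range_init {σ : Fin (n + 1) → Fin N} (hσ : Function.Injective σ) :
    σ (Fin.last n) ∉ range (Fin.init σ) := by
  rintro ⟨j, hj⟩
  exact (Fin.castSucc_lt_last j).ne (hσ hj)

theorem mem_range_of_notMem_init {σ : Fin (n + 1) → Fin N} {i : Fin N}
    (hi : i ∉ range (Fin.init σ)) (hi' : i ≠ σ (Fin.last n)) : i ∉ range σ := by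
  rw [← Fin.snoc_init_self σ, range_snoc, mem_insert_iff, not_or]
  exact ⟨hi', hi⟩

/-- The partner of the removed collision now counts as unmet. Before its collision it flies freely,
and the absence of re-collisions keeps it outside. -/
theorem Realizes.prune {a : Phase × (Fin (n + 1) → Mark)} {σ : Fin (n + 1) → Fin N} {t : ℝ}
    (hR : Realizes ε t ω a σ) (hmono : StrictMono fun j => (a.2 j).1)
    (hrec : RecollisionFree ε t ⟨n + 1, a⟩) {s : ℝ} (hs : ∀ j : Fin n, (a.2 j.castSucc).1 ≤ s)
    (hs' : s < (a.2 (Fin.last n)).1) : Realizes ε s ω (a.1, Fin.init a.2) (Fin.init σ) := by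
  have hm : ∀ j : Fin n, (a.2 j.castSucc).1 ≤ (a.2 (Fin.last n)).1 := fun j =>
    (hmono (Fin.castSucc_lt_last j)).le
  have ht := (hR.times (Fin.last n)).2
  refine ⟨hR.root, fun j k h => Fin.castSucc_injective _ (hR.inj h),
    fun j => ⟨(hR.times j.castSucc).1, hs j⟩, fun j => ?_, fun i hi r hr => ?_⟩
  · exact (hR.met j.castSucc).trans (startOf_prune ε a j (hm j)).symm
  · have hrτ := hr.2.trans_lt hs'
    have h1 := pos_prune a hrτ.le
    change ε < torusDist (pos (CollisionTree.prune ⟨n + 1, a⟩) r) _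
    rw [h1]
    by_cases hi' : i = σ (Fin.last n)
    · rw [hi', ← bgPos_of_met (hR.met (Fin.last n)) hrτ.le]
      exact hrec (Fin.last n) r ⟨hr.1, hrτ.le.trans ht⟩ hrτ.ne
    · exact hR.unmet i (mem_range_of_notMem_init hi hi') r ⟨hr.1, hrτ.le.trans ht⟩

/-- Induction on the number of collisions: the pruned tree is run to its last collision, then follow
free flight, the final collision, and free flight up to t. Non-grazing supplies the sign required
for a collision. -/
theorem Realizes.evolves {a : Phase × (Fin n → Mark)} {σ : Fin n → Fin N} {t : ℝ} (ht : 0 ≤ t)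
    (hR : Realizes ε t ω a σ) (hmono : StrictMono fun j => (a.2 j).1)
    (hrec : RecollisionFree ε t ⟨n, a⟩) (hng : NonGrazing ⟨n, a⟩) :
    ∃ S, Evolves ε ω t (List.ofFn a.2) S ∧ IsState ε ω a σ t S := by
  induction n generalizing t with
  | zero =>
    have hS : IsState ε ω a σ 0 ω := by
      refine ⟨?_, fun j => j.elim0, fun i _ => ?_⟩
      · rw [pos_zero_of_nonneg ⟨0, a⟩ fun j => Fin.elim0 j]
        change _ = (a.1.1, a.1.2)
        rw [hR.root]
      · simp [flyOne, shift_zero]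
    have hσ : ∀ i, i ∉ range σ := by rintro i ⟨j, -⟩; exact j.elim0
    have hE : Evolves ε ω 0 (List.ofFn a.2) ω := by
      rw [List.ofFn_zero]
      exact Evolves.start fun i => (hS.apart_unmet_iff (hσ i)).2 (hR.unmet i (hσ i) 0 ⟨le_rfl, ht⟩)
    exact ⟨_, hE.free ht fun r hr i => ((hS.fly (fun j => j.elim0) hr.1.le).apart_unmet_iff (hσ i)).2
      (hR.unmet i (hσ i) r ⟨hr.1.le, hr.2⟩), hS.fly (fun j => j.elim0) ht⟩
  | succ n ih =>
    set τ := (a.2 (Fin.last n)).1 with hτ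
    have hτt : τ ≤ t := (hR.times (Fin.last n)).2
    -- The time s is that of the previous collision, or 0 if there is none.
    obtain ⟨s, hs0, hsτ, hs⟩ : ∃ s, 0 ≤ s ∧ s < τ ∧ ∀ j : Fin n, (a.2 j.castSucc).1 ≤ s := by
      cases n with
      | zero => exact ⟨0, le_rfl, (hR.times (Fin.last 0)).1, fun j => j.elim0⟩
      | succ n =>
        exact ⟨_, (hR.times (Fin.last n).castSucc).1.le, hmono (Fin.castSucc_lt_last _), fun j =>
          hmono.monotone (Fin.castSucc_le_castSucc_iff.2 (Fin.le_last j))⟩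
    have hm : ∀ j : Fin n, (a.2 j.castSucc).1 ≤ τ := fun j => (hs j).trans hsτ.le
    obtain ⟨S, hE, hS⟩ := ih hs0 (hR.prune hmono hrec hs hsτ)
      (fun j k hjk => hmono (Fin.castSucc_lt_castSucc_iff.2 hjk))
      (recollisionFree_prune hrec hm (hsτ.le.trans hτt) hsτ.le)
      (nonGrazing_prune hng)
    set i := σ (Fin.last n) with hi
    have hir : i ∉ range (Fin.init σ) := notMem_range_init hR.inj
    have hmet : ω.2 i = startOf ε ⟨n + 1, a⟩ (Fin.last n) := hR.met (Fin.last n)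
    have hap : ∀ r, s < r → r ≤ τ → ∀ k, (k = i → r < τ) → Apart ε (RayleighGas.fly (r - s) S) k := by
      intro r hr hrτ k hk
      have hSr := hS.fly hs hr.le
      have hpr : pos ⟨n, (a.1, Fin.init a.2)⟩ r = pos ⟨n + 1, a⟩ r := pos_prune a hrτ
      have hr0 : r ∈ Icc 0 t := ⟨hs0.trans hr.le, hrτ.trans hτt⟩
      by_cases hk' : k ∈ range (Fin.init σ)
      · obtain ⟨j, rfl⟩ := hk'
        rw [hSr.apart_met_iff]
        exact recollisionFree_prune hrec hm (hrτ.trans hτt) hrτ j r ⟨hr0.1, le_rfl⟩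
          ((hs j).trans_lt hr).ne'
      · rw [hSr.apart_unmet_iff hk', hpr]
        by_cases hki : k = i
        · rw [hki, ← bgPos_of_met hmet hrτ]
          exact hrec (Fin.last n) r hr0 (hk hki).ne
        · exact hR.unmet k (mem_range_of_notMem_init hk' hki) r hr0
    have hSτ := hS.fly hs hsτ.le
    have hSi : S.2 i = flyOne s (ω.2 i) := hS.unmet i hir
    have hw : (S.2 i).2 = (a.2 (Fin.last n)).2.2 := by rw [hSi, hmet]; rfl
    have hE' := Evolves.collision i (a.2 (Fin.last n)).2.1 hE hsτ
      (fun r hr j => hap r hr.1 hr.2.le j fun _ => hr.2)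
      (fun j hj => hap τ hsτ le_rfl j fun h => absurd h hj) (by
        rw [hSτ.unmet i hir, hSτ.tagged, hmet]
        have h1 : pos ⟨n, (a.1, Fin.init a.2)⟩ τ = pos ⟨n + 1, a⟩ τ := pos_prune a le_rfl
        simp only [h1]
        change shift (shift (pos ⟨n + 1, a⟩ τ) (_ - τ • _)) (τ • _) = _
        rw [shift_shift]
        congr 1
        exact sub_add_cancel _ _) (by
        have h1 := hng (Fin.last n)
        rw [real_inner_comm] at h1
        rw [hS.tagged, hw]
        have h2 : endVel ⟨n, (a.1, Fin.init a.2)⟩ = velAfter ⟨n + 1, a⟩ n := velAfter_prune a le_rfl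
        simp only [h2]
        exact h1)
    have hC := hSτ.collide (a := a) hm hir hmet
    rw [Fin.snoc_init_self] at hC
    have hl : List.ofFn (Fin.init a.2) ++ [(τ, (a.2 (Fin.last n)).2.1, (S.2 i).2)]
        = List.ofFn a.2 := by
      rw [List.ofFn_succ' a.2, List.concat_eq_append, hw]
      rfl
    rw [hl] at hE'
    have hτ' : ∀ j, (a.2 j).1 ≤ τ := fun j => hmono.monotone (Fin.le_last j)
    refine ⟨_, hE'.free hτt fun r hr k => ?_, hC.fly hτ' hτt⟩
    have hCr := hC.fly hτ' hr.1.le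
    have hr0 : r ∈ Icc 0 t := ⟨(hs0.trans hsτ.le).trans hr.1.le, hr.2⟩
    by_cases hk : k ∈ range σ
    · obtain ⟨j, rfl⟩ := hk
      rw [hCr.apart_met_iff]
      exact hrec j r hr0 ((hτ' j).trans_lt hr.1).ne'
    · rw [hCr.apart_unmet_iff hk]
      exact hR.unmet k hk r hr0

/-- This is where the dynamics disappears: on regular trees only conditions on independent initial
states remain. -/
theorem exists_evolves_iff {T t : ℝ} (hε : 0 ≤ ε) (ht : 0 ≤ t) {a : Phase × (Fin n → Mark)}
    (ha : (⟨n, a⟩ : CollisionTree) ∈ regularTrees T ε t) :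
    (a.1 = ω.1 ∧ ∃ S, Evolves ε ω t (List.ofFn a.2) S) ↔ ∃ σ, Realizes ε t ω a σ := by
  obtain ⟨⟨hmono, -⟩, hrec, -, hng⟩ := ha
  constructor
  · rintro ⟨hroot, S, hS⟩
    obtain ⟨σ, hσ, -⟩ := hS.realizes hε rfl hroot hmono hrec
    exact ⟨σ, hσ⟩
  · rintro ⟨σ, hσ⟩
    obtain ⟨S, hS, -⟩ := hσ.evolves ht hmono hrec hng
    exact ⟨hσ.root, S, hS⟩

end Dynamics

/-! ### The initial states which lead to a tree -/

section SplitLast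

variable (X : Type*) [MeasurableSpace X] (n : ℕ)

/-- Splitting off the last entry of a sequence. -/
def splitLast : Phase × (Fin (n + 1) → X) ≃ᵐ (Phase × (Fin n → X)) × X where
  toFun a := ((a.1, Fin.init a.2), a.2 (Fin.last n))
  invFun z := (z.1.1, Fin.snoc z.1.2 z.2)
  left_inv a := by simp
  right_inv z := by simp
  measurable_toFun := by
    have : Measurable fun a : Phase × (Fin (n + 1) → X) => (Fin.init a.2 : Fin n → X) :=
      measurable_pi_iff.2 fun j => (measurable_pi_apply _).comp measurable_snd
    exact (measurable_fst.prodMk this).prodMk ((measurable_pi_apply _).comp measurable_snd)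
  measurable_invFun := by
    refine (measurable_fst.comp measurable_fst).prodMk (measurable_pi_iff.2 fun j => ?_)
    induction j using Fin.lastCases with
    | last => simpa using measurable_snd
    | cast j =>
      simp only [Fin.snoc_castSucc]
      exact (measurable_pi_apply j).comp (measurable_snd.comp measurable_fst)

theorem measurePreserving_splitLast (μ : Measure Phase) [SigmaFinite μ] (ν : Measure X)
    [SigmaFinite ν] : MeasurePreserving (splitLast X n) (μ.prod (Measure.pi fun _ => ν))
      ((μ.prod (Measure.pi fun _ => ν)).prod ν) := by
  have h1 := measurePreserving_piFinSuccAbove (fun _ : Fin (n + 1) => ν) (Fin.last n)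
  have h2 := (Measure.measurePreserving_swap (μ := ν) (ν := Measure.pi fun _ : Fin n => ν)).comp h1
  have h3 := (MeasurePreserving.id μ).prod h2
  have h4 := (measurePreserving_prodAssoc μ (Measure.pi fun _ : Fin n => ν) ν).symm.comp h3
  convert h4 using 1
  funext a
  refine Prod.ext (Prod.ext rfl ?_) rfl
  funext j
  change a.2 j.castSucc = a.2 ((Fin.last n).succAbove j)
  rw [Fin.succAbove_last]

end SplitLast

/-- The marks of the collisions which can follow after a tree. -/
def nextMarks (ε : ℝ) (Ψ : CollisionTree) : Set Mark :=
  {m | Ψ.tau < m.1 ∧ 0 < inner ℝ (Ψ.endVel - m.2.2) (m.2.1 : Vel) ∧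
    ∀ θ ∈ Ico (0 : ℝ) 1, ε < torusDist (Ψ.pos (θ * m.1))
      (shift (flyBack ε Ψ.anchor Ψ.endVel m).1 ((θ * m.1) • m.2.2))}

/-- The trees in which no background particle is met before the time of its collision. -/
def consistentMarks (ε : ℝ) : (n : ℕ) → Set (Phase × (Fin n → Mark))
  | 0 => univ
  | n + 1 => {a | (a.1, Fin.init a.2) ∈ consistentMarks ε n ∧
      a.2 (Fin.last n) ∈ nextMarks ε ⟨n, (a.1, Fin.init a.2)⟩}

/-- The initial states of the tagged particle and of the background particles of the collisions. -/
def starts (ε : ℝ) : (n : ℕ) → Phase × (Fin n → Mark) → Phase × (Fin n → Phase)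
  | 0, a => (a.1, Fin.elim0)
  | n + 1, a => (a.1, Fin.snoc (α := fun _ => Phase) (starts ε n (a.1, Fin.init a.2)).2
      (flyBack ε (anchor ⟨n, (a.1, Fin.init a.2)⟩) (endVel ⟨n, (a.1, Fin.init a.2)⟩) (a.2 (Fin.last n))))

/-- The density of trees which comes from the initial states of their particles. -/
def treeWeight (f₀ g₀ : Phase → ℝ) (ε : ℝ) : (n : ℕ) → Phase × (Fin n → Mark) → ℝ
  | 0, a => f₀ a.1
  | n + 1, a => treeWeight f₀ g₀ ε n (a.1, Fin.init a.2) *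
      (ε ^ 2 * max (inner ℝ (endVel ⟨n, (a.1, Fin.init a.2)⟩ - (a.2 (Fin.last n)).2.2)
        ((a.2 (Fin.last n)).2.1 : Vel)) 0 *
      g₀ (flyBack ε (anchor ⟨n, (a.1, Fin.init a.2)⟩) (endVel ⟨n, (a.1, Fin.init a.2)⟩)
        (a.2 (Fin.last n))))

theorem starts_fst (ε : ℝ) {n : ℕ} (a : Phase × (Fin n → Mark)) : (starts ε n a).1 = a.1 := by
  cases n <;> rfl

theorem splitLast_starts (ε : ℝ) {n : ℕ} (a : Phase × (Fin (n + 1) → Mark)) :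
    splitLast Phase n (starts ε (n + 1) a) = (starts ε n (a.1, Fin.init a.2),
      flyBack ε (anchor ⟨n, (a.1, Fin.init a.2)⟩) (endVel ⟨n, (a.1, Fin.init a.2)⟩)
        (a.2 (Fin.last n))) := by
  refine Prod.ext (Prod.ext ?_ ?_) ?_
  · exact (starts_fst ε (a.1, Fin.init a.2)).symm
  · exact Fin.init_snoc (α := fun _ => Phase) _ _
  · exact Fin.snoc_last (α := fun _ => Phase) _ _

theorem times_le_tau_of_consistent {ε : ℝ} {n : ℕ} {a : Phase × (Fin n → Mark)}
    (ha : a ∈ consistentMarks ε n) :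
    0 ≤ tau ⟨n, a⟩ ∧ ∀ j, (a.2 j).1 ≤ tau ⟨n, a⟩ := by
  induction n with
  | zero => exact ⟨le_rfl, fun j => j.elim0⟩
  | succ n ih =>
    obtain ⟨h1, h2⟩ := ih ha.1
    have h3 : tau ⟨n, (a.1, Fin.init a.2)⟩ < (a.2 (Fin.last n)).1 := ha.2.1
    refine ⟨(h1.trans_lt h3).le, fun j => ?_⟩
    induction j using Fin.lastCases with
    | last => exact le_rfl
    | cast j => exact (h2 j).trans h3.le

theorem starts_eq_startOf {ε : ℝ} {n : ℕ} {a : Phase × (Fin n → Mark)}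
    (ha : a ∈ consistentMarks ε n) : starts ε n a = (a.1, fun j => startOf ε ⟨n, a⟩ j) := by
  induction n with
  | zero => exact Prod.ext rfl (funext fun j => j.elim0)
  | succ n ih =>
    have h1 : ∀ j : Fin n, (a.2 j.castSucc).1 ≤ (a.2 (Fin.last n)).1 := fun j =>
      ((times_le_tau_of_consistent ha.1).2 j).trans ha.2.1.le
    refine Prod.ext rfl (funext fun j => ?_)
    rw [starts, ih ha.1]
    induction j using Fin.lastCases with
    | last => exact (Fin.snoc_last (α := fun _ => Phase) _ _).trans (startOf_last ε a h1).symm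
    | cast j =>
      exact (Fin.snoc_castSucc (α := fun _ => Phase) _ _ j).trans (startOf_prune ε a j (h1 j))

/-- The hit described by a mark is the first contact after all earlier times, so the initial state
determines the time: a contact at s < s' violates the condition of the mark at s'. At equal times
the directions agree because 2ε < 1. -/
theorem nextMarks_injOn {ε : ℝ} (hε : 0 < ε) (hε' : ε ≤ 1 / 8) {Ψ : CollisionTree}
    (h0 : 0 ≤ Ψ.tau) (ht : ∀ j, Ψ.time j ≤ Ψ.tau) :
    InjOn (flyBack ε Ψ.anchor Ψ.endVel) (nextMarks ε Ψ) := by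
  have key : ∀ m ∈ nextMarks ε Ψ, ∀ m' ∈ nextMarks ε Ψ,
      flyBack ε Ψ.anchor Ψ.endVel m = flyBack ε Ψ.anchor Ψ.endVel m' → m'.1 ≤ m.1 := by
    rintro ⟨s, ν, w⟩ ⟨hs, -, -⟩ ⟨s', ν', w'⟩ ⟨hs', -, hd⟩ he
    obtain rfl : w = w' := congrArg Prod.snd he
    by_contra hlt
    push Not at hlt
    simp only at hs hs' hd hlt
    have hs0 : 0 < s' := (h0.trans_lt hs').trans_le le_rfl
    have h1 := hd (s / s') ⟨by have := h0.trans_lt hs; positivity, (div_lt_one hs0).2 hlt⟩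
    rw [div_mul_cancel₀ _ hs0.ne', ← he, shift_flyBack,
      pos_eq_anchor Ψ fun j => (ht j).trans hs.le] at h1
    refine absurd h1 (not_lt.2 ?_)
    have h2 := torusDist_shift_smul_le hε.le (shift Ψ.anchor (s • Ψ.endVel)) ν
    rw [shift_shift] at h2
    have h3 : s • Ψ.endVel + ε • (ν : Vel) = s • (Ψ.endVel - w) + ε • (ν : Vel) + s • w := by module
    rwa [h3] at h2
  intro m hm m' hm' he
  have ht' : m.1 = m'.1 := le_antisymm (key _ hm' _ hm he.symm) (key _ hm _ hm' he)
  obtain ⟨s, ν, w⟩ := m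
  obtain ⟨s', ν', w'⟩ := m'
  obtain rfl : s = s' := ht'
  obtain rfl : w = w' := congrArg Prod.snd he
  have h1 := congrArg Prod.fst he
  simp only [flyBack] at h1
  have hn : ‖ε • (ν : Vel) - ε • (ν' : Vel)‖ < 1 := by
    refine (norm_sub_le _ _).trans_lt ?_
    rw [norm_smul, norm_smul, norm_eq_of_mem_sphere, norm_eq_of_mem_sphere, Real.norm_of_nonneg hε.le]
    linarith
  rw [shift_eq_shift_iff_of_norm_lt (by rwa [add_sub_add_left_eq_sub]), add_right_inj] at h1
  rw [Subtype.ext (smul_right_injective Vel hε.ne' h1)]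

theorem starts_injOn {ε : ℝ} (hε : 0 < ε) (hε' : ε ≤ 1 / 8) (n : ℕ) :
    InjOn (starts ε n) (consistentMarks ε n) := by
  induction n with
  | zero =>
    intro a _ b _ h
    exact Prod.ext (congrArg (fun y => y.1) h : _) (funext fun j => j.elim0)
  | succ n ih =>
    intro a ha b hb h
    have h1 := congrArg (splitLast Phase n) h
    rw [splitLast_starts, splitLast_starts, Prod.mk.injEq] at h1
    have h2 := ih ha.1 hb.1 h1.1
    refine (splitLast Mark n).injective (Prod.ext h2 ?_)
    have h3 := h1.2
    rw [← h2] at h3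
    obtain ⟨h4, h5⟩ := times_le_tau_of_consistent ha.1
    refine nextMarks_injOn hε hε' h4 h5 ha.2 ?_ h3
    rw [h2]
    exact hb.2

/-! ### Measurability -/

theorem measurable_endVel {X : Type*} [MeasurableSpace X] {n : ℕ} {a : X → Phase × (Fin n → Mark)}
    (ha : Measurable a) : Measurable fun x => endVel ⟨n, a x⟩ := measurable_velAfter ha n

theorem measurable_flyBack_tree (ε : ℝ) (n : ℕ) :
    Measurable fun z : (Phase × (Fin n → Mark)) × Mark =>
      flyBack ε (anchor ⟨n, z.1⟩) (endVel ⟨n, z.1⟩) z.2 := by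
  have h1 := measurable_endVel (n := n) (measurable_fst (α := Phase × (Fin n → Mark)) (β := Mark))
  unfold flyBack
  exact (measurable_shift_comp (measurable_anchor measurable_fst) (by fun_prop)).prodMk (by fun_prop)

theorem measurable_tau (n : ℕ) :
    Measurable fun a : Phase × (Fin n → Mark) => tau ⟨n, a⟩ := by
  cases n with
  | zero => exact measurable_const
  | succ n =>
    change Measurable fun a : Phase × (Fin (n + 1) → Mark) => (a.2 (Fin.last n)).1
    fun_prop

theorem measurableSet_nextMarks (ε : ℝ) (n : ℕ) :
    MeasurableSet {z : (Phase × (Fin n → Mark)) × Mark | z.2 ∈ nextMarks ε ⟨n, z.1⟩} := by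
  have h1 := measurable_endVel (n := n) (measurable_fst (α := Phase × (Fin n → Mark)) (β := Mark))
  have h2 := measurable_flyBack_tree ε n
  have h3 : Measurable fun z : (Phase × (Fin n → Mark)) × Mark =>
      (inner ℝ (endVel ⟨n, z.1⟩ - z.2.2.2) (z.2.2.1 : Vel) : ℝ) := by fun_prop
  refine MeasurableSet.inter (measurableSet_lt ((measurable_tau n).comp measurable_fst)
      (measurable_fst.comp measurable_snd))
    (MeasurableSet.inter (measurableSet_lt measurable_const h3) ?_)
  -- The fraction θ of the hit time ranges over a set independent of the mark, as the measurability
  -- criterion requires.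
  refine measurableSet_forall_lt (d := fun (z : (Phase × (Fin n → Mark)) × Mark) θ =>
    torusDist (pos ⟨n, z.1⟩ (θ * z.2.1))
      (shift (flyBack ε (anchor ⟨n, z.1⟩) (endVel ⟨n, z.1⟩) z.2).1 ((θ * z.2.1) • z.2.2.2)))
    (fun θ => ?_) (fun z => ?_) ?_ ε
  · exact measurable_torusDist_comp (measurable_pos measurable_fst (by fun_prop))
      (measurable_shift_comp h2.fst (by fun_prop))
  · exact continuous_torusDist_comp ((continuous_pos _).comp (by fun_prop))
      (continuous_shift_comp continuous_const (by fun_prop))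
  · rw [← Ici_inter_Iio]
    exact isClosed_Ici.isLocallyClosed.inter isOpen_Iio.isLocallyClosed

theorem measurableSet_consistentMarks (ε : ℝ) (n : ℕ) : MeasurableSet (consistentMarks ε n) := by
  induction n with
  | zero => exact MeasurableSet.univ
  | succ n ih =>
    exact MeasurableSet.inter ((splitLast Mark n).measurable.fst ih)
      ((splitLast Mark n).measurable (measurableSet_nextMarks ε n))

theorem measurable_starts (ε : ℝ) (n : ℕ) : Measurable (starts ε n) := by
  induction n with
  | zero => exact measurable_fst.prodMk (measurable_pi_iff.2 fun j => j.elim0)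
  | succ n ih =>
    have h : starts ε (n + 1) = fun a => (splitLast Phase n).symm
        (starts ε n (splitLast Mark n a).1, flyBack ε (anchor ⟨n, (splitLast Mark n a).1⟩)
          (endVel ⟨n, (splitLast Mark n a).1⟩) (splitLast Mark n a).2) := by
      funext a
      rw [← MeasurableEquiv.symm_apply_apply (splitLast Phase n) (starts ε (n + 1) a),
        splitLast_starts]
      rfl
    rw [h]
    have hs := (splitLast Mark n).measurable
    exact (splitLast Phase n).symm.measurable.comp
      ((ih.comp hs.fst).prodMk ((measurable_flyBack_tree ε n).comp hs))

theorem measurable_treeWeight {f₀ g₀ : Phase → ℝ} (hf : Measurable f₀) (hg : Measurable g₀) (ε : ℝ)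
    (n : ℕ) : Measurable (treeWeight f₀ g₀ ε n) := by
  induction n with
  | zero => exact hf.comp measurable_fst
  | succ n ih =>
    have hs := (splitLast Mark n).measurable
    have h1 : Measurable fun z : (Phase × (Fin n → Mark)) × Mark =>
        ε ^ 2 * max (inner ℝ (endVel ⟨n, z.1⟩ - z.2.2.2) (z.2.2.1 : Vel)) 0 *
          g₀ (flyBack ε (anchor ⟨n, z.1⟩) (endVel ⟨n, z.1⟩) z.2) := by
      have h2 := measurable_endVel (n := n) (measurable_fst (α := Phase × (Fin n → Mark)) (β := Mark))
      have h3 : Measurable fun z : (Phase × (Fin n → Mark)) × Mark =>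
        g₀ (flyBack ε (anchor ⟨n, z.1⟩) (endVel ⟨n, z.1⟩) z.2) := hg.comp (measurable_flyBack_tree ε n)
      have h4 : Measurable fun z : (Phase × (Fin n → Mark)) × Mark =>
        ε ^ 2 * max (inner ℝ (endVel ⟨n, z.1⟩ - z.2.2.2) (z.2.2.1 : Vel)) 0 := by fun_prop
      exact h4.mul h3
    have h5 : treeWeight f₀ g₀ ε (n + 1) = fun a => treeWeight f₀ g₀ ε n (splitLast Mark n a).1 *
        (fun z : (Phase × (Fin n → Mark)) × Mark =>
          ε ^ 2 * max (inner ℝ (endVel ⟨n, z.1⟩ - z.2.2.2) (z.2.2.1 : Vel)) 0 *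
          g₀ (flyBack ε (anchor ⟨n, z.1⟩) (endVel ⟨n, z.1⟩) z.2)) (splitLast Mark n a) := rfl
    rw [h5]
    exact (ih.comp hs.fst).mul (h1.comp hs)

theorem treeWeight_nonneg {f₀ g₀ : Phase → ℝ} (hf : ∀ q, 0 ≤ f₀ q) (hg : ∀ q, 0 ≤ g₀ q) (ε : ℝ)
    {n : ℕ} (a : Phase × (Fin n → Mark)) : 0 ≤ treeWeight f₀ g₀ ε n a := by
  induction n with
  | zero => exact hf _
  | succ n ih =>
    exact mul_nonneg (ih _) (mul_nonneg (mul_nonneg (sq_nonneg _) (le_max_right _ _)) (hg _))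

/-! ### Change of variables from initial states to trees -/

theorem lintegral_lawOf (g : Phase → ℝ) (hg : Measurable g) (F : Phase → ENNReal) (hF : Measurable F) :
    ∫⁻ q, F q ∂lawOf g = ∫⁻ q, ENNReal.ofReal (g q) * F q :=
  lintegral_withDensity_eq_lintegral_mul _ hg.ennreal_ofReal hF

theorem lintegral_flyBack_lawOf {g : Phase → ℝ} (hg : Measurable g) (a : Torus) (v : Vel) {ε : ℝ}
    (hε : 0 < ε) {S : Set Mark} (hS : MeasurableSet S)
    (hpos : ∀ m ∈ S, 0 < m.1 ∧ 0 < inner ℝ (v - m.2.2) (m.2.1 : Vel))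
    (hinj : InjOn (flyBack ε a v) S) (F : Phase → ENNReal) (hF : Measurable F) :
    ∫⁻ q in flyBack ε a v '' S, F q ∂lawOf g
      = ∫⁻ m in S, ENNReal.ofReal (ε ^ 2 * max (inner ℝ (v - m.2.2) (m.2.1 : Vel)) 0 *
          g (flyBack ε a v m)) * F (flyBack ε a v m) ∂markMeasure := by
  have himg : MeasurableSet (flyBack ε a v '' S) :=
    hS.image_of_measurable_injOn (continuous_flyBack ε a v).measurable hinj
  rw [← lintegral_indicator himg, lintegral_lawOf g hg _ (hF.indicator himg)]
  have h1 := lintegral_flux a v hε hS hpos hinj (fun q => ENNReal.ofReal (g q) * F q)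
    (hg.ennreal_ofReal.mul hF)
  rw [← lintegral_indicator himg] at h1
  refine Eq.trans (lintegral_congr fun q => ?_) (h1.symm.trans ?_)
  · by_cases hq : q ∈ flyBack ε a v '' S
    · rw [indicator_of_mem hq, indicator_of_mem hq]
    · rw [indicator_of_notMem hq, indicator_of_notMem hq, mul_zero]
  · refine lintegral_congr fun m => ?_
    rw [ENNReal.ofReal_mul (mul_nonneg (sq_nonneg _) (le_max_right _ _)), mul_assoc]
    rfl

/-- The law of the initial states of the tagged particle and of `n` background particles. -/
def startLaw (f₀ g₀ : Phase → ℝ) (n : ℕ) : Measure (Phase × (Fin n → Phase)) :=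
  (lawOf f₀).prod (Measure.pi fun _ => lawOf g₀)

/-- Lebesgue measure on trees with `n` collisions. -/
def marksMeasure (n : ℕ) : Measure (Phase × (Fin n → Mark)) :=
  (volume : Measure Phase).prod (Measure.pi fun _ => markMeasure)

theorem mem_consistentMarks_symm (ε : ℝ) {n : ℕ} (b : Phase × (Fin n → Mark)) (m : Mark) :
    (splitLast Mark n).symm (b, m) ∈ consistentMarks ε (n + 1)
      ↔ b ∈ consistentMarks ε n ∧ m ∈ nextMarks ε ⟨n, b⟩ := by
  change (splitLast Mark n ((splitLast Mark n).symm (b, m))).1 ∈ consistentMarks ε n ∧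
    (splitLast Mark n ((splitLast Mark n).symm (b, m))).2 ∈
      nextMarks ε ⟨n, (splitLast Mark n ((splitLast Mark n).symm (b, m))).1⟩ ↔ _
  rw [MeasurableEquiv.apply_symm_apply]

theorem starts_symm (ε : ℝ) {n : ℕ} (b : Phase × (Fin n → Mark)) (m : Mark) :
    starts ε (n + 1) ((splitLast Mark n).symm (b, m))
      = (splitLast Phase n).symm (starts ε n b, flyBack ε (anchor ⟨n, b⟩) (endVel ⟨n, b⟩) m) := by
  rw [MeasurableEquiv.eq_symm_apply, splitLast_starts]
  change (starts ε n (splitLast Mark n ((splitLast Mark n).symm (b, m))).1,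
    flyBack ε (anchor ⟨n, (splitLast Mark n ((splitLast Mark n).symm (b, m))).1⟩)
      (endVel ⟨n, (splitLast Mark n ((splitLast Mark n).symm (b, m))).1⟩)
      (splitLast Mark n ((splitLast Mark n).symm (b, m))).2) = _
  rw [MeasurableEquiv.apply_symm_apply]

theorem treeWeight_symm (f₀ g₀ : Phase → ℝ) (ε : ℝ) {n : ℕ} (b : Phase × (Fin n → Mark)) (m : Mark) :
    treeWeight f₀ g₀ ε (n + 1) ((splitLast Mark n).symm (b, m)) = treeWeight f₀ g₀ ε n b *
      (ε ^ 2 * max (inner ℝ (endVel ⟨n, b⟩ - m.2.2) (m.2.1 : Vel)) 0 *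
        g₀ (flyBack ε (anchor ⟨n, b⟩) (endVel ⟨n, b⟩) m)) := by
  change treeWeight f₀ g₀ ε n (splitLast Mark n ((splitLast Mark n).symm (b, m))).1 *
    (ε ^ 2 * max (inner ℝ (endVel ⟨n, (splitLast Mark n ((splitLast Mark n).symm (b, m))).1⟩ -
      (splitLast Mark n ((splitLast Mark n).symm (b, m))).2.2.2)
      ((splitLast Mark n ((splitLast Mark n).symm (b, m))).2.2.1 : Vel)) 0 *
      g₀ (flyBack ε (anchor ⟨n, (splitLast Mark n ((splitLast Mark n).symm (b, m))).1⟩)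
      (endVel ⟨n, (splitLast Mark n ((splitLast Mark n).symm (b, m))).1⟩)
      (splitLast Mark n ((splitLast Mark n).symm (b, m))).2)) = _
  rw [MeasurableEquiv.apply_symm_apply]

instance : StandardBorelSpace Torus := by infer_instance

instance : StandardBorelSpace Vel := by infer_instance

instance : StandardBorelSpace Phase := by infer_instance

instance : StandardBorelSpace Mark := by infer_instance

instance (n : ℕ) : StandardBorelSpace (Phase × (Fin n → Mark)) := by infer_instance

instance (n : ℕ) : StandardBorelSpace (Phase × (Fin n → Phase)) := by infer_instance

theorem measurableSet_starts_image {ε : ℝ} (hε : 0 < ε) (hε' : ε ≤ 1 / 8) {n : ℕ}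
    {A : Set (Phase × (Fin n → Mark))} (hA : MeasurableSet A) (hAc : A ⊆ consistentMarks ε n) :
    MeasurableSet (starts ε n '' A) :=
  hA.image_of_measurable_injOn (measurable_starts ε n) ((starts_injOn hε hε' n).mono hAc)

/-- Induction on the number of collisions. Given the first n marks, the last initial state varies
along `flyBack` from the path of the truncated tree, so the flux formula handles the last variable
and the induction hypothesis the others. -/
theorem lintegral_starts {f₀ g₀ : Phase → ℝ} (hf : Measurable f₀) (hg : Measurable g₀)
    (hf0 : ∀ q, 0 ≤ f₀ q) (hg0 : ∀ q, 0 ≤ g₀ q)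
    {ε : ℝ} (hε : 0 < ε) (hε' : ε ≤ 1 / 8) (n : ℕ) (F : Phase × (Fin n → Phase) → ENNReal)
    (hF : Measurable F) :
    ∫⁻ y in starts ε n '' consistentMarks ε n, F y ∂startLaw f₀ g₀ n
      = ∫⁻ a in consistentMarks ε n, ENNReal.ofReal (treeWeight f₀ g₀ ε n a) * F (starts ε n a)
          ∂marksMeasure n := by
  induction n with
  | zero =>
    have h1 : starts ε 0 '' consistentMarks ε 0 = univ :=
      eq_univ_of_forall fun y => ⟨(y.1, Fin.elim0), trivial, Prod.ext rfl (funext fun j => j.elim0)⟩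
    have h2 : Measurable fun q : Phase => F (q, Fin.elim0) := hF.comp (by fun_prop)
    have h3 : Measurable fun a => ENNReal.ofReal (treeWeight f₀ g₀ ε 0 a) * F (starts ε 0 a) :=
      (measurable_treeWeight hf hg ε 0).ennreal_ofReal.mul (hF.comp (measurable_starts ε 0))
    rw [h1, consistentMarks, setLIntegral_univ, setLIntegral_univ, startLaw, marksMeasure,
      lintegral_prod _ hF.aemeasurable, lintegral_prod _ h3.aemeasurable,
      Measure.pi_of_empty _ Fin.elim0, Measure.pi_of_empty _ Fin.elim0]
    simp only [lintegral_dirac]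
    rw [lintegral_lawOf f₀ hf _ h2]
    rfl
  | succ n ih =>
    set Θ := starts ε n
    set B := consistentMarks ε n with hB
    have hBm : MeasurableSet B := measurableSet_consistentMarks ε n
    have hB'm := measurableSet_consistentMarks ε (n + 1)
    have hI := measurableSet_starts_image hε hε' hB'm subset_rfl
    have hΘinj := starts_injOn hε hε' n
    set H : (Phase × (Fin n → Phase)) × Phase → ENNReal := fun z =>
      (starts ε (n + 1) '' consistentMarks ε (n + 1)).indicator F ((splitLast Phase n).symm z) with hH
    have hHm : Measurable H := (hF.indicator hI).comp (splitLast Phase n).symm.measurable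
    set R : (Phase × (Fin n → Mark)) × Mark → ENNReal := fun z =>
      (consistentMarks ε (n + 1)).indicator (fun a => ENNReal.ofReal (treeWeight f₀ g₀ ε (n + 1) a) *
        F (starts ε (n + 1) a)) ((splitLast Mark n).symm z) with hR
    have hRm : Measurable R := by
      refine (Measurable.indicator ?_ hB'm).comp (splitLast Mark n).symm.measurable
      exact (measurable_treeWeight hf hg ε _).ennreal_ofReal.mul (hF.comp (measurable_starts ε _))
    have hKm : Measurable fun y => ∫⁻ q, H (y, q) ∂lawOf g₀ := hHm.lintegral_prod_right'
    have hmem : ∀ b m, b ∈ B → (flyBack ε (anchor ⟨n, b⟩) (endVel ⟨n, b⟩) m ∈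
        flyBack ε (anchor ⟨n, b⟩) (endVel ⟨n, b⟩) '' nextMarks ε ⟨n, b⟩) →
        (splitLast Phase n).symm (Θ b, flyBack ε (anchor ⟨n, b⟩) (endVel ⟨n, b⟩) m) ∈
          starts ε (n + 1) '' consistentMarks ε (n + 1) := by
      rintro b m hb ⟨m', hm', he⟩
      rw [← he, ← starts_symm]
      exact mem_image_of_mem _ ((mem_consistentMarks_symm ε b m').2 ⟨hb, hm'⟩)
    have himg : ∀ y q, (splitLast Phase n).symm (y, q) ∈ starts ε (n + 1) '' consistentMarks ε (n + 1) ↔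
        ∃ b ∈ B, Θ b = y ∧ ∃ m ∈ nextMarks ε ⟨n, b⟩,
          flyBack ε (anchor ⟨n, b⟩) (endVel ⟨n, b⟩) m = q := by
      intro y q
      constructor
      · rintro ⟨a, ha, he⟩
        rw [MeasurableEquiv.eq_symm_apply, splitLast_starts, Prod.mk.injEq] at he
        exact ⟨_, ha.1, he.1, _, ha.2, he.2⟩
      · rintro ⟨b, hb, rfl, m, hm, rfl⟩
        exact hmem b m hb ⟨m, hm, rfl⟩
    have hL : ∀ y ∉ Θ '' B, ∫⁻ q, H (y, q) ∂lawOf g₀ = 0 := by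
      intro y hy
      rw [← lintegral_zero (μ := lawOf g₀)]
      refine lintegral_congr fun q => ?_
      refine indicator_of_notMem (fun h => hy ?_) _
      obtain ⟨b, hb, hby, -⟩ := (himg y q).1 h
      exact ⟨b, hb, hby⟩
    have hR0 : ∀ b ∉ B, ∫⁻ m, R (b, m) ∂markMeasure = 0 := by
      intro b hb
      rw [← lintegral_zero (μ := markMeasure)]
      refine lintegral_congr fun m => ?_
      exact indicator_of_notMem (fun h => hb ((mem_consistentMarks_symm ε b m).1 h).1) _
    have hmain : ∀ b ∈ B, ENNReal.ofReal (treeWeight f₀ g₀ ε n b) * ∫⁻ q, H (Θ b, q) ∂lawOf g₀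
        = ∫⁻ m, R (b, m) ∂markMeasure := by
      intro b hb
      obtain ⟨h0, ht⟩ := times_le_tau_of_consistent hb
      set fb := flyBack ε (anchor ⟨n, b⟩) (endVel ⟨n, b⟩) with hfb
      have hfbm : Measurable fb := (continuous_flyBack ε _ _).measurable
      have hSm : MeasurableSet (nextMarks ε ⟨n, b⟩) :=
        (measurable_const.prodMk measurable_id : Measurable fun m : Mark => (b, m))
          (measurableSet_nextMarks ε n)
      have hinj := nextMarks_injOn hε hε' (Ψ := ⟨n, b⟩) h0 ht
      have hFb : Measurable fun q => F ((splitLast Phase n).symm (Θ b, q)) :=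
        hF.comp ((splitLast Phase n).symm.measurable.comp (measurable_const.prodMk measurable_id))
      -- Since `starts` is injective on consistent marks, the slice over `Θ b` comes from extensions
      -- of b alone.
      have h1 : ∫⁻ q, H (Θ b, q) ∂lawOf g₀
          = ∫⁻ q in fb '' nextMarks ε ⟨n, b⟩, F ((splitLast Phase n).symm (Θ b, q)) ∂lawOf g₀ := by
        rw [← lintegral_indicator (hSm.image_of_measurable_injOn hfbm hinj)]
        refine lintegral_congr fun q => ?_
        have h2 : (splitLast Phase n).symm (Θ b, q) ∈ starts ε (n + 1) '' consistentMarks ε (n + 1)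
            ↔ q ∈ fb '' nextMarks ε ⟨n, b⟩ := by
          rw [himg]
          constructor
          · rintro ⟨b', hb', he, m, hm, rfl⟩
            obtain rfl := hΘinj hb' hb he
            exact ⟨m, hm, rfl⟩
          · rintro ⟨m, hm, rfl⟩
            exact ⟨b, hb, rfl, m, hm, rfl⟩
        by_cases hq : q ∈ fb '' nextMarks ε ⟨n, b⟩
        · rw [indicator_of_mem hq]; exact indicator_of_mem (h2.2 hq) _
        · rw [indicator_of_notMem hq]; exact indicator_of_notMem (fun h => hq (h2.1 h)) _
      rw [h1, lintegral_flyBack_lawOf hg _ _ hε hSm (fun m hm => ⟨h0.trans_lt hm.1, hm.2.1⟩) hinj _ hFb,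
        ← lintegral_const_mul' _ _ ENNReal.ofReal_ne_top, ← lintegral_indicator hSm]
      refine lintegral_congr fun m => ?_
      by_cases hm : m ∈ nextMarks ε ⟨n, b⟩
      · rw [indicator_of_mem hm]
        refine Eq.trans ?_ (indicator_of_mem ((mem_consistentMarks_symm ε b m).2 ⟨hb, hm⟩) _).symm
        rw [starts_symm, treeWeight_symm, ENNReal.ofReal_mul (treeWeight_nonneg hf0 hg0 ε b)]
        exact (mul_assoc _ _ _).symm
      · rw [indicator_of_notMem hm]
        exact (indicator_of_notMem (fun h => hm ((mem_consistentMarks_symm ε b m).1 h).2) _).symm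
    have hΘB : MeasurableSet (Θ '' B) := measurableSet_starts_image hε hε' hBm subset_rfl
    calc ∫⁻ y in starts ε (n + 1) '' consistentMarks ε (n + 1), F y ∂startLaw f₀ g₀ (n + 1)
        = ∫⁻ z, H z ∂((startLaw f₀ g₀ n).prod (lawOf g₀)) := by
          rw [← lintegral_indicator hI]
          exact ((measurePreserving_splitLast Phase n (lawOf f₀) (lawOf g₀)).symm.lintegral_comp
            (hF.indicator hI)).symm
      _ = ∫⁻ y, ∫⁻ q, H (y, q) ∂lawOf g₀ ∂startLaw f₀ g₀ n := lintegral_prod _ hHm.aemeasurable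
      _ = ∫⁻ y in Θ '' B, ∫⁻ q, H (y, q) ∂lawOf g₀ ∂startLaw f₀ g₀ n := by
          rw [← lintegral_indicator hΘB]
          refine lintegral_congr fun y => ?_
          by_cases hy : y ∈ Θ '' B
          · rw [indicator_of_mem hy]
          · rw [indicator_of_notMem hy, hL y hy]
      _ = ∫⁻ b in B, ∫⁻ m, R (b, m) ∂markMeasure ∂marksMeasure n := by
          rw [ih _ hKm]
          exact setLIntegral_congr_fun hBm hmain
      _ = ∫⁻ b, ∫⁻ m, R (b, m) ∂markMeasure ∂marksMeasure n := by
          rw [← lintegral_indicator hBm]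
          refine lintegral_congr fun b => ?_
          by_cases hb : b ∈ B
          · rw [indicator_of_mem hb]
          · rw [indicator_of_notMem hb, hR0 b hb]
      _ = ∫⁻ z, R z ∂((marksMeasure n).prod markMeasure) := (lintegral_prod _ hRm.aemeasurable).symm
      _ = _ := by
          rw [← lintegral_indicator hB'm]
          exact (measurePreserving_splitLast Mark n volume markMeasure).symm.lintegral_comp
            (Measurable.indicator ((measurable_treeWeight hf hg ε _).ennreal_ofReal.mul
              (hF.comp (measurable_starts ε _))) hB'm)

/-! ### The probability that given background particles are met -/

section Events

variable {N n : ℕ} {f₀ g₀ : Phase → ℝ}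

/-- The particles `σ 0, σ 1, …`, and the others. -/
def splitMet (σ : Fin n → Fin N) (ω : Config N) :
    (Phase × (Fin n → Phase)) × ({i // i ∉ range σ} → Phase) :=
  ((ω.1, fun j => ω.2 (σ j)), fun i => ω.2 i)

theorem measurable_splitMet (σ : Fin n → Fin N) : Measurable (splitMet σ) := by
  unfold splitMet
  fun_prop

theorem measurePreserving_splitMet (f₀ g₀ : Phase → ℝ) {σ : Fin n → Fin N}
    (hσ : Function.Injective σ) : MeasurePreserving (splitMet σ) (initialLaw f₀ g₀ N)
      ((startLaw f₀ g₀ n).prod (Measure.pi fun _ => lawOf g₀)) := by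
  classical
  have h1 : MeasurePreserving
      (MeasurableEquiv.piEquivPiSubtypeProd (fun _ : Fin N => Phase) fun i => i ∈ range σ)
      (Measure.pi fun _ => lawOf g₀) ((Measure.pi fun _ : {i // i ∈ range σ} => lawOf g₀).prod
        (Measure.pi fun _ : {i // i ∉ range σ} => lawOf g₀)) := by
    convert measurePreserving_piEquivPiSubtypeProd (fun _ : Fin N => lawOf g₀) (fun i => i ∈ range σ)
  have h2 := (measurePreserving_piCongrLeft (fun _ : {i // i ∈ range σ} => lawOf g₀)
    (Equiv.ofInjective σ hσ)).symm
  have h3 := (h2.prod (MeasurePreserving.id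
    (Measure.pi fun _ : {i // i ∉ range σ} => lawOf g₀))).comp h1
  have h4 := (MeasurePreserving.id (lawOf f₀)).prod h3
  have h5 := (measurePreserving_prodAssoc (lawOf f₀) (Measure.pi fun _ : Fin n => lawOf g₀)
    (Measure.pi fun _ : {i // i ∉ range σ} => lawOf g₀)).symm.comp h4
  exact h5

/-- The initial states for which the tree lies in `A` and the particles met are `σ 0, σ 1, …`. -/
def event (ε t : ℝ) (A : Set (Phase × (Fin n → Mark))) (σ : Fin n → Fin N) : Set (Config N) :=
  {ω | ∃ a ∈ A, Realizes ε t ω a σ}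

/-- The trees up to time `t`. -/
def treesUpTo (ε t : ℝ) (n : ℕ) : Set (Phase × (Fin n → Mark)) :=
  {a | a ∈ consistentMarks ε n ∧ ∀ j, (a.2 j).1 ∈ Ioc 0 t}

/-- The event becomes the preimage of an image under an injective Borel map between standard Borel
spaces, which is how its measurability is obtained. -/
theorem event_eq_preimage {ε t : ℝ} {A : Set (Phase × (Fin n → Mark))} (hA : A ⊆ treesUpTo ε t n)
    {σ : Fin n → Fin N} (hσ : Function.Injective σ) :
    event ε t A σ = splitMet σ ⁻¹' ((fun z : (Phase × (Fin n → Mark)) × ({i // i ∉ range σ} → Phase) =>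
      (starts ε n z.1, z.2)) '' {z | z.1 ∈ A ∧ ∀ i, z.2 i ∈ avoidSet (pos ⟨n, z.1⟩) ε (Icc 0 t)}) := by
  ext ω
  constructor
  · rintro ⟨a, ha, hR⟩
    refine ⟨(a, fun i => ω.2 i), ⟨ha, fun i => hR.unmet i i.2⟩, ?_⟩
    refine Prod.ext ?_ rfl
    change starts ε n a = _
    rw [starts_eq_startOf (hA ha).1]
    exact Prod.ext hR.root (funext fun j => (hR.met j).symm)
  · rintro ⟨⟨a, r⟩, ⟨ha, hr⟩, he⟩
    have h1 : starts ε n a = (ω.1, fun j => ω.2 (σ j)) := congrArg Prod.fst he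
    have h2 : r = fun i : {i // i ∉ range σ} => ω.2 i := congrArg Prod.snd he
    rw [starts_eq_startOf (hA ha).1] at h1
    subst h2
    exact ⟨a, ha, congrArg Prod.fst h1, hσ, (hA ha).2,
      fun j => (congrFun (congrArg Prod.snd h1) j).symm, fun i hi => hr ⟨i, hi⟩⟩

theorem measurableSet_unmet (ε t : ℝ) {A : Set (Phase × (Fin n → Mark))} (hA : MeasurableSet A)
    (ι : Type*) [Fintype ι] :
    MeasurableSet {z : (Phase × (Fin n → Mark)) × (ι → Phase) |
      z.1 ∈ A ∧ ∀ i, z.2 i ∈ avoidSet (pos ⟨n, z.1⟩) ε (Icc 0 t)} := by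
  refine MeasurableSet.inter (measurable_fst hA) ?_
  have : {z : (Phase × (Fin n → Mark)) × (ι → Phase) |
      ∀ i, z.2 i ∈ avoidSet (pos ⟨n, z.1⟩) ε (Icc 0 t)} = ⋂ i,
      (fun z : (Phase × (Fin n → Mark)) × (ι → Phase) => (z.1, z.2 i)) ⁻¹'
        {z | z.2 ∈ avoidSet (pos ⟨n, z.1⟩) ε (Icc 0 t)} := by
    ext z; simp
  change MeasurableSet {z : (Phase × (Fin n → Mark)) × (ι → Phase) |
      ∀ i, z.2 i ∈ avoidSet (pos ⟨n, z.1⟩) ε (Icc 0 t)}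
  rw [this]
  exact MeasurableSet.iInter fun i =>
    (measurable_fst.prodMk ((measurable_pi_apply i).comp measurable_snd))
      (measurableSet_avoidSet_tree ε isClosed_Icc.isLocallyClosed)

instance (ι : Type*) [Fintype ι] : StandardBorelSpace ((Phase × (Fin n → Mark)) × (ι → Phase)) := by
  infer_instance

instance (ι : Type*) [Fintype ι] : StandardBorelSpace ((Phase × (Fin n → Phase)) × (ι → Phase)) := by
  infer_instance

theorem measurableSet_image_of_injOn {X Y : Type*} [MeasurableSpace X] [StandardBorelSpace X]
    [MeasurableSpace Y] [StandardBorelSpace Y] {s : Set X} (hs : MeasurableSet s) {f : X → Y}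
    (hf : Measurable f) (hi : InjOn f s) : MeasurableSet (f '' s) :=
  hs.image_of_measurable_injOn hf hi

theorem measurableSet_unmet_image {ε t : ℝ} (hε : 0 < ε) (hε' : ε ≤ 1 / 8)
    {A : Set (Phase × (Fin n → Mark))} (hA : MeasurableSet A) (hAc : A ⊆ consistentMarks ε n)
    (ι : Type*) [Fintype ι] :
    MeasurableSet ((fun z : (Phase × (Fin n → Mark)) × (ι → Phase) => (starts ε n z.1, z.2)) ''
      {z | z.1 ∈ A ∧ ∀ i, z.2 i ∈ avoidSet (pos ⟨n, z.1⟩) ε (Icc 0 t)}) := by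
  refine measurableSet_image_of_injOn (measurableSet_unmet ε t hA ι)
    ((measurable_starts ε n).comp measurable_fst |>.prodMk measurable_snd) ?_
  rintro ⟨a, r⟩ ha ⟨b, r'⟩ hb h
  simp only [Prod.mk.injEq] at h
  exact Prod.ext (starts_injOn hε hε' n (hAc ha.1) (hAc hb.1) h.1) h.2

theorem measurableSet_event {ε t : ℝ} (hε : 0 < ε) (hε' : ε ≤ 1 / 8)
    {A : Set (Phase × (Fin n → Mark))} (hA : MeasurableSet A) (hAc : A ⊆ treesUpTo ε t n)
    {σ : Fin n → Fin N} (hσ : Function.Injective σ) : MeasurableSet (event ε t A σ) := by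
  rw [event_eq_preimage hAc hσ]
  exact measurable_splitMet σ (measurableSet_unmet_image hε hε' hA (fun a ha => (hAc ha).1) _)

theorem card_unmet {σ : Fin n → Fin N} (hσ : Function.Injective σ) :
    Fintype.card {i // i ∉ range σ} = N - n := by
  classical
  rw [Fintype.card_subtype_compl, Fintype.card_fin]
  congr 1
  rw [show Fintype.card {i // i ∈ range σ} = Fintype.card (Fin n) from
    (Fintype.card_congr (Equiv.ofInjective σ hσ)).symm, Fintype.card_fin]

/-- Given the initial states of the n particles met, and with them the tree, the other N - n
particles avoid the path independently, which gives the power. Integration over the met particles is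
`lintegral_starts`. -/
theorem initialLaw_event (hf : Measurable f₀) (hg : Measurable g₀)
    (hf0 : ∀ q, 0 ≤ f₀ q) (hg0 : ∀ q, 0 ≤ g₀ q) {ε t : ℝ} (hε : 0 < ε) (hε' : ε ≤ 1 / 8)
    {A : Set (Phase × (Fin n → Mark))} (hA : MeasurableSet A) (hAc : A ⊆ treesUpTo ε t n)
    {σ : Fin n → Fin N} (hσ : Function.Injective σ) :
    initialLaw f₀ g₀ N (event ε t A σ) = ∫⁻ a in A, ENNReal.ofReal (treeWeight f₀ g₀ ε n a) *
      lawOf g₀ (avoidSet (pos ⟨n, a⟩) ε (Icc 0 t)) ^ (N - n) ∂marksMeasure n := by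
  classical
  have hAB : A ⊆ consistentMarks ε n := fun a ha => (hAc ha).1
  have hBm := measurableSet_consistentMarks ε n
  have hinj := starts_injOn hε hε' n
  set ι := {i // i ∉ range σ}
  set W := (fun z : (Phase × (Fin n → Mark)) × (ι → Phase) => (starts ε n z.1, z.2)) ''
      {z | z.1 ∈ A ∧ ∀ i, z.2 i ∈ avoidSet (pos ⟨n, z.1⟩) ε (Icc 0 t)} with hW
  have hWm : MeasurableSet W := measurableSet_unmet_image hε hε' hA hAB ι
  set K : Phase × (Fin n → Phase) → ENNReal := fun y =>
    Measure.pi (fun _ : ι => lawOf g₀) (Prod.mk y ⁻¹' W) with hK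
  have hKm : Measurable K := measurable_measure_prodMk_left hWm
  have hK0 : ∀ a ∈ consistentMarks ε n, K (starts ε n a)
      = A.indicator (fun a => lawOf g₀ (avoidSet (pos ⟨n, a⟩) ε (Icc 0 t)) ^ (N - n)) a := by
    intro a ha
    by_cases haA : a ∈ A
    · have h1 : Prod.mk (starts ε n a) ⁻¹' W = univ.pi fun _ => avoidSet (pos ⟨n, a⟩) ε (Icc 0 t) := by
        ext r
        rw [mem_univ_pi]
        constructor
        · rintro ⟨⟨b, r'⟩, ⟨hb, hr⟩, he⟩
          obtain rfl := hinj (hAB hb) ha (congrArg Prod.fst he)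
          obtain rfl : r' = r := congrArg Prod.snd he
          exact hr
        · intro hr
          exact ⟨(a, r), ⟨haA, hr⟩, rfl⟩
      rw [indicator_of_mem haA, hK]
      simp only [h1]
      rw [Measure.pi_pi, Finset.prod_const, Finset.card_univ, card_unmet hσ]
    · rw [indicator_of_notMem haA, hK]
      have h1 : Prod.mk (starts ε n a) ⁻¹' W = ∅ := by
        refine eq_empty_of_forall_notMem fun r => ?_
        rintro ⟨⟨b, r'⟩, ⟨hb, hr⟩, he⟩
        exact haA (hinj (hAB hb) ha (congrArg Prod.fst he) ▸ hb)
      simp only [h1, measure_empty]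
  have hKout : ∀ y ∉ starts ε n '' consistentMarks ε n, K y = 0 := by
    intro y hy
    have h1 : Prod.mk y ⁻¹' W = ∅ := by
      refine eq_empty_of_forall_notMem fun r => ?_
      rintro ⟨⟨b, r'⟩, ⟨hb, hr⟩, he⟩
      exact hy ⟨b, hAB hb, congrArg Prod.fst he⟩
    simp only [hK, h1, measure_empty]
  have hI := measurableSet_starts_image hε hε' hBm subset_rfl
  rw [event_eq_preimage hAc hσ, (measurePreserving_splitMet f₀ g₀ hσ).measure_preimage
    hWm.nullMeasurableSet, Measure.prod_apply hWm]
  calc ∫⁻ y, K y ∂startLaw f₀ g₀ n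
      = ∫⁻ y in starts ε n '' consistentMarks ε n, K y ∂startLaw f₀ g₀ n := by
        rw [← lintegral_indicator hI]
        refine lintegral_congr fun y => ?_
        by_cases hy : y ∈ starts ε n '' consistentMarks ε n
        · rw [indicator_of_mem hy]
        · rw [indicator_of_notMem hy, hKout y hy]
    _ = _ := by
        rw [lintegral_starts hf hg hf0 hg0 hε hε' n K hKm, ← lintegral_indicator hBm,
          ← lintegral_indicator hA]
        refine lintegral_congr fun a => ?_
        by_cases ha : a ∈ consistentMarks ε n
        · rw [indicator_of_mem ha, hK0 a ha]
          by_cases haA : a ∈ A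
          · rw [indicator_of_mem haA, indicator_of_mem haA]
          · rw [indicator_of_notMem haA, indicator_of_notMem haA, mul_zero]
        · rw [indicator_of_notMem ha, indicator_of_notMem fun h => ha (hAB h)]

end Events

/-! ### The dynamics determines the tree -/

section Determinism

variable {N n : ℕ} {ε t : ℝ} {ω : Config N}

theorem tau_init_lt {a : Phase × (Fin (n + 1) → Mark)} (hmono : StrictMono fun j => (a.2 j).1)
    (h0 : ∀ j, 0 < (a.2 j).1) : tau ⟨n, (a.1, Fin.init a.2)⟩ < (a.2 (Fin.last n)).1 := by
  cases n with
  | zero => exact h0 _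
  | succ n => exact hmono (Fin.castSucc_lt_last _)

theorem strictMono_init {a : Phase × (Fin (n + 1) → Mark)} (hmono : StrictMono fun j => (a.2 j).1) :
    StrictMono fun j => (Fin.init a.2 j : Mark).1 :=
  fun _ _ hjk => hmono (Fin.castSucc_lt_castSucc_iff.2 hjk)

theorem mem_consistentMarks {a : Phase × (Fin n → Mark)} (hmono : StrictMono fun j => (a.2 j).1)
    (ht : ∀ j, (a.2 j).1 ∈ Ioc 0 t) (hrec : RecollisionFree ε t ⟨n, a⟩) (hng : NonGrazing ⟨n, a⟩) :
    a ∈ consistentMarks ε n := by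
  induction n generalizing t with
  | zero => trivial
  | succ n ih =>
    have hm : ∀ j : Fin n, (a.2 j.castSucc).1 ≤ (a.2 (Fin.last n)).1 := fun j =>
      (hmono (Fin.castSucc_lt_last j)).le
    have hτ := ht (Fin.last n)
    refine ⟨ih (strictMono_init hmono) (fun j => ⟨(ht j.castSucc).1, hm j⟩)
      (recollisionFree_prune hrec hm hτ.2 le_rfl) (nonGrazing_prune hng), tau_init_lt hmono fun j => (ht j).1, ?_, fun θ hθ => ?_⟩
    · have h1 := hng (Fin.last n)
      rw [real_inner_comm] at h1
      have h2 : endVel ⟨n, (a.1, Fin.init a.2)⟩ = velAfter ⟨n + 1, a⟩ n := velAfter_prune a le_rfl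
      rw [h2]
      exact h1
    · have hs : θ * (a.2 (Fin.last n)).1 < (a.2 (Fin.last n)).1 := by nlinarith [hθ.2, hτ.1]
      have h1 := hrec (Fin.last n) _ ⟨mul_nonneg hθ.1 hτ.1.le, hs.le.trans hτ.2⟩ hs.ne
      rw [bgPos_eq_of_le ε ⟨n + 1, a⟩ (Fin.last n) hs.le, startOf_last ε a hm, ← pos_prune a hs.le] at h1
      exact h1

theorem Realizes.mono {a : Phase × (Fin n → Mark)} {σ : Fin n → Fin N} (hR : Realizes ε t ω a σ)
    {s : ℝ} (hst : s ≤ t) (hs : ∀ j, (a.2 j).1 ≤ s) : Realizes ε s ω a σ :=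
  ⟨hR.root, hR.inj, fun j => ⟨(hR.times j).1, hs j⟩, hR.met,
    fun i hi => avoidSet_anti (Icc_subset_Icc_right hst) (hR.unmet i hi)⟩

theorem Realizes.last_notMem_avoidSet {a : Phase × (Fin (n + 1) → Mark)} {σ : Fin (n + 1) → Fin N}
    (hε : 0 ≤ ε) (hR : Realizes ε t ω a σ) :
    ω.2 (σ (Fin.last n)) ∉ avoidSet (pos ⟨n, (a.1, Fin.init a.2)⟩) ε (Icc 0 (a.2 (Fin.last n)).1) := by
  intro h
  have h1 := h (a.2 (Fin.last n)).1 ⟨(hR.times _).1.le, le_rfl⟩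
  have h2 : pos ⟨n, (a.1, Fin.init a.2)⟩ (a.2 (Fin.last n)).1 = pos ⟨n + 1, a⟩ (a.2 (Fin.last n)).1 :=
    pos_prune a le_rfl
  have h3 : bgPos ε ⟨n + 1, a⟩ (Fin.last n) (a.2 (Fin.last n)).1
      = shift (pos ⟨n + 1, a⟩ (a.2 (Fin.last n)).1) (ε • ((a.2 (Fin.last n)).2.1 : Vel)) := by
    change shift _ (_ + ((a.2 (Fin.last n)).1 - (a.2 (Fin.last n)).1) • _) = _
    rw [sub_self, zero_smul, add_zero]
    rfl
  rw [h2, ← bgPos_of_met (hR.met (Fin.last n)) le_rfl, h3] at h1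
  exact absurd h1 (not_lt.2 (torusDist_shift_smul_le hε _ _))

theorem Realizes.not_lt_last {m : ℕ} {a : Phase × (Fin n → Mark)} {b : Phase × (Fin (m + 1) → Mark)}
    {σ : Fin n → Fin N} {ρ : Fin (m + 1) → Fin N} (hε : 0 ≤ ε)
    (hRa : Realizes ε t ω a σ) (hRb : Realizes ε t ω b ρ)
    (h : (⟨n, a, σ⟩ : Σ n, (Phase × (Fin n → Mark)) × (Fin n → Fin N))
      = ⟨m, (b.1, Fin.init b.2), Fin.init ρ⟩) : False := by
  obtain ⟨rfl, h⟩ := Sigma.mk.inj h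
  obtain ⟨rfl, rfl⟩ := Prod.mk.inj (eq_of_heq h)
  exact hRb.last_notMem_avoidSet hε (avoidSet_anti (Icc_subset_Icc_right (hRb.times _).2)
    (hRa.unmet _ (notMem_range_init hRb.inj)))

/-- An initial state realizes at most one tree up to time `t`. -/
theorem Realizes.unique (hε : 0 < ε) (hε' : ε ≤ 1 / 8) {m : ℕ} {a : Phase × (Fin n → Mark)}
    {b : Phase × (Fin m → Mark)} {σ : Fin n → Fin N} {ρ : Fin m → Fin N}
    (hRa : Realizes ε t ω a σ) (hRb : Realizes ε t ω b ρ)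
    (hma : StrictMono fun j => (a.2 j).1) (hmb : StrictMono fun j => (b.2 j).1)
    (hra : RecollisionFree ε t ⟨n, a⟩) (hrb : RecollisionFree ε t ⟨m, b⟩)
    (hna : NonGrazing ⟨n, a⟩) (hnb : NonGrazing ⟨m, b⟩) :
    (⟨n, a, σ⟩ : Σ n, (Phase × (Fin n → Mark)) × (Fin n → Fin N)) = ⟨m, b, ρ⟩ := by
  induction hk : n + m using Nat.strong_induction_on generalizing n m t with
  | _ k ih =>
  have hA : ∀ {n m : ℕ} {a : Phase × (Fin n → Mark)} {b : Phase × (Fin (m + 1) → Mark)}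
      {σ : Fin n → Fin N} {ρ : Fin (m + 1) → Fin N},
      Realizes ε t ω a σ → Realizes ε t ω b ρ →
      (StrictMono fun j => (a.2 j).1) → (StrictMono fun j => (b.2 j).1) →
      RecollisionFree ε t ⟨n, a⟩ → RecollisionFree ε t ⟨m + 1, b⟩ →
      NonGrazing ⟨n, a⟩ → NonGrazing ⟨m + 1, b⟩ → n + (m + 1) = k →
      ¬ tau ⟨n, a⟩ < (b.2 (Fin.last m)).1 := by
    intro n m a b σ ρ hRa hRb hma hmb hra hrb hna hnb hk hlt
    have hτ := (hRb.times (Fin.last m)).2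
    -- If b had a collision later than all of a, cut both at s: by induction a equals b without its
    -- last collision. But the last partner of b touches this common path, while in a it is unmet.
    set s := max (tau ⟨n, a⟩) (tau ⟨m, (b.1, Fin.init b.2)⟩) with hs
    have hsτ : s < (b.2 (Fin.last m)).1 := max_lt hlt (tau_init_lt hmb fun j => (hRb.times j).1)
    have hbm : ∀ j : Fin m, (b.2 j.castSucc).1 ≤ (b.2 (Fin.last m)).1 := fun j =>
      (hmb (Fin.castSucc_lt_last j)).le
    refine hRa.not_lt_last hε.le hRb (ih _ (by omega)
      (hRa.mono (hsτ.le.trans hτ) fun j => (time_le_tau (Φ := ⟨n, a⟩) hma j).trans (le_max_left _ _))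
      (hRb.prune hmb hrb (fun j => (time_le_tau (Φ := ⟨m, (b.1, Fin.init b.2)⟩)
        (strictMono_init hmb) j).trans (le_max_right _ _)) hsτ)
      hma (strictMono_init hmb) (fun j r hr => hra j r ⟨hr.1, hr.2.trans (hsτ.le.trans hτ)⟩)
      (recollisionFree_prune hrb hbm (hsτ.le.trans hτ) hsτ.le) hna (nonGrazing_prune hnb) rfl)
  have hca := mem_consistentMarks hma hRa.times hra hna
  have hcb := mem_consistentMarks hmb hRb.times hrb hnb
  cases n with
  | zero =>
    cases m with
    | zero =>
      obtain rfl : a = b :=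
        Prod.ext (hRa.root.trans hRb.root.symm) (funext fun j => j.elim0)
      rw [show σ = ρ from funext fun j => j.elim0]
    | succ m =>
      exact absurd (hRb.times (Fin.last m)).1 (hA hRa hRb hma hmb hra hrb hna hnb hk)
  | succ n =>
    cases m with
    | zero =>
      exact absurd (hRa.times (Fin.last n)).1 (hA hRb hRa hmb hma hrb hra hnb hna (by omega))
    | succ m =>
      have hab : (a.2 (Fin.last n)).1 = (b.2 (Fin.last m)).1 :=
        le_antisymm (not_lt.1 (hA hRb hRa hmb hma hrb hra hnb hna (by omega)))
          (not_lt.1 (hA hRa hRb hma hmb hra hrb hna hnb hk))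
      have hτ := (hRb.times (Fin.last m)).2
      set s := max (tau ⟨n, (a.1, Fin.init a.2)⟩) (tau ⟨m, (b.1, Fin.init b.2)⟩) with hs
      have hsτ : s < (b.2 (Fin.last m)).1 :=
        max_lt (hab ▸ tau_init_lt hma fun j => (hRa.times j).1)
          (tau_init_lt hmb fun j => (hRb.times j).1)
      have hsa : s < (a.2 (Fin.last n)).1 := hab ▸ hsτ
      have ham : ∀ j : Fin n, (a.2 j.castSucc).1 ≤ (a.2 (Fin.last n)).1 := fun j =>
        (hma (Fin.castSucc_lt_last j)).le
      have hbm : ∀ j : Fin m, (b.2 j.castSucc).1 ≤ (b.2 (Fin.last m)).1 := fun j =>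
        (hmb (Fin.castSucc_lt_last j)).le
      have h := ih _ (by omega)
        (hRa.prune hma hra (fun j => (time_le_tau (Φ := ⟨n, (a.1, Fin.init a.2)⟩)
          (strictMono_init hma) j).trans (le_max_left _ _)) hsa)
        (hRb.prune hmb hrb (fun j => (time_le_tau (Φ := ⟨m, (b.1, Fin.init b.2)⟩)
          (strictMono_init hmb) j).trans (le_max_right _ _)) hsτ)
        (strictMono_init hma) (strictMono_init hmb)
        (recollisionFree_prune hra ham (hsτ.le.trans hτ) hsa.le)
        (recollisionFree_prune hrb hbm (hsτ.le.trans hτ) hsτ.le)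
        (nonGrazing_prune hna) (nonGrazing_prune hnb) rfl
      obtain ⟨rfl, h⟩ := Sigma.mk.inj h
      obtain ⟨h1, h2⟩ := Prod.mk.inj (eq_of_heq h)
      -- The last collisions happen at the same time on the same path. If the partners differed,
      -- that of b would be unmet in a although it is in contact.
      have hi : σ (Fin.last n) = ρ (Fin.last n) := by
        by_contra hne
        refine hRb.last_notMem_avoidSet hε.le ?_
        intro r hr
        have h3 := hRa.unmet (ρ (Fin.last n)) (mem_range_of_notMem_init
          (h2 ▸ notMem_range_init hRb.inj) (Ne.symm hne)) r ⟨hr.1, hr.2.trans hτ⟩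
        rw [← pos_prune a (hr.2.trans hab.ge)] at h3
        rw [← h1]
        exact h3
      have hab' : a = b := by
        refine (splitLast Mark n).injective (Prod.ext h1 ?_)
        have h3 := (hRa.met (Fin.last n)).symm.trans ((congrArg ω.2 hi).trans (hRb.met (Fin.last n)))
        rw [startOf_last ε a ham, startOf_last ε b hbm] at h3
        obtain ⟨h4, h5⟩ := times_le_tau_of_consistent hca.1
        refine nextMarks_injOn hε hε' h4 h5 hca.2 (h1 ▸ hcb.2) (h3.trans ?_)
        change flyBack ε (anchor ⟨n, (b.1, Fin.init b.2)⟩) (endVel ⟨n, (b.1, Fin.init b.2)⟩) _ = _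
        rw [← h1]
        rfl
      subst hab'
      have hσρ : σ = ρ := by
        rw [← Fin.snoc_init_self σ, ← Fin.snoc_init_self ρ, h2, hi]
      rw [hσρ]

end Determinism

/-! ### The density of the empirical distribution -/

open Classical in
/-- The density, at the tree, of the empirical distribution at time `t`. -/
def treeDensity (f₀ g₀ : Phase → ℝ) (N : ℕ) (ε t : ℝ) (Φ : CollisionTree) : ℝ :=
  if ∀ j, Φ.time j ∈ Ioc 0 t then
    N.descFactorial Φ.n * treeWeight f₀ g₀ ε Φ.n Φ.2 * unhitMass g₀ ε t Φ ^ (N - Φ.n)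
  else 0

theorem treeDensity_of_times {f₀ g₀ : Phase → ℝ} {N : ℕ} {ε t : ℝ} {n : ℕ}
    {a : Phase × (Fin n → Mark)} (h : ∀ j, (a.2 j).1 ∈ Ioc 0 t) :
    treeDensity f₀ g₀ N ε t ⟨n, a⟩
      = N.descFactorial n * treeWeight f₀ g₀ ε n a * unhitMass g₀ ε t ⟨n, a⟩ ^ (N - n) := if_pos h

theorem treeDensity_of_not_times {f₀ g₀ : Phase → ℝ} {N : ℕ} {ε t : ℝ} {Φ : CollisionTree}
    (h : ¬∀ j, Φ.time j ∈ Ioc 0 t) : treeDensity f₀ g₀ N ε t Φ = 0 := if_neg h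

section Density

variable {f₀ g₀ : Phase → ℝ}

theorem treeDensity_nonneg (hf0 : ∀ q, 0 ≤ f₀ q) (hg0 : ∀ q, 0 ≤ g₀ q) (N : ℕ) (ε t : ℝ)
    (Φ : CollisionTree) : 0 ≤ treeDensity f₀ g₀ N ε t Φ := by
  rw [treeDensity]
  split_ifs
  · exact mul_nonneg (mul_nonneg (Nat.cast_nonneg _) (treeWeight_nonneg hf0 hg0 ε _))
      (pow_nonneg (unhitMass_nonneg _ _ _ _) _)
  · exact le_rfl

theorem measurable_sigma_iff {ι : Type*} {α : ι → Type*} [∀ i, MeasurableSpace (α i)] {β : Type*}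
    [MeasurableSpace β] {f : Sigma α → β} : Measurable f ↔ ∀ i, Measurable fun x => f ⟨i, x⟩ := by
  constructor
  · intro h i s hs
    exact (MeasurableSpace.measurableSet_iInf.1 (h hs)) i
  · intro h s hs
    exact MeasurableSpace.measurableSet_iInf.2 fun i => h i hs

theorem measurable_sigma_mk {ι : Type*} {α : ι → Type*} [∀ i, MeasurableSpace (α i)] (i : ι) :
    Measurable (Sigma.mk i : α i → Sigma α) :=
  measurable_sigma_iff.1 measurable_id i

theorem measurableSet_times (t : ℝ) (n : ℕ) :
    MeasurableSet {a : Phase × (Fin n → Mark) | ∀ j, (a.2 j).1 ∈ Ioc 0 t} := by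
  rw [ofPred_forall]
  exact MeasurableSet.iInter fun j =>
    (by fun_prop : Measurable fun a : Phase × (Fin n → Mark) => (a.2 j).1) measurableSet_Ioc

theorem measurable_unhitMass (g₀ : Phase → ℝ) (ε t : ℝ) (n : ℕ) :
    Measurable fun a : Phase × (Fin n → Mark) => unhitMass g₀ ε t ⟨n, a⟩ := by
  have h := measurable_measure_prodMk_left (ν := lawOf g₀)
    (measurableSet_avoidSet_tree (n := n) ε (isClosed_Icc (a := 0) (b := t)).isLocallyClosed)
  exact h.ennreal_toReal

theorem measurable_treeDensity (hf : Measurable f₀) (hg : Measurable g₀) (N : ℕ) (ε t : ℝ) :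
    Measurable (treeDensity f₀ g₀ N ε t) := by
  refine measurable_sigma_iff.2 fun n => ?_
  refine Measurable.ite (measurableSet_times t n) ?_ measurable_const
  exact ((measurable_treeWeight hf hg ε n).const_mul (N.descFactorial n : ℝ)).mul
    ((measurable_unhitMass g₀ ε t n).pow_const (N - n))

theorem setLIntegral_treeMeasure {F : CollisionTree → ENNReal} (hF : Measurable F)
    {A : Set CollisionTree} (hA : MeasurableSet A) :
    ∫⁻ Φ in A, F Φ ∂treeMeasure
      = ∑' n, ∫⁻ a in {a | (⟨n, a⟩ : CollisionTree) ∈ A}, F ⟨n, a⟩ ∂marksMeasure n := by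
  rw [treeMeasure, Measure.restrict_sum _ hA, lintegral_sum_measure]
  refine tsum_congr fun n => ?_
  exact setLIntegral_map hA hF (measurable_sigma_mk n)

/-- The event splits according to the number of collisions and the ordered choice of partners, an
embedding of `Fin n` into `Fin N`. The pieces are disjoint by `Realizes.unique`, all choices have
equal probability, and their number is the falling factorial. -/
theorem empirical_eq (hf : Measurable f₀) (hg : Measurable g₀) (hf0 : ∀ q, 0 ≤ f₀ q)
    (hg0 : ∀ q, 0 ≤ g₀ q) [IsFiniteMeasure (lawOf g₀)] (N : ℕ) {ε t T : ℝ} (hε : 0 < ε)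
    (hε' : ε ≤ 1 / 8) (ht : 0 ≤ t) {A : Set CollisionTree} (hA : MeasurableSet A)
    (hAr : A ⊆ regularTrees T ε t) :
    empirical f₀ g₀ N ε t A
      = ∫⁻ Φ in A, ENNReal.ofReal (treeDensity f₀ g₀ N ε t Φ) ∂treeMeasure := by
  set A' : (n : ℕ) → Set (Phase × (Fin n → Mark)) := fun n =>
    {a | (⟨n, a⟩ : CollisionTree) ∈ A ∧ ∀ j, (a.2 j).1 ∈ Ioc 0 t} with hA'
  have hAm : ∀ n, MeasurableSet {a | (⟨n, a⟩ : CollisionTree) ∈ A} := fun n =>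
    measurable_sigma_mk n hA
  have hA'm : ∀ n, MeasurableSet (A' n) := fun n => (hAm n).inter (measurableSet_times t n)
  have hA't : ∀ n, A' n ⊆ treesUpTo ε t n := fun n a ha => by
    obtain ⟨⟨hmono, -⟩, hrec, -, hng⟩ := hAr ha.1
    exact ⟨mem_consistentMarks hmono ha.2 hrec hng, ha.2⟩
  have hset : {ω : Config N | ∃ Φ ∈ A, Φ.2.1 = ω.1 ∧ ∃ S, Evolves ε ω t (List.ofFn Φ.2.2) S}
      = ⋃ x : Σ n, Fin n ↪ Fin N, event ε t (A' x.1) x.2 := by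
    ext ω
    rw [mem_iUnion]
    constructor
    · rintro ⟨⟨n, a⟩, hΦ, h⟩
      obtain ⟨σ, hσ⟩ := (exists_evolves_iff hε.le ht (hAr hΦ)).1 h
      exact ⟨⟨n, σ, hσ.inj⟩, a, ⟨hΦ, hσ.times⟩, hσ⟩
    · rintro ⟨⟨n, σ⟩, a, ha, hσ⟩
      exact ⟨⟨n, a⟩, ha.1, (exists_evolves_iff hε.le ht (hAr ha.1)).2 ⟨σ, hσ⟩⟩
  have hdisj : Pairwise (Function.onFun Disjoint
      fun x : Σ n, Fin n ↪ Fin N => event ε t (A' x.1) x.2) := by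
    rintro ⟨n, σ⟩ ⟨m, ρ⟩ hne
    refine Set.disjoint_left.2 ?_
    rintro ω ⟨a, ha, hRa⟩ ⟨b, hb, hRb⟩
    obtain ⟨⟨hma, -⟩, hra, -, hna⟩ := hAr ha.1
    obtain ⟨⟨hmb, -⟩, hrb, -, hnb⟩ := hAr hb.1
    have h := hRa.unique hε hε' hRb hma hmb hra hrb hna hnb
    obtain ⟨rfl, h⟩ := Sigma.mk.inj h
    obtain ⟨-, h⟩ := Prod.mk.inj (eq_of_heq h)
    exact hne (congrArg (Sigma.mk n) (DFunLike.coe_injective h))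
  rw [empirical, hset, measure_iUnion hdisj fun x =>
    measurableSet_event hε hε' (hA'm x.1) (hA't x.1) x.2.injective,
    ENNReal.tsum_sigma' , setLIntegral_treeMeasure
      (measurable_treeDensity hf hg N ε t).ennreal_ofReal hA]
  refine tsum_congr fun n => ?_
  have hev : ∀ σ : Fin n ↪ Fin N, initialLaw f₀ g₀ N (event ε t (A' n) σ)
      = ∫⁻ a in A' n, ENNReal.ofReal (treeWeight f₀ g₀ ε n a) *
      lawOf g₀ (avoidSet (pos ⟨n, a⟩) ε (Icc 0 t)) ^ (N - n) ∂marksMeasure n := fun σ =>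
    initialLaw_event hf hg hf0 hg0 hε hε' (hA'm n) (hA't n) σ.injective
  simp only [hev]
  rw [tsum_fintype, Finset.sum_const, Finset.card_univ, Fintype.card_embedding_eq, Fintype.card_fin,
    Fintype.card_fin, nsmul_eq_mul, ← lintegral_const_mul' _ _ (ENNReal.natCast_ne_top _),
    ← lintegral_indicator (hA'm n), ← lintegral_indicator (hAm n)]
  refine lintegral_congr fun a => ?_
  by_cases ha : (⟨n, a⟩ : CollisionTree) ∈ A
  · rw [indicator_of_mem (show a ∈ {a | (⟨n, a⟩ : CollisionTree) ∈ A} from ha)]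
    by_cases hat : ∀ j, (a.2 j).1 ∈ Ioc 0 t
    · rw [indicator_of_mem (show a ∈ A' n from ⟨ha, hat⟩), treeDensity_of_times hat, unhitMass,
        ENNReal.ofReal_mul (mul_nonneg (Nat.cast_nonneg _) (treeWeight_nonneg hf0 hg0 ε _)),
        ENNReal.ofReal_mul (Nat.cast_nonneg _), ENNReal.ofReal_natCast,
        ENNReal.ofReal_pow ENNReal.toReal_nonneg, ENNReal.ofReal_toReal (measure_ne_top _ _), mul_assoc]
    · rw [indicator_of_notMem (show a ∉ A' n from fun h => hat h.2), treeDensity_of_not_times (Φ := ⟨n, a⟩) hat,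
        ENNReal.ofReal_zero]
  · rw [indicator_of_notMem (show a ∉ A' n from fun h => ha h.1),
      indicator_of_notMem (show a ∉ {a | (⟨n, a⟩ : CollisionTree) ∈ A} from ha)]

end Density

/-! ### The empirical equation -/

section Equation

variable {f₀ g₀ : Phase → ℝ}

theorem BackgroundAdmissible.isProbabilityMeasure_lawOf (hg : BackgroundAdmissible g₀) :
    IsProbabilityMeasure (lawOf g₀) :=
  ⟨by rw [lawOf_apply, Measure.restrict_univ, hg.mass]⟩

theorem lawOf_avoidSet_pos [IsProbabilityMeasure (lawOf g₀)] {ε T : ℝ} {Φ : CollisionTree}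
    (h : lawOf g₀ (avoidSet Φ.pos ε (Icc 0 T))ᶜ < 1) {S : Set ℝ} (hS : S ⊆ Icc 0 T) :
    0 < (lawOf g₀ (avoidSet Φ.pos ε S)).toReal := by
  have hm := measurableSet_avoidSet Φ.continuous_pos ε (isClosed_Icc (a := 0) (b := T)).isLocallyClosed
  have h1 : lawOf g₀ (avoidSet Φ.pos ε (Icc 0 T)) ≠ 0 := fun h0 => by
    rw [prob_compl_eq_one_sub hm, h0, tsub_zero] at h
    exact lt_irrefl _ h
  refine ENNReal.toReal_pos (fun h0 => h1 ?_) (measure_ne_top _ _)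
  exact measure_mono_null (avoidSet_anti hS) h0

/-- The sphere of radius exactly ε around the starting point is null, so the complement of the open
ball has the mass of the particles avoiding the path at time 0. -/
theorem zeta_eq (hgm : Measurable g₀) (hg0 : ∀ q, 0 ≤ g₀ q) [IsProbabilityMeasure (lawOf g₀)] (N : ℕ)
    {ε : ℝ} (hε : 0 < ε) {Φ : CollisionTree} (h0 : ∀ j, 0 ≤ Φ.time j) :
    zeta g₀ N ε Φ = unhitMass g₀ ε 0 Φ ^ N := by
  have hint : Integrable g₀ := by
    refine ⟨hgm.aestronglyMeasurable, ?_⟩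
    rw [hasFiniteIntegral_iff_ofReal (Eventually.of_forall hg0)]
    have h1 := measure_lt_top (lawOf g₀) univ
    rwa [lawOf_apply, Measure.restrict_univ] at h1
  have h1 : ∫ x in {x : Torus | torusDist x Φ.x₀ < ε}, ∫ v : Vel, g₀ (x, v)
      = (lawOf g₀ {q : Phase | torusDist (Φ.pos 0) (shift q.1 ((0 : ℝ) • q.2)) < ε}).toReal := by
    have h2 := setIntegral_prod (μ := (volume : Measure Torus)) (ν := (volume : Measure Vel))
      (s := {x : Torus | torusDist x Φ.x₀ < ε}) (t := univ) g₀ hint.integrableOn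
    simp only [Measure.restrict_univ] at h2
    rw [← h2, ← Measure.volume_eq_prod, setIntegral_eq_lawOf hgm hg0]
    congr 2
    ext q
    simp only [mem_prod, mem_ofPred_eq, mem_univ, and_true, zero_smul, shift_zero,
      pos_zero_of_nonneg Φ h0]
    rw [torusDist_comm]
  have h3 : lawOf g₀ {q : Phase | torusDist (Φ.pos 0) (shift q.1 ((0 : ℝ) • q.2)) < ε}
      = lawOf g₀ (avoidSet Φ.pos ε (Icc 0 0))ᶜ := by
    refine measure_congr ?_
    filter_upwards [measure_eq_zero_iff_ae_notMem.1
      (lawOf_torusDist_eq_zero g₀ Φ.continuous_pos hε 0)] with q hq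
    refine propext ⟨fun h h' => ?_, fun h => ?_⟩
    · exact absurd (h' 0 ⟨le_rfl, le_rfl⟩) (not_lt.2 (le_of_lt h))
    · refine lt_of_le_of_ne (not_lt.1 fun h' => h fun s hs => ?_) hq
      obtain rfl : s = 0 := le_antisymm hs.2 hs.1
      exact h'
  have hm := measurableSet_avoidSet Φ.continuous_pos ε (isClosed_Icc (a := 0) (b := 0)).isLocallyClosed
  rw [zeta, h1, h3, unhitMass, prob_compl_eq_one_sub hm,
    ENNReal.toReal_sub_of_le prob_le_one ENNReal.one_ne_top, ENNReal.toReal_one, sub_sub_cancel]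

theorem unhitMass_prune (g₀ : Phase → ℝ) (ε : ℝ) {n : ℕ} (a : Phase × (Fin (n + 1) → Mark)) :
    unhitMass g₀ ε (a.2 (Fin.last n)).1 ⟨n, (a.1, Fin.init a.2)⟩
      = unhitMass g₀ ε (a.2 (Fin.last n)).1 ⟨n + 1, a⟩ := by
  rw [unhitMass, unhitMass]
  congr 2
  ext q
  refine forall₂_congr fun s hs => ?_
  rw [← pos_prune a hs.2]
  rfl

/-- Subtracting the re-hit rate from the collision rate leaves the rate of first hits, the one that
appears in the derivative of `unhitMass`. -/
theorem lossTerm_eq (hgm : Measurable g₀) (hg0 : ∀ q, 0 ≤ g₀ q) {G : Vel → ENNReal}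
    (hG : IsMajorant g₀ G) {ε : ℝ} (hε : 0 < ε) {t : ℝ} (ht : 0 < t) {Φ : CollisionTree}
    (hmono : StrictMono Φ.time) (htime : ∀ j, Φ.time j ≤ t) (P : CollisionTree → ℝ) :
    lossTerm g₀ (rehitRate g₀ ε t Φ).toReal ε t P Φ
      = P Φ * ((firstHitRate g₀ ε t Φ).toReal / unhitMass g₀ ε t Φ) := by
  rw [lossTerm, collisionRate_eq hgm hg0 hG ε hmono htime, add_sub_cancel_right,
    freeMass_eq_unhitMass hgm hg0 hε ht]

theorem gainCoeff_eq (hgm : Measurable g₀) (hg0 : ∀ q, 0 ≤ g₀ q) {ε : ℝ} (hε : 0 < ε) {n : ℕ}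
    {a : Phase × (Fin (n + 1) → Mark)} (hmono : StrictMono fun j => (a.2 j).1)
    (hτ : 0 < (a.2 (Fin.last n)).1) (P : CollisionTree → ℝ) :
    gainCoeff g₀ ε P ⟨n + 1, a⟩ = P ⟨n, (a.1, Fin.init a.2)⟩ *
      (g₀ (flyBack ε (anchor ⟨n, (a.1, Fin.init a.2)⟩) (endVel ⟨n, (a.1, Fin.init a.2)⟩)
          (a.2 (Fin.last n))) *
        max (inner ℝ (endVel ⟨n, (a.1, Fin.init a.2)⟩ - (a.2 (Fin.last n)).2.2)
          ((a.2 (Fin.last n)).2.1 : Vel)) 0 / unhitMass g₀ ε (a.2 (Fin.last n)).1 ⟨n + 1, a⟩) := by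
  have h1 : gainCoeff g₀ ε P ⟨n + 1, a⟩ = P ⟨n, (a.1, Fin.init a.2)⟩ *
      (transported g₀ (a.2 (Fin.last n)).1 (shift (pos ⟨n + 1, a⟩ (a.2 (Fin.last n)).1)
        (ε • ((a.2 (Fin.last n)).2.1 : Vel)), (a.2 (Fin.last n)).2.2) *
        max (inner ℝ (velAfter ⟨n + 1, a⟩ n - (a.2 (Fin.last n)).2.2)
          ((a.2 (Fin.last n)).2.1 : Vel)) 0 / freeMass g₀ ε (a.2 (Fin.last n)).1 ⟨n + 1, a⟩) :=
    dif_pos (Nat.succ_pos n)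
  have h2 : startOf ε ⟨n + 1, a⟩ (Fin.last n)
      = flyBack ε (anchor ⟨n, (a.1, Fin.init a.2)⟩) (endVel ⟨n, (a.1, Fin.init a.2)⟩)
        (a.2 (Fin.last n)) := startOf_last ε a fun j => (hmono (Fin.castSucc_lt_last j)).le
  have h3 : endVel ⟨n, (a.1, Fin.init a.2)⟩ = velAfter ⟨n + 1, a⟩ n := velAfter_prune a le_rfl
  rw [h1, freeMass_eq_unhitMass hgm hg0 hε hτ, ← h2, h3, transported, shift_shift, ← sub_eq_add_neg]
  rfl

theorem solvesEmpirical (hgm : Measurable g₀) (hg0 : ∀ q, 0 ≤ g₀ q)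
    [IsProbabilityMeasure (lawOf g₀)] {G : Vel → ENNReal} (hG : IsMajorant g₀ G) {T : ℝ}
    {N : ℕ} {ε : ℝ} (hε : 0 < ε) (hε' : ε ≤ 1 / 8) (hN : (N : ℝ) * ε ^ 2 = 1) {Φ : CollisionTree}
    (htree : Φ.IsTree T) (hpos : ∀ j, 0 < Φ.time j) (hn : Φ.n ≤ N)
    (hu : ∀ t ∈ Icc 0 T, 0 < unhitMass g₀ ε t Φ) :
    SolvesEmpirical f₀ g₀ T N ε (fun t Φ => (rehitRate g₀ ε t Φ).toReal) (treeDensity f₀ g₀ N ε) Φ := by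
  obtain ⟨hmono, hIcc⟩ := htree
  have h0 : ∀ j, 0 ≤ Φ.time j := fun j => (hpos j).le
  have hτ0 := tau_nonneg h0
  have htimes : ∀ s, Φ.tau ≤ s → ∀ j, Φ.time j ∈ Ioc 0 s := fun s hs j =>
    ⟨hpos j, (time_le_tau hmono j).trans hs⟩
  have hP : ∀ s, Φ.tau ≤ s → treeDensity f₀ g₀ N ε s Φ
      = N.descFactorial Φ.n * treeWeight f₀ g₀ ε Φ.n Φ.2 * unhitMass g₀ ε s Φ ^ (N - Φ.n) :=
    fun s hs => treeDensity_of_times (htimes s hs)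
  have hP0 : ∀ s, 0 ≤ s → s < Φ.tau → treeDensity f₀ g₀ N ε s Φ = 0 := by
    intro s hs0 hs
    refine treeDensity_of_not_times fun h => ?_
    obtain ⟨n, a⟩ := Φ
    cases n with
    | zero => exact absurd hs (not_lt.2 hs0)
    | succ n => exact absurd (h (Fin.last n)).2 (not_le.2 hs)
  -- The exponent of the mass times ε² is 1 - γ after τ, by the Boltzmann-Grad scaling; n ≤ N makes
  -- the natural subtraction genuine.
  have hNn : ((N - Φ.n : ℕ) : ℝ) * ε ^ 2 = 1 - Φ.n * ε ^ 2 := by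
    rw [Nat.cast_sub hn, sub_mul, hN]
  refine ⟨?_, ?_, ?_, ?_⟩
  · by_cases hn0 : Φ.n = 0
    · rw [if_pos hn0, zeta_eq hgm hg0 N hε h0]
      obtain ⟨n, a⟩ := Φ
      obtain rfl : n = 0 := hn0
      rw [hP 0 le_rfl]
      change ((N.descFactorial 0 : ℕ) : ℝ) * f₀ a.1 * unhitMass g₀ ε 0 ⟨0, a⟩ ^ (N - 0) = _ * f₀ a.1
      rw [Nat.descFactorial_zero, Nat.cast_one, one_mul, mul_comm]
      rfl
    · rw [if_neg hn0]
      refine treeDensity_of_not_times fun h => ?_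
      obtain ⟨h1, h2⟩ := h ⟨0, Nat.pos_of_ne_zero hn0⟩
      exact absurd h1 (not_lt.2 h2)
  · intro t ht hne
    rcases lt_or_gt_of_ne hne with hlt | hgt
    · rw [gam, if_pos hlt, sub_self, zero_mul]
      refine (hasDerivWithinAt_const t (Icc 0 T) (0 : ℝ)).congr_of_eventuallyEq ?_ (hP0 t ht.1 hlt)
      filter_upwards [self_mem_nhdsWithin, mem_nhdsWithin_of_mem_nhds (gt_mem_nhds hlt)] with s hs hs'
      exact hP0 s hs.1 hs'
    · rw [gam, if_neg (not_lt.2 hgt.le), if_neg hne,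
        lossTerm_eq hgm hg0 hG hε (hτ0.trans_lt hgt) hmono fun j => (htimes t hgt.le j).2, hP t hgt.le]
      have hd := ((hasDerivAt_unhitMass hgm hG hε hε' hmono h0 hgt).pow (N - Φ.n)).const_mul
        (N.descFactorial Φ.n * treeWeight f₀ g₀ ε Φ.n Φ.2)
      have hev : (fun s => treeDensity f₀ g₀ N ε s Φ) =ᶠ[𝓝 t] fun s =>
          N.descFactorial Φ.n * treeWeight f₀ g₀ ε Φ.n Φ.2 * unhitMass g₀ ε s Φ ^ (N - Φ.n) := by
        filter_upwards [lt_mem_nhds hgt] with s hs using hP s (le_of_lt hs)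
      refine ((hd.congr_of_eventuallyEq hev).hasDerivWithinAt).congr_deriv ?_
      have hut := (hu t ht).ne'
      rw [← hNn]
      -- If every background particle has been met, the density is constant and the factor 1 - γ
      -- vanishes as well.
      rcases Nat.eq_zero_or_pos (N - Φ.n) with hk | hk
      · rw [hk]; simp
      · obtain ⟨k, hk⟩ := Nat.exists_eq_succ_of_ne_zero hk.ne'
        rw [hk, Nat.succ_eq_add_one, Nat.add_sub_cancel, pow_succ]
        field_simp
        ring
  · obtain ⟨n, a⟩ := Φ
    cases n with
    | zero =>
      -- Without collisions τ is 0 and there are no earlier times, so the jump condition is vacuous.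
      have : Ico 0 (tau ⟨0, a⟩) = ∅ := Ico_self 0
      rw [this, nhdsWithin_empty]
      exact tendsto_bot
    | succ n =>
      have hτ := hpos (Fin.last n)
      have h1 : treeDensity f₀ g₀ N ε (tau ⟨n + 1, a⟩) ⟨n + 1, a⟩
          - (1 - gam ε (tau ⟨n + 1, a⟩) ⟨n + 1, a⟩) * gainCoeff g₀ ε
            (treeDensity f₀ g₀ N ε (tau ⟨n + 1, a⟩)) ⟨n + 1, a⟩ = 0 := by
        have hgam : gam ε (tau ⟨n + 1, a⟩) ⟨n + 1, a⟩ = n * ε ^ 2 := by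
          rw [gam, if_neg (lt_irrefl _), if_pos rfl]
          rfl
        rw [hgam, gainCoeff_eq hgm hg0 hε hmono hτ, hP _ le_rfl]
        change _ - _ * (treeDensity f₀ g₀ N ε (a.2 (Fin.last n)).1 ⟨n, (a.1, Fin.init a.2)⟩ * _) = 0
        have hpr : ∀ j : Fin n, (Fin.init a.2 j : Mark).1 ∈ Ioc 0 (a.2 (Fin.last n)).1 := fun j =>
          ⟨hpos (Fin.castSucc (n := n) j), (hmono (Fin.castSucc_lt_last j)).le⟩
        rw [treeDensity_of_times (a := (a.1, Fin.init a.2)) hpr, unhitMass_prune]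
        change ((N.descFactorial (n + 1) : ℕ) : ℝ) * (treeWeight f₀ g₀ ε n (a.1, Fin.init a.2) *
          (ε ^ 2 * max (inner ℝ (endVel ⟨n, (a.1, Fin.init a.2)⟩ - (a.2 (Fin.last n)).2.2)
          ((a.2 (Fin.last n)).2.1 : Vel)) 0 *
          g₀ (flyBack ε (anchor ⟨n, (a.1, Fin.init a.2)⟩) (endVel ⟨n, (a.1, Fin.init a.2)⟩)
          (a.2 (Fin.last n))))) * unhitMass g₀ ε (a.2 (Fin.last n)).1 ⟨n + 1, a⟩ ^ (N - (n + 1)) - _ = 0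
        have hut := (hu (a.2 (Fin.last n)).1 (hIcc (Fin.last n))).ne'
        have hn' : n + 1 ≤ N := hn
        -- Here n counts the collisions of the pruned tree and N = n + 1 + k. The falling factorial
        -- gains the factor N - n = k + 1, and (k + 1)ε² = 1 - γ(τ); the power of the mass drops
        -- from k + 1 to k, which is the division by the free mass.
        obtain ⟨k, rfl⟩ := Nat.exists_eq_add_of_le hn'
        have e1 : n + 1 + k - n = k + 1 := by omega
        have e2 : n + 1 + k - (n + 1) = k := by omega
        have e3 : (1 : ℝ) - n * ε ^ 2 = (k + 1) * ε ^ 2 := by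
          push_cast at hN
          linarith
        rw [Nat.descFactorial_succ, e1, e2, e3, pow_succ]
        push_cast
        field_simp
        ring
      rw [h1]
      refine tendsto_const_nhds.congr' ?_
      filter_upwards [self_mem_nhdsWithin] with s hs
      exact (hP0 s hs.1 hs.2).symm
  · have h1 : ContinuousWithinAt (fun s => unhitMass g₀ ε s Φ) (Icc Φ.tau T) Φ.tau :=
      (tendsto_unhitMass_right ε Φ.tau Φ).mono Icc_subset_Ici_self
    refine ((h1.pow (N - Φ.n)).const_mul (N.descFactorial Φ.n * treeWeight f₀ g₀ ε Φ.n Φ.2)).congr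
      (fun s hs => hP s hs.1) (hP _ le_rfl)

end Equation

/-- A good tree has at most ε^(-1/2) ≤ ε^(-2) = N collisions, so there are enough background
particles for it. -/
theorem CutOffs.le_of_le {V M : ℝ → ℝ} (h : CutOffs V M) {ε : ℝ} (hε : ε ∈ Ioo (0 : ℝ) 1) {n N : ℕ}
    (hN : (N : ℝ) * ε ^ 2 = 1) (hn : (n : ℝ) ≤ M ε) : n ≤ N := by
  have h1 := hn.trans (h.bound ε hε).2
  have h2 : ε ^ 2 ≤ √ε := by
    refine Real.le_sqrt_of_sq_le ?_
    have := pow_le_of_le_one hε.1.le hε.2.le (n := 4) (by norm_num)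
    linarith [show (ε ^ 2) ^ 2 = ε ^ 4 by ring]
  have h3 : (N : ℝ) = 1 / ε ^ 2 := by
    rw [eq_div_iff (pow_ne_zero 2 hε.1.ne')]; exact hN
  have h4 : (n : ℝ) ≤ N := by
    rw [h3]
    exact h1.trans (one_div_le_one_div_of_le (pow_pos hε.1 2) h2)
  exact_mod_cast h4

end RayleighGas

end

theorem mainTheorem4 (T : ℝ) (hT : 0 < T)
    (f₀ g₀ : Phase → ℝ)
    (hf : TaggedAdmissible f₀) (hg : BackgroundAdmissible g₀)
    (V M : ℝ → ℝ) (hVM : CutOffs V M) :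
    ∃ ε₀ > 0, ∃ C : ℝ → ℝ → CollisionTree → ℝ,
      -- the correction to the collision rate vanishes in the limit, for each good tree and each time
      (∀ Φ : CollisionTree, (∃ ε > 0, Φ ∈ goodTrees T V M ε) →
        ∀ t ∈ Ioc Φ.tau T, Tendsto (fun ε => C ε t Φ) (𝓝[>] 0) (𝓝 0)) ∧
      -- it is nonnegative and measures the background particles that would be hit for a second time
      (∀ ε ∈ Ioo 0 ε₀, ∀ Φ ∈ goodTrees T V M ε, ∀ t ∈ Ioc Φ.tau T,
        0 ≤ C ε t Φ ∧
        Tendsto (fun h => (∫ q in hittingTwice ε t h Φ, g₀ q) / (h * ε ^ 2))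
          (𝓝[>] 0) (𝓝 (C ε t Φ)) ∧
        Tendsto (fun h => (∫ q in hittingTwice ε (t - h) h Φ, g₀ q) / (h * ε ^ 2))
          (𝓝[>] 0) (𝓝 (C ε t Φ))) ∧
      -- the empirical distribution in the Boltzmann-Grad scaling
      ∀ (N : ℕ) (ε : ℝ), 0 < ε → ε < ε₀ → (N : ℝ) * ε ^ 2 = 1 →
        (∀ Φ ∈ goodTrees T V M ε, ∀ t ∈ Icc 0 T,
          0 < freeMass g₀ ε t Φ) ∧
        ∃ P : ℝ → CollisionTree → ℝ,
          (∀ t ∈ Icc 0 T, Measurable (P t) ∧ (∀ Φ, 0 ≤ P t Φ) ∧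
            ∀ A : Set CollisionTree, MeasurableSet A → A ⊆ regularTrees T ε t →
              empirical f₀ g₀ N ε t A =
                ∫⁻ Φ in A, ENNReal.ofReal (P t Φ) ∂treeMeasure) ∧
          ∀ Φ ∈ goodTrees T V M ε,
            SolvesEmpirical f₀ g₀ T N ε (C ε) P Φ := by
  obtain ⟨ε₁, hε₁, hlt⟩ := exists_lawOf_compl_avoidSet_lt_one hT hg hVM
  obtain ⟨G, hG⟩ := hg.exists_majorant
  have := hg.isProbabilityMeasure_lawOf
  have hgm := hg.measurable
  have hg0 := hg.nonneg
  -- Below ε₁ good trees leave free mass; 1/8 is what the geometry of the torus requires.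
  refine ⟨min ε₁ (1 / 8), lt_min hε₁ (by norm_num),
    fun ε t Φ => (rehitRate g₀ ε t Φ).toReal, ?_, ?_, ?_⟩
  · rintro Φ ⟨_, -, hΦ⟩ t ht
    exact tendsto_rehitRate hgm hG hΦ.1.1 ht.1
  · intro ε hε Φ hΦ t ht
    have hε8 : ε ≤ 1 / 8 := (hε.2.trans_le (min_le_right _ _)).le
    have h0 : ∀ j, 0 ≤ Φ.time j := fun j => (hΦ.1.2 j).1
    refine ⟨ENNReal.toReal_nonneg, ?_, ?_⟩
    · simp only [setIntegral_eq_lawOf hgm hg0]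
      exact tendsto_hittingTwice hgm hG hε.1 hε8 hΦ.1.1 h0 ht.1 (α := fun _ => t)
        fun h hh => ⟨sub_le_self _ (le_of_lt hh), le_rfl⟩
    · simp only [setIntegral_eq_lawOf hgm hg0]
      exact tendsto_hittingTwice hgm hG hε.1 hε8 hΦ.1.1 h0 ht.1 (α := fun h => t - h)
        fun h hh => ⟨le_rfl, sub_le_self _ (le_of_lt hh)⟩
  · intro N ε hε hεε₀ hN
    have hε8 : ε ≤ 1 / 8 := (hεε₀.trans_le (min_le_right _ _)).le
    have hΦlt := hlt ε ⟨hε, hεε₀.trans_le (min_le_left _ _)⟩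
    refine ⟨fun Φ hΦ t ht => ?_, treeDensity f₀ g₀ N ε, fun t ht => ⟨measurable_treeDensity hf.measurable
      hgm N ε t, treeDensity_nonneg hf.nonneg hg0 N ε t, fun A hA hAr =>
      empirical_eq hf.measurable hgm hf.nonneg hg0 N hε hε8 ht.1 hA hAr⟩, fun Φ hΦ => ?_⟩
    · rw [freeMass_eq hgm hg0, avoiding_eq]
      exact lawOf_avoidSet_pos (hΦlt Φ hΦ) (Ioo_subset_Icc_self.trans (Icc_subset_Icc_right ht.2))
    · obtain ⟨htree, hn, -, -, hover, -⟩ := id hΦ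
      -- Collision times of good trees are strictly positive, as a collision at time 0 would be an
      -- initial overlap; the density formula counts collisions in (0, t] only.
      exact solvesEmpirical hgm hg0 hG hε hε8 hN htree
        (fun j => CollisionTree.time_pos_of_noInitialOverlap hε.le htree hover j)
        (hVM.le_of_le ⟨hε, by linarith⟩ hN hn)
        fun t ht => lawOf_avoidSet_pos (hΦlt Φ hΦ) (Icc_subset_Icc_right ht.2)
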